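/- Let $F$ be a field. Fix an approximation to the diagonal, that is, a natural coassociative chain map $\Delta\colon C_*(X)\to C_*(X)\otimes C_*(X)$ on singular chains with coefficients in $F$ with $\Delta(v)=v\otimes v$ for every $0$-simplex $v$ (for example the Alexander–Whitney map). An $A_\infty$-coalgebra structure on a graded $F$-vector space $C$ is a family of linear maps $\Delta_n\colon C\to C^{\otimes n}$, $n\ge 1$, of degree $n-2$, with $$\sum_{i=1}^{n}\sum_{j=0}^{n-i}(-1)^{i+j+ij}\left(1^{\otimes n-i-j}\otimes\Delta_i\otimes 1^{\otimes j}\right)\Delta_{n-i+1}=0\qquad\text{for all } n\ge 1.$$ It is minimal if $\Delta_1=0$. A morphism $(C,\{\Delta_n\})\to(C',\{\Delta'_n\})$ is a family of linear maps $f_{(k)}\colon C\to C'^{\otimes k}$, $k\ge1$, of degree $k-1$, such that for all $i\ge 1$ $$\sum_{\substack{p+q+k=i\\ q\ge1,\ p,k\ge0}}(-1)^{p+qk}\left(1^{\otimes p}\otimes\Delta'_q\otimes1^{\otimes k}\right)f_{(p+k+1)}=\sum_{\substack{k_1+\dots+k_\ell=i\\ \ell,k_b\ge1}}(-1)^{\sigma}\left(f_{(k_1)}\otimes\dots\otimes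 f_{(k_\ell)}\right)\Delta_\ell,$$ where $\sigma=\sum_b(\ell-b)(k_b-1)+\sum_{a<b}(k_a-1)(k_b-1)$, and tensor products of maps follow the Koszul rule $(f\otimes g)(x\otimes y)=(-1)^{|g||x|}f(x)\otimes g(y)$. It is a quasi-isomorphism if $f_{(1)}$ induces an isomorphism from the homology of $(C,\Delta_1)$ to that of $(C',\Delta'_1)$. Two $A_\infty$-coalgebras are quasi-isomorphic if they are connected by a zigzag of quasi-isomorphisms. For a space $X$ with base point $x_0$, let $\widetilde C_*(X)$ be the kernel of the augmentation $\varepsilon\colon C_*(X)\to F$, let $\pi\colon C_*(X)\to\widetilde C_*(X)$ be $\pi(c)=c-\varepsilon(c)x_0$, and let $\widetilde\Delta=(\pi\otimes\pi)\Delta|_{\widetilde C_*(X)}$ be the reduced diagonal. A transferred $A_\infty$-coalgebra structure on the reduced homology $\widetilde H_*(X)=\widetilde H_*(X;F)$ is a minimal $A_\infty$-coalgebra structure on $\widetilde H_*(X)$ that is quasi-isomorphic to $\left(\widetilde C_*(X),\{\widetilde\partial,\widetilde\Delta,0,0,\dots\}\right)$. For such a structure put $k=\min\{n\ge1\mid\Delta_n\ne0\}$,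 and $k=+\infty$ if all $\Delta_n$ vanish. **Corollary.** (1) Let $\{\Delta_n\}$ and $\{\Delta'_n\}$ be two transferred $A_\infty$-coalgebra structures on the reduced homology of a space $X$ with base point $x_0$, with numbers $k$ and $k'$. Then $k=k'$ and $$\dim\operatorname{Ker}\left(\Delta_m|_{\widetilde H_p(X)}\right)=\dim\operatorname{Ker}\left(\Delta'_m|_{\widetilde H_p(X)}\right)\qquad\text{for all integers } 1\le m\le k,\ p\ge0.$$ (2) These are invariants of the homotopy type: let $h\colon X\to Y$ be a homotopy equivalence of spaces with base points $x_0$, $y_0$ such that $h(x_0)$ and $y_0$ lie in the same path component of $Y$ (which holds automatically if $Y$ is path-connected). If $\{\Delta_n\}$ and $\{\Delta'_n\}$ are transferred structures on $\widetilde H_*(X)$ and $\widetilde H_*(Y)$, with numbers $k$ and $k'$, then $k=k'$ and $\dim\operatorname{Ker}(\Delta_m|_{\widetilde H_p(X)})=\dim\operatorname{Ker}(\Delta'_m|_{\widetilde H_p(Y)})$ for all integers $1\le m\le k$, $p\ge0$. Here dimensions are cardinal numbers; no finiteness of the homology is needed. -/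

import Mathlib

open CategoryTheory TensorProduct DirectSum

universe u v w

noncomputable section

namespace AInfty

/-! ### Graded vector spaces and Koszul signs -/

/-- A `ℤ`-graded vector space `V = (V_d)_{d ∈ ℤ}` over `F`. -/
abbrev GradedSpace (F : Type v) [Field F] := ℤ → ModuleCat.{w} F

section Graded

variable {F : Type v} [Field F]

/-- The total space `⨁_d V_d`. -/
abbrev Total (V : GradedSpace.{v, w} F) : Type w := ⨁ d, V d

/-- The inclusion `V_d → ⨁_d V_d`. -/
abbrev incl (V : GradedSpace.{v, w} F) (d : ℤ) : V d →ₗ[F] Total V :=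
  DirectSum.lof F ℤ (fun d => V d) d

/-- The part of degree `d` of `V^{⊗ n}`: it is spanned by the tensors `x_1 ⊗ ⋯ ⊗ x_n` with
`x_b` homogeneous of degree `p_b` and `p_1 + ⋯ + p_n = d`. -/
def tensorDegree (V : GradedSpace.{v, w} F) (n : ℕ) (d : ℤ) :
    Submodule F (⨂[F]^n (Total V)) :=
  Submodule.span F {t | ∃ (p : Fin n → ℤ) (x : ∀ b, V (p b)), ∑ b, p b = d ∧
    t = PiTensorProduct.tprod F (fun b => incl V (p b) (x b))}

/-- The linear map that sends a homogeneous `x` of degree `d` to `(-1)^{e d} x`. -/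
def signTwist (V : GradedSpace.{v, w} F) (e : ℤ) : Total V →ₗ[F] Total V :=
  DirectSum.toModule F ℤ (Total V) (fun d => (e * d).negOnePow • incl V d)

/-- The inclusion of `V^{⊗ n}` as the word-length `n` part of `T(V) = ⨁_n V^{⊗ n}`. -/
abbrev word (V : GradedSpace.{v, w} F) (n : ℕ) :
    ⨂[F]^n (Total V) →ₗ[F] TensorAlgebra F (Total V) :=
  TensorPower.toTensorAlgebra

/-- The tensor product `g_1 ⊗ ⋯ ⊗ g_l` of linear maps `g_b : V → T(W)` of degrees `e_b`
(with concatenation `T(W) ⊗ ⋯ ⊗ T(W) → T(W)` applied to the result), with the Koszul sign: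
`x_1 ⊗ ⋯ ⊗ x_l` goes to `(-1)^ε g_1(x_1) ⋯ g_l(x_l)`, where `ε` is the sum of `e_c |x_b|` over
`b < c`. -/
def koszulTensor {V W : GradedSpace.{v, w} F} {l : ℕ} (e : Fin l → ℤ)
    (g : Fin l → (Total V →ₗ[F] TensorAlgebra F (Total W))) :
    ⨂[F]^l (Total V) →ₗ[F] TensorAlgebra F (Total W) :=
  PiTensorProduct.lift
    ((MultilinearMap.mkPiAlgebraFin F l (TensorAlgebra F (Total W))).compLinearMap
      (fun b => g b ∘ₗ signTwist V (∑ c ∈ Finset.Ioi b, e c)))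

/-! ### A∞-coalgebras -/

/-- A family of linear maps `V → W^{⊗ n}`, `n ≥ 1`. The index `n = 0` is not used; wherever
laws are imposed, the value there is required to vanish. -/
abbrev Ops (V W : GradedSpace.{v, w} F) := (n : ℕ) → (Total V →ₗ[F] ⨂[F]^n (Total W))

/-- The map `1^{⊗ a} ⊗ Δ_i ⊗ 1^{⊗ j} : V^{⊗ (a + 1 + j)} → V^{⊗ (a + i + j)} ⊆ T(V)`, with the
Koszul sign, where `Δ_i` has degree `i - 2`. -/
def insertOp {V : GradedSpace.{v, w} F} (Δ : Ops V V) (a i j : ℕ) :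
    ⨂[F]^(a + 1 + j) (Total V) →ₗ[F] TensorAlgebra F (Total V) :=
  koszulTensor (fun b => if (b : ℕ) = a then (i : ℤ) - 2 else 0)
    (fun b => if (b : ℕ) = a then word V i ∘ₗ Δ i else TensorAlgebra.ι F)

/-- `{Δ_n}_{n ≥ 1}` is an A∞-coalgebra structure on `V`. -/
structure IsCoalgebra {V : GradedSpace.{v, w} F} (Δ : Ops V V) : Prop where
  zero : Δ 0 = 0
  /-- `Δ_n` has degree `n - 2`. -/
  degree : ∀ n, 1 ≤ n → ∀ (p : ℤ) (x : V p), Δ n (incl V p x) ∈ tensorDegree V n (p + n - 2)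
  /-- The Stasheff identities. -/
  stasheff : ∀ n, 1 ≤ n →
    ∑ i ∈ Finset.Icc 1 n, ∑ j ∈ Finset.range (n - i + 1),
      (-1 : F) ^ (i + j + i * j) • (insertOp Δ (n - i - j) i j ∘ₗ Δ (n - i - j + 1 + j)) = 0

/-- The A∞-coalgebra is minimal: `Δ_1 = 0`. -/
def IsMinimal {V : GradedSpace.{v, w} F} (Δ : Ops V V) : Prop := Δ 1 = 0

/-- The exponent of the sign of `(f_{k_1} ⊗ ⋯ ⊗ f_{k_l}) Δ_l` in the identities for morphisms:
with `e_b = k_b - 1` it is `∑_b (l - b) e_b + ∑_{a < b} e_a e_b`. -/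
def morphismSign {i : ℕ} (c : Composition i) : ℕ :=
  ∑ b : Fin c.length, (c.length - 1 - b) * (c.blocksFun b - 1) +
    ∑ b : Fin c.length, ∑ a ∈ Finset.Iio b, (c.blocksFun a - 1) * (c.blocksFun b - 1)

/-- `{f_(k)}_{k ≥ 1}` is a morphism of A∞-coalgebras `(V, Δ) → (W, Δ')`. The signs are those for
which this says that the induced map of (completed) cobar constructions commutes with the
differentials. -/
structure IsMorphism {V W : GradedSpace.{v, w} F} (Δ : Ops V V) (Δ' : Ops W W)
    (f : Ops V W) : Prop where
  zero : f 0 = 0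
  /-- `f_(k)` has degree `k - 1`. -/
  degree : ∀ k, 1 ≤ k → ∀ (p : ℤ) (x : V p), f k (incl V p x) ∈ tensorDegree W k (p + k - 1)
  /-- The sum of `±(1^{⊗ p} ⊗ Δ'_q ⊗ 1^{⊗ k}) f_(p+k+1)` over `p + q + k = i`, `q ≥ 1`, equals
  the sum of `±(f_(k_1) ⊗ ⋯ ⊗ f_(k_l)) Δ_l` over `k_1 + ⋯ + k_l = i`, `k_b ≥ 1`. -/
  identity : ∀ i, 1 ≤ i →
    ∑ q ∈ Finset.Icc 1 i, ∑ k ∈ Finset.range (i - q + 1),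
      (-1 : F) ^ ((i - q - k) + q * k) •
        (insertOp Δ' (i - q - k) q k ∘ₗ f (i - q - k + 1 + k)) =
    ∑ c : Composition i, (-1 : F) ^ morphismSign c •
      (koszulTensor (fun b => (c.blocksFun b : ℤ) - 1)
        (fun b => word W (c.blocksFun b) ∘ₗ f (c.blocksFun b)) ∘ₗ Δ c.length)

/-- The first map of a family, seen as a linear map `V → W` through `W^{⊗ 1} = W`. -/
def linearPart {V W : GradedSpace.{v, w} F} (f : Ops V W) : Total V →ₗ[F] Total W :=
  (PiTensorProduct.subsingletonEquiv (R := F) (s := fun _ : Fin 1 => Total W) 0).toLinearMap ∘ₗ f 1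

/-- `f` is a quasi-isomorphism `(V, Δ) → (W, Δ')`: a morphism such that `f_(1)` induces a
bijection from the homology of `(V, Δ_1)` to the homology of `(W, Δ'_1)`. -/
structure IsQuasiIso {V W : GradedSpace.{v, w} F} (Δ : Ops V V) (Δ' : Ops W W)
    (f : Ops V W) : Prop where
  morphism : IsMorphism Δ Δ' f
  injective : ∀ x, linearPart Δ x = 0 → (∃ y, linearPart Δ' y = linearPart f x) →
    ∃ z, linearPart Δ z = x
  surjective : ∀ y, linearPart Δ' y = 0 →
    ∃ x, linearPart Δ x = 0 ∧ ∃ z, linearPart Δ' z = y - linearPart f x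

/-- Two A∞-coalgebras are quasi-isomorphic if they are connected by a zigzag of
quasi-isomorphisms of A∞-coalgebras. -/
def QuasiIsomorphic {V W : GradedSpace.{v, w} F} (Δ : Ops V V) (Δ' : Ops W W) : Prop :=
  Relation.EqvGen
    (fun A B : (Σ U : GradedSpace.{v, w} F, Ops U U) =>
      IsCoalgebra A.2 ∧ IsCoalgebra B.2 ∧ ∃ f : Ops A.1 B.1, IsQuasiIso A.2 B.2 f)
    ⟨V, Δ⟩ ⟨W, Δ'⟩

/-- The smallest `n ≥ 1` with `Δ_n ≠ 0`, and `+∞` if there is none. -/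
def firstNonzero {V : GradedSpace.{v, w} F} (Δ : Ops V V) : ℕ∞ :=
  sInf {k : ℕ∞ | ∃ n : ℕ, 1 ≤ n ∧ Δ n ≠ 0 ∧ k = n}

/-- `Ker (Δ_m restricted to V_p)`. -/
def kerAt {V : GradedSpace.{v, w} F} (Δ : Ops V V) (m : ℕ) (p : ℤ) : Submodule F (V p) :=
  LinearMap.ker (Δ m ∘ₗ incl V p)

end Graded

/-! ### Singular chains -/

section Chains

variable (F : Type v) [Field F]

/-- The set of `n`-simplices of a simplicial set. -/
abbrev Simplex (K : SSet.{u}) (n : ℕ) : Type u := K.obj (Opposite.op (SimplexCategory.mk n))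

/-- The total space of the (unnormalized) chains of a simplicial set: the vector space on all
simplices. -/
abbrev SChain (K : SSet.{u}) : Type (max u v) := (Σ n : ℕ, Simplex K n) →₀ F

variable {K L : SSet.{u}}

/-- A simplex as a chain. -/
abbrev simplex {n : ℕ} (σ : Simplex K n) : SChain F K := Finsupp.single ⟨n, σ⟩ 1

/-- The boundary of a simplex, `∂σ = ∑ (-1)^i d_i σ`. -/
def boundarySimplex : (Σ n : ℕ, Simplex K n) → SChain F K
  | ⟨0, _⟩ => 0
  | ⟨n + 1, σ⟩ => ∑ i : Fin (n + 2), (-1 : F) ^ (i : ℕ) • simplex F (K.δ i σ)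

/-- The boundary operator. -/
def boundary (K : SSet.{u}) : SChain F K →ₗ[F] SChain F K :=
  Finsupp.linearCombination F (boundarySimplex F)

/-- The augmentation: vertices go to `1`, simplices of positive dimension to `0`. -/
def augmentation (K : SSet.{u}) : SChain F K →ₗ[F] F :=
  Finsupp.linearCombination F (fun s => if s.1 = 0 then 1 else 0)

/-- The linear map that sends a chain `c` of degree `n` to `(-1)^n c`. -/
def chainSign (K : SSet.{u}) : SChain F K →ₗ[F] SChain F K :=
  Finsupp.linearCombination F (fun s => (-1 : F) ^ s.1 • simplex F s.2)

/-- The map of chains induced by a simplicial map. -/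
def chainMap (f : K ⟶ L) : SChain F K →ₗ[F] SChain F L :=
  Finsupp.lmapDomain F F (fun s => ⟨s.1, f.app _ s.2⟩)

/-- The Alexander–Whitney diagonal
`σ ↦ ∑_i σ|[0, …, i] ⊗ σ|[i, …, n]`. -/
def awMap (K : SSet.{u}) : SChain F K →ₗ[F] SChain F K ⊗[F] SChain F K :=
  Finsupp.linearCombination F (fun s => ∑ i : Fin (s.1 + 1),
    simplex F (K.map (SimplexCategory.subinterval 0 i (by omega)).op s.2) ⊗ₜ[F]
      simplex F (K.map (SimplexCategory.subinterval i (s.1 - i) (by omega)).op s.2))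

/-- The singular chains of `X` with coefficients in `F` (all degrees together). -/
abbrev Sing (X : TopCat.{u}) : Type (max u v) := SChain F (TopCat.toSSet.obj X)

/-- An approximation to the diagonal that makes singular chains a differential graded coalgebra:
a natural chain map `S(X) → S(X) ⊗ S(X)` of degree `0`, with `v ↦ v ⊗ v` for every singular
`0`-simplex `v`, that is coassociative. -/
structure DiagonalApproximation where
  map (X : TopCat.{u}) : Sing F X →ₗ[F] Sing F X ⊗[F] Sing F X
  natural : ∀ {X Y : TopCat.{u}} (f : X ⟶ Y),
    TensorProduct.map (chainMap F (TopCat.toSSet.map f)) (chainMap F (TopCat.toSSet.map f)) ∘ₗ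
      map X = map Y ∘ₗ chainMap F (TopCat.toSSet.map f)
  degree : ∀ (X : TopCat.{u}) (n : ℕ) (σ : Simplex (TopCat.toSSet.obj X) n),
    map X (simplex F σ) ∈ Submodule.span F
      {t | ∃ (i j : ℕ) (α : Simplex (TopCat.toSSet.obj X) i) (β : Simplex (TopCat.toSSet.obj X) j),
        i + j = n ∧ t = simplex F α ⊗ₜ[F] simplex F β}
  chain : ∀ X : TopCat.{u}, map X ∘ₗ boundary F _ =
    (TensorProduct.map (boundary F _) LinearMap.id +
      TensorProduct.map (chainSign F _) (boundary F _)) ∘ₗ map X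
  coassoc : ∀ X : TopCat.{u},
    (TensorProduct.assoc F _ _ _).toLinearMap ∘ₗ
      TensorProduct.map (map X) LinearMap.id ∘ₗ map X =
    TensorProduct.map LinearMap.id (map X) ∘ₗ map X
  vertex : ∀ (X : TopCat.{u}) (v : Simplex (TopCat.toSSet.obj X) 0),
    map X (simplex F v) = simplex F v ⊗ₜ[F] simplex F v

end Chains

/-! ### The Alexander–Whitney diagonal -/

section AlexanderWhitney

variable (F : Type v) [Field F] {K L : SSet.{u}}

/-- For a monotone `f : ℕ → ℕ`, the simplex of dimension `m` with vertices
`f 0, f 1, …, f m` (cut off at `n`) of an `n`-simplex `σ`. -/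
def face {n : ℕ} (σ : Simplex K n) (m : ℕ) (f : ℕ →o ℕ) : SChain F K :=
  simplex F (K.map (SimplexCategory.mkHom (n := m) (m := n)
    ⟨fun k => ⟨min n (f k), by omega⟩, fun a b h => by
      have := f.monotone (show (a : ℕ) ≤ b from h)
      simp only [Fin.mk_le_mk]
      omega⟩).op σ)

theorem face_congr {n : ℕ} (σ : Simplex K n) {m m' : ℕ} (hm : m = m') {f g : ℕ →o ℕ}
    (h : ∀ k, k ≤ m → min n (f k) = min n (g k)) : face F σ m f = face F σ m' g := by
  subst hm
  unfold face
  congr 5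
  ext k
  exact h k (Nat.lt_succ_iff.mp k.isLt)

/-- The order-preserving map that misses `j`. -/
def skip (j : ℕ) : ℕ →o ℕ := ⟨fun k => if k < j then k else k + 1, fun a b h => by
  dsimp only
  split_ifs <;> omega⟩

/-- The translation by `i`. -/
def shift (i : ℕ) : ℕ →o ℕ := ⟨fun k => i + k, fun a b h => by
  dsimp only
  omega⟩

theorem skip_apply (j k : ℕ) : skip j k = if k < j then k else k + 1 := rfl

theorem shift_apply (i k : ℕ) : shift i k = i + k := rfl

theorem map_simplex_face {n m p : ℕ} (σ : Simplex K n) (f g : ℕ →o ℕ)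
    (φ : SimplexCategory.mk p ⟶ SimplexCategory.mk m)
    (h : ∀ k : Fin (p + 1), ((φ.toOrderHom k : Fin (m + 1)) : ℕ) = g k)
    (ψ : SimplexCategory.mk m ⟶ SimplexCategory.mk n)
    (hψ : ∀ k : Fin (m + 1), ((ψ.toOrderHom k : Fin (n + 1)) : ℕ) = min n (f k)) :
    simplex F (K.map φ.op (K.map ψ.op σ)) = face F σ p (f.comp g) := by
  unfold face
  rw [← CategoryTheory.comp_apply, ← K.map_comp, ← op_comp]
  congr 5
  ext k
  have h1 := hψ (φ.toOrderHom k)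
  rw [h] at h1
  exact h1

theorem simplex_eq_face {n : ℕ} (σ : Simplex K n) :
    simplex F σ = face F σ n OrderHom.id := by
  have := map_simplex_face F σ OrderHom.id OrderHom.id (𝟙 _) (fun k => rfl) (𝟙 _)
    (fun k => by
      have := k.isLt
      simp
      omega)
  simpa using this

theorem boundary_face {n : ℕ} (σ : Simplex K n) (m : ℕ) (f : ℕ →o ℕ) :
    boundary F K (face F σ (m + 1) f) =
      ∑ j ∈ Finset.range (m + 2), (-1 : F) ^ j • face F σ m (f.comp (skip j)) := by
  rw [Finset.sum_range]
  unfold face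
  simp only [boundary, Finsupp.linearCombination_single, one_smul, boundarySimplex]
  refine Finset.sum_congr rfl fun j _ => ?_
  congr 1
  refine map_simplex_face F σ f (skip j) (SimplexCategory.δ j) (fun k => ?_) _ (fun k => rfl)
  change ((Fin.succAbove j k : Fin (m + 2)) : ℕ) = if (k : ℕ) < j then (k : ℕ) else k + 1
  simp only [Fin.succAbove, Fin.lt_def, Fin.val_castSucc]
  split_ifs <;> rfl

theorem boundary_face_zero {n : ℕ} (σ : Simplex K n) (f : ℕ →o ℕ) :
    boundary F K (face F σ 0 f) = 0 := by
  simp [face, boundary, boundarySimplex]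

theorem chainSign_face {n : ℕ} (σ : Simplex K n) (m : ℕ) (f : ℕ →o ℕ) :
    chainSign F K (face F σ m f) = (-1 : F) ^ m • face F σ m f := by
  simp [face, chainSign]

theorem awMap_face {n : ℕ} (σ : Simplex K n) (m : ℕ) (f : ℕ →o ℕ) :
    awMap F K (face F σ m f) = ∑ i ∈ Finset.range (m + 1),
      face F σ i f ⊗ₜ[F] face F σ (m - i) (f.comp (shift i)) := by
  rw [Finset.sum_range]
  conv_lhs => unfold face
  simp only [awMap, Finsupp.linearCombination_single, one_smul]
  refine Finset.sum_congr rfl fun i _ => ?_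
  congr 1
  · refine (map_simplex_face F σ f OrderHom.id _ (fun k => ?_) _ (fun k => rfl)).trans rfl
    simp [SimplexCategory.subinterval]
  · refine map_simplex_face F σ f (shift i) _ (fun k => ?_) _ (fun k => rfl)
    simp [SimplexCategory.subinterval, shift, add_comm]

theorem chain_hom_ext {M : Type w} [AddCommMonoid M] [Module F M] {g h : SChain F K →ₗ[F] M}
    (H : ∀ (n : ℕ) (σ : Simplex K n), g (face F σ n OrderHom.id) = h (face F σ n OrderHom.id)) :
    g = h := by
  refine Finsupp.lhom_ext' fun s => LinearMap.ext_ring ?_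
  obtain ⟨n, σ⟩ := s
  have := H n σ
  rw [← simplex_eq_face] at this
  exact this

theorem awMap_coassoc (K : SSet.{u}) :
    (TensorProduct.assoc F _ _ _).toLinearMap ∘ₗ
      TensorProduct.map (awMap F K) LinearMap.id ∘ₗ awMap F K =
    TensorProduct.map LinearMap.id (awMap F K) ∘ₗ awMap F K := by
  apply chain_hom_ext
  intro n σ
  simp only [LinearMap.comp_apply, awMap_face, map_sum, TensorProduct.map_tmul, LinearMap.id_apply,
    TensorProduct.sum_tmul, TensorProduct.tmul_sum, LinearEquiv.coe_coe, TensorProduct.assoc_tmul]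
  have key := Finset.sum_range_diag_flip (n + 1) (fun a b =>
    face F σ a OrderHom.id ⊗ₜ[F] (face F σ b (shift a) ⊗ₜ[F] face F σ (n - a - b) (shift (a + b))))
  refine Eq.trans (Finset.sum_congr rfl fun i hi => Finset.sum_congr rfl fun a ha => ?_)
    (key.trans (Finset.sum_congr rfl fun a ha => ?_))
  · rw [Finset.mem_range] at hi ha
    have h1 : n - i = n - a - (i - a) := by omega
    have h2 : a + (i - a) = i := by omega
    dsimp only
    rw [h2, ← face_congr F σ h1 (f := OrderHom.id.comp (shift i)) (g := shift i) fun k _ => rfl]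
    rfl
  · rw [Finset.mem_range] at ha
    have h1 : n - a + 1 = n + 1 - a := by omega
    rw [h1]
    refine Finset.sum_congr rfl fun b hb => ?_
    rw [face_congr F σ rfl (f := (OrderHom.id.comp (shift a)).comp (shift b)) (g := shift (a + b))
      fun k _ => by simp [shift_apply, add_assoc]]
    rfl

theorem awMap_chain (K : SSet.{u}) : awMap F K ∘ₗ boundary F K =
    (TensorProduct.map (boundary F K) LinearMap.id +
      TensorProduct.map (chainSign F K) (boundary F K)) ∘ₗ awMap F K := by
  apply chain_hom_ext
  intro n σ
  rcases n with _ | N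
  · simp [awMap_face, boundary_face_zero]
  have hL : ∀ i ∈ Finset.range (N + 1), ∑ j ∈ Finset.range (N + 2), (-1 : F) ^ j •
        (face F σ i (skip j) ⊗ₜ[F] face F σ (N - i) ((skip j).comp (shift i))) =
      (∑ j ∈ Finset.range (i + 1), (-1 : F) ^ j •
        (face F σ i (skip j) ⊗ₜ[F] face F σ (N - i) (shift (i + 1)))) +
      ∑ l ∈ Finset.range (N - i + 1), (-1 : F) ^ (i + (l + 1)) •
        (face F σ i OrderHom.id ⊗ₜ[F] face F σ (N - i) ((shift i).comp (skip (l + 1)))) := by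
    intro i hi
    rw [Finset.mem_range] at hi
    have h1 : N + 2 = (i + 1) + (N - i + 1) := by omega
    rw [h1, Finset.sum_range_add]
    congr 1
    · refine Finset.sum_congr rfl fun j hj => ?_
      rw [Finset.mem_range] at hj
      rw [face_congr F σ rfl (f := (skip j).comp (shift i)) (g := shift (i + 1)) fun k _ => by
        have : ¬ (i + k < j) := by omega
        simp [shift_apply, skip_apply, this]
        omega]
    · refine Finset.sum_congr rfl fun l hl => ?_
      have h2 : i + 1 + l = i + (l + 1) := by omega
      rw [h2, face_congr F σ rfl (f := skip (i + (l + 1))) (g := OrderHom.id) fun k hk => by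
        have : k < i + (l + 1) := by omega
        simp [skip_apply, this],
        face_congr F σ rfl (f := (skip (i + (l + 1))).comp (shift i))
          (g := (shift i).comp (skip (l + 1))) fun k _ => by
        simp [shift_apply, skip_apply]
        split_ifs <;> omega]
  have lhs : awMap F K (boundary F K (face F σ (N + 1) OrderHom.id)) =
      ∑ i ∈ Finset.range (N + 1), ∑ j ∈ Finset.range (N + 2), (-1 : F) ^ j •
        (face F σ i (skip j) ⊗ₜ[F] face F σ (N - i) ((skip j).comp (shift i))) := by
    rw [boundary_face, map_sum, Finset.sum_comm]
    refine Finset.sum_congr rfl fun j _ => ?_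
    rw [map_smul, awMap_face, Finset.smul_sum]
    rfl
  have rhs1 : TensorProduct.map (boundary F K) LinearMap.id
        (awMap F K (face F σ (N + 1) OrderHom.id)) =
      ∑ i ∈ Finset.range (N + 1), ((∑ j ∈ Finset.range (i + 1), (-1 : F) ^ j •
        (face F σ i (skip j) ⊗ₜ[F] face F σ (N - i) (shift (i + 1)))) +
        (-1 : F) ^ (i + 1) • (face F σ i OrderHom.id ⊗ₜ[F] face F σ (N - i) (shift (i + 1)))) := by
    rw [awMap_face, map_sum, Finset.sum_range_succ']
    simp only [TensorProduct.map_tmul, boundary_face_zero, TensorProduct.zero_tmul, add_zero,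
      LinearMap.id_apply]
    refine Finset.sum_congr rfl fun i hi => ?_
    rw [boundary_face, TensorProduct.sum_tmul, Finset.sum_range_succ]
    simp only [TensorProduct.smul_tmul']
    have h1 : N + 1 - (i + 1) = N - i := by omega
    rw [face_congr F σ rfl (f := OrderHom.id.comp (skip (i + 1))) (g := OrderHom.id) fun k hk => by
      have : k < i + 1 := by omega
      simp [skip_apply, this], h1]
    rfl
  have rhs2 : TensorProduct.map (chainSign F K) (boundary F K)
        (awMap F K (face F σ (N + 1) OrderHom.id)) =
      ∑ i ∈ Finset.range (N + 1), ((∑ l ∈ Finset.range (N - i + 1), (-1 : F) ^ (i + (l + 1)) •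
        (face F σ i OrderHom.id ⊗ₜ[F] face F σ (N - i) ((shift i).comp (skip (l + 1))))) +
        (-1 : F) ^ i • (face F σ i OrderHom.id ⊗ₜ[F] face F σ (N - i) (shift (i + 1)))) := by
    rw [awMap_face, map_sum, Finset.sum_range_succ]
    simp only [TensorProduct.map_tmul, Nat.sub_self, boundary_face_zero, TensorProduct.tmul_zero,
      add_zero, chainSign_face]
    refine Finset.sum_congr rfl fun i hi => ?_
    rw [Finset.mem_range] at hi
    have h1 : N + 1 - i = N - i + 1 := by omega
    rw [h1, boundary_face, TensorProduct.tmul_sum, Finset.sum_range_succ']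
    rw [face_congr F σ rfl (f := (OrderHom.id.comp (shift i)).comp (skip 0)) (g := shift (i + 1))
      fun k hk => by
        simp [shift_apply, skip_apply]
        omega]
    simp only [TensorProduct.tmul_smul, TensorProduct.smul_tmul', smul_smul, ← pow_add, pow_zero, one_smul]
    congr 1
    refine Finset.sum_congr rfl fun l _ => ?_
    rw [add_comm (l + 1) i]
    rfl
  rw [LinearMap.comp_apply, LinearMap.comp_apply, LinearMap.add_apply, lhs, rhs1, rhs2,
    ← Finset.sum_add_distrib]
  refine Finset.sum_congr rfl fun i hi => ?_
  have h0 : (-1 : F) ^ (i + 1) + (-1 : F) ^ i = 0 := by ring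
  rw [hL i hi, add_add_add_comm, add_comm ((-1 : F) ^ (i + 1) • _), ← add_smul,
    add_comm ((-1 : F) ^ i), h0, zero_smul, add_zero]

theorem chainMap_face (φ : K ⟶ L) {n : ℕ} (σ : Simplex K n) (m : ℕ) (f : ℕ →o ℕ) :
    chainMap F φ (face F σ m f) = face F (φ.app _ σ) m f := by
  unfold face
  simp only [chainMap, Finsupp.lmapDomain_apply, Finsupp.mapDomain_single]
  congr 2
  exact NatTrans.naturality_apply φ _ σ

theorem awMap_natural (φ : K ⟶ L) :
    TensorProduct.map (chainMap F φ) (chainMap F φ) ∘ₗ awMap F K =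
      awMap F L ∘ₗ chainMap F φ := by
  apply chain_hom_ext
  intro n σ
  simp only [LinearMap.comp_apply, chainMap_face, awMap_face, map_sum, TensorProduct.map_tmul]

/-- The Alexander–Whitney diagonal is an approximation to the diagonal. -/
def alexanderWhitney : DiagonalApproximation.{u, v} F where
  map X := awMap F (TopCat.toSSet.obj X)
  natural f := awMap_natural F (TopCat.toSSet.map f)
  degree X n σ := by
    simp only [awMap, Finsupp.linearCombination_single, one_smul]
    exact Submodule.sum_mem _ fun i _ => Submodule.subset_span ⟨i, n - i, _, _, by omega, rfl⟩
  chain X := awMap_chain F _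
  coassoc X := awMap_coassoc F _
  vertex X v := by
    rw [simplex_eq_face, awMap_face]
    simp only [zero_add, Finset.range_one, Finset.sum_singleton]
    rw [face_congr F v (m := 0 - 0) (m' := 0) rfl (f := OrderHom.id.comp (shift 0))
      (g := OrderHom.id) fun k _ => by simp [shift_apply]]

end AlexanderWhitney

/-! ### Reduced singular chains and reduced homology -/

section Reduced

variable (F : Type v) [Field F] (X : TopCat.{u})

/-- The reduced singular chains of degree `d`: the chains of degree `d` in the kernel of the
augmentation. -/
def reducedSub (d : ℤ) : Submodule F (Sing F X) :=
  Finsupp.supported F F {s | (s.1 : ℤ) = d} ⊓ LinearMap.ker (augmentation F _)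

/-- The graded vector space of reduced singular chains. -/
def reducedChains : GradedSpace.{v, max u v} F := fun d => ModuleCat.of F (reducedSub F X d)

/-- The inclusion of reduced chains into chains. -/
def reducedIncl : Total (reducedChains F X) →ₗ[F] Sing F X :=
  DirectSum.toModule F ℤ _ (fun d => (reducedSub F X d).subtype)

variable {X}

/-- The base point as a singular `0`-simplex. -/
abbrev basepoint (x₀ : X) : Simplex (TopCat.toSSet.obj X) 0 := TopCat.toSSetObj₀Equiv.symm x₀

/-- The projection `c ↦ c - ε(c) x₀` of chains onto reduced chains, with kernel spanned by the
base point. -/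
def reducedProj (x₀ : X) : Sing F X →ₗ[F] Total (reducedChains F X) :=
  Finsupp.linearCombination F (fun s => incl (reducedChains F X) s.1
    ⟨simplex F s.2 - augmentation F _ (simplex F s.2) • simplex F (basepoint x₀), by
      obtain ⟨n, σ⟩ := s
      refine ⟨?_, ?_⟩
      · refine Submodule.sub_mem _ (Finsupp.single_mem_supported F _ rfl) ?_
        rcases Nat.eq_zero_or_pos n with rfl | hn
        · exact Submodule.smul_mem _ _ (Finsupp.single_mem_supported F _ rfl)
        · simp [augmentation, hn.ne']
      · rcases Nat.eq_zero_or_pos n with rfl | hn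
        · simp [augmentation]
        · simp [augmentation, hn.ne']⟩)

/-- `C ⊗ C` as the tensor power `C^{⊗ 2}`. -/
def tensorSquare (C : Type w) [AddCommGroup C] [Module F C] : C ⊗[F] C →ₗ[F] ⨂[F]^2 C :=
  (TensorPower.mulEquiv (R := F) (M := C) (n := 1) (m := 1)).toLinearMap ∘ₗ
    TensorProduct.map
      (PiTensorProduct.subsingletonEquiv (R := F) (s := fun _ : Fin 1 => C) 0).symm.toLinearMap
      (PiTensorProduct.subsingletonEquiv (R := F) (s := fun _ : Fin 1 => C) 0).symm.toLinearMap

/-- The reduced singular coalgebra `(C̃(X), {∂, Δ, 0, 0, …})` of the pointed space `(X, x₀)`. -/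
def reducedOps (D : DiagonalApproximation.{u, v} F) (x₀ : X) :
    Ops (reducedChains F X) (reducedChains F X)
  | 1 => (PiTensorProduct.subsingletonEquiv (R := F)
      (s := fun _ : Fin 1 => Total (reducedChains F X)) 0).symm.toLinearMap ∘ₗ
        reducedProj F x₀ ∘ₗ boundary F _ ∘ₗ reducedIncl F X
  | 2 => tensorSquare F _ ∘ₗ TensorProduct.map (reducedProj F x₀) (reducedProj F x₀) ∘ₗ
      D.map X ∘ₗ reducedIncl F X
  | _ => 0

variable (X)

/-- The cycles among the reduced singular chains of degree `d`. -/
def reducedCycles (d : ℤ) : Submodule F (reducedChains F X d) :=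
  LinearMap.ker (boundary F _ ∘ₗ (reducedSub F X d).subtype)

/-- The boundaries of reduced singular chains of degree `d + 1`, as a subspace of the cycles of
degree `d`. -/
def reducedBoundaries (d : ℤ) : Submodule F (reducedCycles F X d) :=
  ((reducedSub F X (d + 1)).map (boundary F _)).comap
    ((reducedSub F X d).subtype ∘ₗ (reducedCycles F X d).subtype)

/-- The reduced singular homology `H̃_*(X; F)`, a graded vector space. -/
def reducedHomology : GradedSpace.{v, max u v} F := fun d =>
  ModuleCat.of F (reducedCycles F X d ⧸ reducedBoundaries F X d)

variable {X F}

/-- `{Δ_n}` is a transferred A∞-coalgebra structure on the reduced homology of the pointed space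
`(X, x₀)`: a minimal A∞-coalgebra structure that is quasi-isomorphic to the reduced singular
coalgebra. -/
structure IsTransferred (D : DiagonalApproximation.{u, v} F) (x₀ : X)
    (Δ : Ops (reducedHomology F X) (reducedHomology F X)) : Prop where
  coalgebra : IsCoalgebra Δ
  minimal : IsMinimal Δ
  quasiIso : QuasiIsomorphic Δ (reducedOps F D x₀)

end Reduced

end AInfty

end

/-! An A∞-coalgebra structure on V amounts to a differential D on the tensor algebra of the
desuspension of V, completed by word length (the cobar construction), and a morphism to a
multiplicative chain map Φ. The completion is avoided by computing modulo I^(m+1), where I is the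
augmentation ideal: only finitely many operations then matter.

The invariant is an obstruction. A cycle x extends at stage m if D(x + c) ∈ I^(m+1) for some c ∈ I²
(`Extends`). Two facts about it prove the theorem.

(a) If the coalgebra is minimal and Δ_n = 0 for n < m, then D lengthens words by at least m − 1. So
D c ∈ I^(m+1) for every c ∈ I², while D x agrees modulo I^(m+1) with Δ_m x up to desuspension signs.
Hence x extends exactly if Δ_m x = 0 (`extends_iff_of_vanishing`). For m ≤ k the kernel of Δ_m is
therefore the space of extendable classes, and m < k holds exactly if everything extends at all
stages from 1 to m.

(b) A quasi-isomorphism preserves and reflects extendability of cycles (`extends_iff`), because the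
cone of Φ is acyclic modulo I^(m+1). This is proved along the filtration by powers of I
(`cone_level`, `cone_acyclic`). On a graded piece Φ is a tensor power of its linear part f. Over a
field f has a homotopy inverse (`exists_homotopyInverse`), and tensor powers of homotopy
equivalences are homotopy equivalences (`cobar_homotopy`). A zigzag is thus handled arrow by arrow,
without inverting A∞-morphisms.

Signs depend only on the parity of degrees, which is recorded by an involution t. The operator
`desusp` inserts the desuspension signs. With it the Stasheff and morphism identities become D² = 0
and DΦ = ΦD (`IsCoalgebra.isCobar`, `IsMorphism.isCobarMap`).

For part (2), a homotopy equivalence h induces a strict coalgebra map from the reduced chains at x₀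
to those at h(x₀), to which (b) applies. The base point is then moved from h(x₀) to y₀ through the
path space (`sameInvariants_of_joined`). -/

noncomputable section

namespace AInfty

/-! ### Skew derivations of tensor algebras -/

section SkewDerivation

variable {F : Type*} [Field F] {M N : Type*} [AddCommGroup M] [Module F M]
  [AddCommGroup N] [Module F N]

open TensorAlgebra

/-- The augmentation ideal of the tensor algebra. -/
def augIdeal (F M : Type*) [Field F] [AddCommGroup M] [Module F M] :
    Submodule F (TensorAlgebra F M) :=
  LinearMap.ker (algebraMapInv (R := F) (M := M)).toLinearMap

theorem mem_augIdeal {u : TensorAlgebra F M} :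
    u ∈ augIdeal F M ↔ algebraMapInv u = 0 := Iff.rfl

theorem ι_mem_augIdeal (x : M) : ι F x ∈ augIdeal F M := by
  simp [mem_augIdeal, algebraMapInv]

theorem mul_mem_augIdeal_left (u : TensorAlgebra F M) {v : TensorAlgebra F M}
    (hv : v ∈ augIdeal F M) : u * v ∈ augIdeal F M := by
  rw [mem_augIdeal] at *
  rw [map_mul, hv, mul_zero]

theorem mul_mem_augIdeal_right {u : TensorAlgebra F M} (v : TensorAlgebra F M)
    (hu : u ∈ augIdeal F M) : u * v ∈ augIdeal F M := by
  rw [mem_augIdeal] at *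
  rw [map_mul, hu, zero_mul]

theorem mul_mem_augIdeal_pow {i j : ℕ} {u v : TensorAlgebra F M}
    (hu : u ∈ augIdeal F M ^ i) (hv : v ∈ augIdeal F M ^ j) :
    u * v ∈ augIdeal F M ^ (i + j) := by
  rw [pow_add]
  exact Submodule.mul_mem_mul hu hv

/-- These are powers of a submodule, so the zeroth power is the line of scalars and not the whole
algebra. Being an ideal, and decreasing with the exponent, therefore require positive exponents. -/
theorem augIdeal_pow_mul_left {k : ℕ} (hk : 1 ≤ k) (u : TensorAlgebra F M)
    {v : TensorAlgebra F M} (hv : v ∈ augIdeal F M ^ k) : u * v ∈ augIdeal F M ^ k := by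
  obtain ⟨k, rfl⟩ := Nat.exists_eq_add_of_le' hk
  rw [pow_succ'] at hv ⊢
  induction hv using Submodule.mul_induction_on' with
  | mem_mul_mem a ha b hb =>
    rw [← mul_assoc]
    exact Submodule.mul_mem_mul (mul_mem_augIdeal_left u ha) hb
  | add a _ b _ ha hb => rw [mul_add]; exact add_mem ha hb

theorem augIdeal_pow_mul_right {k : ℕ} (hk : 1 ≤ k) {u : TensorAlgebra F M}
    (v : TensorAlgebra F M) (hu : u ∈ augIdeal F M ^ k) : u * v ∈ augIdeal F M ^ k := by
  obtain ⟨k, rfl⟩ := Nat.exists_eq_add_of_le' hk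
  rw [pow_succ] at hu ⊢
  induction hu using Submodule.mul_induction_on' with
  | mem_mul_mem a ha b hb =>
    rw [mul_assoc]
    exact Submodule.mul_mem_mul ha (mul_mem_augIdeal_right v hb)
  | add a _ b _ ha hb => rw [add_mul]; exact add_mem ha hb

theorem augIdeal_pow_succ_le {k : ℕ} (hk : 1 ≤ k) :
    augIdeal F M ^ (k + 1) ≤ augIdeal F M ^ k := by
  rw [pow_succ, Submodule.mul_le]
  exact fun u hu v _ => augIdeal_pow_mul_right hk v hu

theorem augIdeal_pow_le {k l : ℕ} (hk : 1 ≤ k) (h : k ≤ l) :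
    augIdeal F M ^ l ≤ augIdeal F M ^ k := by
  induction l, h using Nat.le_induction with
  | base => exact le_rfl
  | succ l hl ih => exact (augIdeal_pow_succ_le (hk.trans hl)).trans ih

theorem algHom_mem_augIdeal_pow {α : TensorAlgebra F M →ₐ[F] TensorAlgebra F N}
    (hα : ∀ x, α (ι F x) ∈ augIdeal F N) {k : ℕ} {u : TensorAlgebra F M}
    (hu : u ∈ augIdeal F M ^ k) : α u ∈ augIdeal F N ^ k := by
  have h : algebraMapInv.comp α = algebraMapInv := by
    ext x
    simpa [mem_augIdeal, algebraMapInv] using hα x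
  have h1 : (augIdeal F M).map α.toLinearMap ≤ augIdeal F N := by
    rintro _ ⟨v, hv, rfl⟩
    rw [mem_augIdeal]
    exact (DFunLike.congr_fun h v).trans hv
  have h2 : (augIdeal F M ^ k).map α.toLinearMap ≤ augIdeal F N ^ k := by
    rw [Submodule.map_pow]
    exact pow_le_pow_left' h1 k
  exact h2 ⟨u, hu, rfl⟩

/-- `E` is a derivation along the pair of algebra maps `α`, `β`. -/
def IsSkewDer (α β : TensorAlgebra F M →ₐ[F] TensorAlgebra F N)
    (E : TensorAlgebra F M →ₗ[F] TensorAlgebra F N) : Prop :=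
  ∀ u v, E (u * v) = E u * β v + α u * E v

/-- The derivation along `α`, `β` with given values on the generators. -/
def skewDer (α β : TensorAlgebra F M →ₐ[F] TensorAlgebra F N) (δ : M →ₗ[F] TensorAlgebra F N) :
    TensorAlgebra F M →ₗ[F] TensorAlgebra F N :=
  -- The corner entry of an algebra map into upper triangular 2 × 2 matrices with α and β on the
  -- diagonal: matrix multiplication is the skew Leibniz rule.
  Matrix.entryLinearMap F (TensorAlgebra F N) (0 : Fin 2) (1 : Fin 2) ∘ₗ
    (lift F (Matrix.singleLinearMap F (0 : Fin 2) (0 : Fin 2) ∘ₗ α.toLinearMap ∘ₗ ι F +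
      Matrix.singleLinearMap F (0 : Fin 2) (1 : Fin 2) ∘ₗ δ +
      Matrix.singleLinearMap F (1 : Fin 2) (1 : Fin 2) ∘ₗ β.toLinearMap ∘ₗ ι F)).toLinearMap

variable {α β : TensorAlgebra F M →ₐ[F] TensorAlgebra F N}
  {E E' : TensorAlgebra F M →ₗ[F] TensorAlgebra F N}

theorem skewDer_ι (δ : M →ₗ[F] TensorAlgebra F N) (x : M) : skewDer α β δ (ι F x) = δ x := by
  simp [skewDer, lift_ι_apply]

theorem isSkewDer_skewDer (δ : M →ₗ[F] TensorAlgebra F N) : IsSkewDer α β (skewDer α β δ) := by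
  set A := lift F (Matrix.singleLinearMap F (0 : Fin 2) (0 : Fin 2) ∘ₗ α.toLinearMap ∘ₗ ι F +
      Matrix.singleLinearMap F (0 : Fin 2) (1 : Fin 2) ∘ₗ δ +
      Matrix.singleLinearMap F (1 : Fin 2) (1 : Fin 2) ∘ₗ β.toLinearMap ∘ₗ ι F) with hA
  have key : ∀ u, A u 0 0 = α u ∧ A u 1 0 = 0 ∧ A u 1 1 = β u := by
    intro u
    induction u using TensorAlgebra.induction with
    | algebraMap r => simp [Matrix.algebraMap_matrix_apply]
    | ι x => simp [hA, lift_ι_apply]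
    | mul a b ha hb =>
      simp [Matrix.mul_apply, Fin.sum_univ_two, ha, hb]
    | add a b ha hb => simp [ha, hb]
  intro u v
  change A (u * v) 0 1 = A u 0 1 * β v + α u * A v 0 1
  rw [map_mul, Matrix.mul_apply, Fin.sum_univ_two, (key u).1, (key v).2.2, add_comm]

theorem IsSkewDer.map_one (h : IsSkewDer α β E) : E 1 = 0 := by
  have := h 1 1
  simpa using this

/-- The Leibniz rule expresses every value through the values on generators. The zero ideal gives
uniqueness of skew derivations; powers of the augmentation ideal give the word-length estimates. -/
theorem IsSkewDer.mem_of_ι (h : IsSkewDer α β E) {J : Submodule F (TensorAlgebra F N)}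
    (hl : ∀ u, ∀ v ∈ J, u * v ∈ J) (hr : ∀ u, ∀ v ∈ J, v * u ∈ J)
    (hι : ∀ x, E (ι F x) ∈ J) (u : TensorAlgebra F M) : E u ∈ J := by
  induction u using TensorAlgebra.induction with
  | algebraMap r =>
    rw [Algebra.algebraMap_eq_smul_one, map_smul, h.map_one, smul_zero]
    exact zero_mem _
  | ι x => exact hι x
  | mul a b ha hb =>
    rw [h]
    exact add_mem (hr _ _ ha) (hl _ _ hb)
  | add a b ha hb => rw [map_add]; exact add_mem ha hb

theorem IsSkewDer.mem_pow_of_ι (h : IsSkewDer α β E) {k : ℕ} (hk : 1 ≤ k)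
    (hι : ∀ x, E (ι F x) ∈ augIdeal F N ^ k) (u : TensorAlgebra F M) :
    E u ∈ augIdeal F N ^ k :=
  h.mem_of_ι (fun u _ hv => augIdeal_pow_mul_left hk u hv)
    (fun u _ hv => augIdeal_pow_mul_right hk u hv) hι u

theorem IsSkewDer.ext_ι (h : IsSkewDer α β E) (h' : IsSkewDer α β E')
    (hι : ∀ x, E (ι F x) = E' (ι F x)) : E = E' := by
  have h2 : IsSkewDer α β (E - E') := fun u v => by
    simp only [LinearMap.sub_apply, h u v, h' u v, sub_mul, mul_sub]
    abel
  refine LinearMap.ext fun u => sub_eq_zero.mp ?_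
  refine (Submodule.mem_bot F).mp (h2.mem_of_ι (J := ⊥) (fun u v hv => ?_) (fun u v hv => ?_)
    (fun x => ?_) u)
  · rw [(Submodule.mem_bot F).mp hv, mul_zero]; exact zero_mem _
  · rw [(Submodule.mem_bot F).mp hv, zero_mul]; exact zero_mem _
  · rw [LinearMap.sub_apply, hι, sub_self]; exact zero_mem _

/-- The Leibniz rule replaces one letter at a time by words of length at least k, while α and β do
not shorten the others: j + 1 letters become at least j + k. -/
theorem IsSkewDer.mem_pow (h : IsSkewDer α β E) (hα : ∀ x, α (ι F x) ∈ augIdeal F N)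
    (hβ : ∀ x, β (ι F x) ∈ augIdeal F N) {k : ℕ} (hk : 1 ≤ k)
    (hι : ∀ x, E (ι F x) ∈ augIdeal F N ^ k) (j : ℕ) {u : TensorAlgebra F M}
    (hu : u ∈ augIdeal F M ^ (j + 1)) : E u ∈ augIdeal F N ^ (j + k) := by
  induction j generalizing u with
  | zero => rw [zero_add]; exact h.mem_pow_of_ι hk hι u
  | succ j ih =>
    rw [pow_succ] at hu
    induction hu using Submodule.mul_induction_on' with
    | mem_mul_mem a ha b hb =>
      rw [h]
      refine add_mem ?_ ?_
      · have := mul_mem_augIdeal_pow (ih ha)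
          (algHom_mem_augIdeal_pow hβ (k := 1) (by simpa using hb))
        rwa [show j + k + 1 = j + 1 + k by ring] at this
      · exact mul_mem_augIdeal_pow (algHom_mem_augIdeal_pow hα ha) (h.mem_pow_of_ι hk hι b)
    | add a _ b _ ha hb => rw [map_add]; exact add_mem ha hb

theorem IsSkewDer.sub (h : IsSkewDer α β E) (h' : IsSkewDer α β E') : IsSkewDer α β (E - E') :=
  fun u v => by
    simp only [LinearMap.sub_apply, h u v, h' u v, sub_mul, mul_sub]
    abel

/-- Through `IsSkewDer.mem_pow`, agreement of two algebra maps on generators up to longer words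
propagates to all words. -/
theorem isSkewDer_sub (α β : TensorAlgebra F M →ₐ[F] TensorAlgebra F N) :
    IsSkewDer α β (α.toLinearMap - β.toLinearMap) := fun u v => by
  simp only [LinearMap.sub_apply, AlgHom.toLinearMap_apply, map_mul, sub_mul, mul_sub]
  abel

/-- `ιInv` factors through the trivial square-zero extension of F by M, where products of elements
without scalar part vanish. -/
theorem ιInv_of_mem_sq {u : TensorAlgebra F M} (hu : u ∈ augIdeal F M ^ 2) : ιInv u = 0 := by
  let : Module Fᵐᵒᵖ M := Module.compHom _ ((RingHom.id F).fromOpposite mul_comm)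
  have : IsCentralScalar F M := ⟨fun r m => rfl⟩
  have hfst : ∀ u : TensorAlgebra F M, (toTrivSqZeroExt (R := F) u).fst = algebraMapInv u := by
    intro u
    have : (TrivSqZeroExt.fstHom F F M).comp toTrivSqZeroExt = algebraMapInv (R := F) := by
      ext x
      simp [algebraMapInv]
    exact DFunLike.congr_fun this u
  change (toTrivSqZeroExt (R := F) u).snd = 0
  rw [pow_two] at hu
  induction hu using Submodule.mul_induction_on' with
  | mem_mul_mem a ha b hb =>
    rw [map_mul, TrivSqZeroExt.snd_mul, hfst, hfst, mem_augIdeal.mp ha, mem_augIdeal.mp hb]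
    simp
  | add a _ b _ ha hb => rw [map_add, TrivSqZeroExt.snd_add, ha, hb, add_zero]

theorem eq_zero_of_ι_mem_sq {x : M} (hx : ι F x ∈ augIdeal F M ^ 2) : x = 0 := by
  rw [← ι_leftInverse (R := F) x]
  exact ιInv_of_mem_sq hx

end SkewDerivation

/-! ### Contractions of acyclic spaces with a differential -/

section Contraction

variable {F : Type*} [Field F] {M N : Type*} [AddCommGroup M] [Module F M]
  [AddCommGroup N] [Module F N]

/-- A section of d over its range, preceded by a linear projection onto that range. -/
theorem exists_generalized_inverse (d : M →ₗ[F] N) : ∃ θ : N →ₗ[F] M, d ∘ₗ θ ∘ₗ d = d := by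
  obtain ⟨s, hs⟩ := d.rangeRestrict.exists_rightInverse_of_surjective d.range_rangeRestrict
  obtain ⟨p, hp⟩ := (LinearMap.range d).subtype.exists_leftInverse_of_injective
    (Submodule.ker_subtype _)
  refine ⟨s ∘ₗ p, LinearMap.ext fun x => ?_⟩
  have h1 : p (d x) = d.rangeRestrict x := LinearMap.congr_fun hp (d.rangeRestrict x)
  have h2 := LinearMap.congr_fun hs (d.rangeRestrict x)
  simp only [LinearMap.comp_apply, h1]
  exact congrArg Subtype.val h2

/-- Outside characteristic 2 a generalized inverse is made odd by averaging it with −tθt. In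
characteristic 2 the involution is the identity and every map is odd. -/
theorem exists_odd_generalized_inverse (t d : M →ₗ[F] M) (ht : t ∘ₗ t = LinearMap.id)
    (ht2 : (2 : F) = 0 → t = LinearMap.id) (htd : t ∘ₗ d = -(d ∘ₗ t)) :
    ∃ θ : M →ₗ[F] M, d ∘ₗ θ ∘ₗ d = d ∧ t ∘ₗ θ = -(θ ∘ₗ t) := by
  obtain ⟨θ, hθ⟩ := exists_generalized_inverse d
  have h1 : ∀ x, d (θ (d x)) = d x := fun x => LinearMap.congr_fun hθ x
  have h2 : ∀ x, t (t x) = x := fun x => LinearMap.congr_fun ht x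
  have h3 : ∀ x, t (d x) = -d (t x) := fun x => LinearMap.congr_fun htd x
  by_cases h : (2 : F) = 0
  · refine ⟨θ, hθ, ?_⟩
    rw [ht2 h]
    ext x
    have : (2 : F) • θ x = 0 := by rw [h, zero_smul]
    rw [two_smul] at this
    simpa using eq_neg_of_add_eq_zero_left this
  · refine ⟨(2 : F)⁻¹ • (θ - t ∘ₗ θ ∘ₗ t), ?_, ?_⟩
    · ext x
      have h4 : d (t (θ (t (d x)))) = - d x := by
        rw [h3, map_neg, map_neg, map_neg, ← h3, h1, h3, h2]
      simp only [LinearMap.comp_apply, LinearMap.smul_apply, LinearMap.sub_apply, map_smul,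
        map_sub, h1, h4, sub_neg_eq_add]
      rw [← two_smul F, smul_smul, inv_mul_cancel₀ h, one_smul]
    · ext x
      simp only [LinearMap.comp_apply, LinearMap.smul_apply, LinearMap.sub_apply, map_smul,
        map_sub, h2, LinearMap.neg_apply]
      rw [← smul_neg, neg_sub]

/-- Since dθd = d, the element x − θdx is a cycle, hence a boundary, and dθ is the identity on
boundaries. Therefore s = θ − θθd is a contraction. -/
theorem exists_contraction (t d : M →ₗ[F] M) (ht : t ∘ₗ t = LinearMap.id)
    (ht2 : (2 : F) = 0 → t = LinearMap.id) (htd : t ∘ₗ d = -(d ∘ₗ t))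
    (hd : d ∘ₗ d = 0) (hex : ∀ x, d x = 0 → ∃ y, d y = x) :
    ∃ s : M →ₗ[F] M, d ∘ₗ s + s ∘ₗ d = LinearMap.id ∧ t ∘ₗ s = -(s ∘ₗ t) := by
  obtain ⟨θ, h1, h2⟩ := exists_odd_generalized_inverse t d ht ht2 htd
  have h1 : ∀ x, d (θ (d x)) = d x := fun x => LinearMap.congr_fun h1 x
  have h2 : ∀ x, t (θ x) = -θ (t x) := fun x => LinearMap.congr_fun h2 x
  have h3 : ∀ x, t (d x) = -d (t x) := fun x => LinearMap.congr_fun htd x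
  have h4 : ∀ x, d (d x) = 0 := fun x => LinearMap.congr_fun hd x
  refine ⟨θ - θ ∘ₗ θ ∘ₗ d, ?_, ?_⟩
  · ext x
    obtain ⟨y, hy⟩ := hex (x - θ (d x)) (by rw [map_sub, h1, sub_self])
    have h5 : d (θ x) - d (θ (θ (d x))) = x - θ (d x) := by
      rw [← map_sub, ← map_sub, ← hy, h1]
    simp [h4, h5]
  · ext x
    simp only [LinearMap.comp_apply, LinearMap.sub_apply, LinearMap.neg_apply, map_sub, h2, h3,
      map_neg, neg_neg]
    abel

/-- A quasi-isomorphism of vector spaces with differentials, compatible with the parity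
involutions, is a homotopy equivalence. -/
theorem exists_homotopyInverse (t d : M →ₗ[F] M) (t' d' : N →ₗ[F] N) (f : M →ₗ[F] N)
    (ht : ∀ x, t (t x) = x) (ht2 : (2 : F) = 0 → ∀ x, t x = x)
    (ht' : ∀ x, t' (t' x) = x) (ht2' : (2 : F) = 0 → ∀ x, t' x = x)
    (htd : ∀ x, t (d x) = -d (t x)) (htd' : ∀ x, t' (d' x) = -d' (t' x))
    (htf : ∀ x, t' (f x) = f (t x)) (hd : ∀ x, d (d x) = 0) (hd' : ∀ x, d' (d' x) = 0)
    (hf : ∀ x, d' (f x) = f (d x))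
    (hinj : ∀ x, d x = 0 → (∃ y, d' y = f x) → ∃ z, d z = x)
    (hsurj : ∀ y, d' y = 0 → ∃ x, d x = 0 ∧ ∃ z, d' z = y - f x) :
    ∃ (g : N →ₗ[F] M) (h : M →ₗ[F] M) (h' : N →ₗ[F] N),
      (∀ y, d (g y) = g (d' y)) ∧ (∀ y, t (g y) = g (t' y)) ∧
      (∀ x, t (h x) = -h (t x)) ∧ (∀ y, t' (h' y) = -h' (t' y)) ∧
      (∀ x, x - g (f x) = d (h x) + h (d x)) ∧ (∀ y, y - f (g y) = d' (h' y) + h' (d' y)) := by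
  -- The mapping cone of f, with differential (a, b) ↦ (−d a, f a + d' b), is acyclic by the two
  -- homology hypotheses. Its parity is −t on M, which is shifted by one there.
  obtain ⟨s, h1, h2⟩ := exists_contraction (M := M × N) ((-t).prodMap t')
    ((-(d ∘ₗ LinearMap.fst F M N)).prod (f ∘ₗ LinearMap.fst F M N + d' ∘ₗ LinearMap.snd F M N))
    (by ext x <;> simp [ht, ht'])
    (fun h => by ext x <;> simp [ht2' h]; exact neg_eq_of_add_eq_zero_left (by
      rw [ht2 h, ← two_smul F, h, zero_smul]))
    (by ext x <;> simp [htd, htd', htf]) (by ext x <;> simp [hd, hd', hf])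
    (fun ⟨a, b⟩ hab => by
      simp only [LinearMap.prod_apply, Function.prod_apply, LinearMap.neg_apply, LinearMap.comp_apply,
        LinearMap.fst_apply, LinearMap.add_apply, LinearMap.snd_apply, Prod.mk_eq_zero,
        neg_eq_zero] at hab
      obtain ⟨ha, hb⟩ := hab
      obtain ⟨z, rfl⟩ := hinj a ha ⟨-b, by rw [map_neg, ← eq_neg_of_add_eq_zero_left hb]⟩
      obtain ⟨x, hx, w, hw⟩ := hsurj (b + f z) (by rw [map_add, hf, add_comm, hb])
      refine ⟨(x - z, w), ?_⟩
      ext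
      · simp [hx]
      · simp [hw])
  have h1a : ∀ a b, _ := fun a b => LinearMap.congr_fun h1 (a, b)
  have h2a : ∀ a b, _ := fun a b => LinearMap.congr_fun h2 (a, b)
  -- Matrix entries of the contraction: the entry N → M is the homotopy inverse and the diagonal
  -- entries are the homotopies. The sign on M compensates the −d of the cone.
  refine ⟨LinearMap.fst F M N ∘ₗ s ∘ₗ LinearMap.inr F M N,
    -(LinearMap.fst F M N ∘ₗ s ∘ₗ LinearMap.inl F M N),
    LinearMap.snd F M N ∘ₗ s ∘ₗ LinearMap.inr F M N, ?_, ?_, ?_, ?_, ?_, ?_⟩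
  · intro y
    have := congrArg Prod.fst (h1a 0 y)
    simp at this
    simpa using (neg_add_eq_zero.mp this)
  · intro y
    have := congrArg Prod.fst (h2a 0 y)
    simpa using this
  · intro x
    have := congrArg Prod.fst (h2a x 0)
    have e : s (-t x, 0) = - s (t x, 0) := by
      rw [← map_neg s, Prod.neg_mk, neg_zero]
    simp [e] at this
    simp [this]
  · intro y
    have := congrArg Prod.snd (h2a 0 y)
    simpa using this
  · intro x
    have := congrArg Prod.fst (h1a x 0)
    have e : s (-d x, f x) = - s (d x, 0) + s (0, f x) := by
      rw [← map_neg s, ← map_add, Prod.neg_mk, Prod.mk_add_mk, neg_zero, zero_add, add_zero]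
    simp only [LinearMap.add_apply, LinearMap.comp_apply, LinearMap.prod_apply, Function.prod_apply,
      LinearMap.neg_apply, LinearMap.fst_apply, LinearMap.snd_apply, map_zero, add_zero, e,
      Prod.fst_add, Prod.fst_neg, LinearMap.id_apply] at this
    simp only [LinearMap.comp_apply, LinearMap.inr_apply, LinearMap.inl_apply,
      LinearMap.fst_apply, LinearMap.neg_apply, map_neg]
    rw [sub_eq_iff_eq_add, eq_comm]
    rw [← add_assoc] at this
    exact this
  · intro y
    have := congrArg Prod.snd (h1a 0 y)
    simp only [LinearMap.add_apply, LinearMap.comp_apply, LinearMap.prod_apply, Function.prod_apply,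
      LinearMap.neg_apply, LinearMap.fst_apply, LinearMap.snd_apply, map_zero, neg_zero, zero_add,
      Prod.snd_add, LinearMap.id_apply] at this
    simp only [LinearMap.comp_apply, LinearMap.inr_apply,
      LinearMap.fst_apply, LinearMap.snd_apply]
    rw [sub_eq_iff_eq_add, eq_comm]
    rw [add_assoc, add_comm] at this
    exact this

end Contraction

/-! ### Truncated cobar constructions -/

section Cobar

variable {F : Type*} [Field F] {M N : Type*} [AddCommGroup M] [Module F M]
  [AddCommGroup N] [Module F N]

open TensorAlgebra

/-- The parity automorphism of the tensor algebra on the desuspension of `M`, where `t` is the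
parity involution of `M`. -/
def cobarParity (t : M →ₗ[F] M) : TensorAlgebra F M →ₐ[F] TensorAlgebra F M :=
  lift F (-(ι F ∘ₗ t))

@[simp]
theorem cobarParity_ι (t : M →ₗ[F] M) (x : M) : cobarParity t (ι F x) = -ι F (t x) := by
  simp [cobarParity, lift_ι_apply]

theorem cobarParity_ι_mem (t : M →ₗ[F] M) (x : M) :
    cobarParity t (ι F x) ∈ augIdeal F M := by
  rw [cobarParity_ι]
  exact neg_mem (ι_mem_augIdeal _)

theorem algHom_id_ι_mem (x : M) : AlgHom.id F (TensorAlgebra F M) (ι F x) ∈ augIdeal F M :=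
  ι_mem_augIdeal x

theorem cobarParity_cobarParity {t : M →ₗ[F] M} (ht : ∀ x, t (t x) = x) (u : TensorAlgebra F M) :
    cobarParity t (cobarParity t u) = u := by
  have : (cobarParity t).comp (cobarParity t) = AlgHom.id F _ := by
    ext x
    simp [ht]
  exact DFunLike.congr_fun this u

/-- The differential of the cobar construction with given values on the generators. -/
def cobarD (t : M →ₗ[F] M) (δ : M →ₗ[F] TensorAlgebra F M) :
    TensorAlgebra F M →ₗ[F] TensorAlgebra F M :=
  skewDer (cobarParity t) (AlgHom.id F _) δ

theorem isSkewDer_cobarD (t : M →ₗ[F] M) (δ : M →ₗ[F] TensorAlgebra F M) :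
    IsSkewDer (cobarParity t) (AlgHom.id F _) (cobarD t δ) := isSkewDer_skewDer δ

@[simp]
theorem cobarD_ι (t : M →ₗ[F] M) (δ : M →ₗ[F] TensorAlgebra F M) (x : M) :
    cobarD t δ (ι F x) = δ x := skewDer_ι δ x

theorem cobarD_mul (t : M →ₗ[F] M) (δ : M →ₗ[F] TensorAlgebra F M) (u v : TensorAlgebra F M) :
    cobarD t δ (u * v) = cobarD t δ u * v + cobarParity t u * cobarD t δ v :=
  isSkewDer_cobarD t δ u v

/-- A cobar differential modulo words of length greater than `m`: here `t` is the parity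
involution of `M`, and `d` the linear part of `δ`. -/
structure IsCobar (t d : M →ₗ[F] M) (δ : M →ₗ[F] TensorAlgebra F M) (m : ℕ) : Prop where
  invol : ∀ x, t (t x) = x
  two : (2 : F) = 0 → ∀ x, t x = x
  linear : ∀ x, δ x - ι F (d x) ∈ augIdeal F M ^ 2
  parity : ∀ x, cobarParity t (δ x) = δ (t x)
  square : ∀ x, cobarD t δ (δ x) ∈ augIdeal F M ^ (m + 1)

namespace IsCobar

variable {t d : M →ₗ[F] M} {δ : M →ₗ[F] TensorAlgebra F M} {m : ℕ}

theorem δ_mem (h : IsCobar t d δ m) (x : M) : δ x ∈ augIdeal F M := by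
  have := augIdeal_pow_succ_le le_rfl (h.linear x)
  rw [pow_one] at this
  simpa using add_mem this (ι_mem_augIdeal (d x))

theorem cobarD_mem (h : IsCobar t d δ m) (j : ℕ) {u : TensorAlgebra F M}
    (hu : u ∈ augIdeal F M ^ (j + 1)) : cobarD t δ u ∈ augIdeal F M ^ (j + 1) :=
  (isSkewDer_cobarD t δ).mem_pow (cobarParity_ι_mem t) algHom_id_ι_mem le_rfl
    (fun x => by simpa using h.δ_mem x) j hu

/-- Both sides are derivations along the same pair of algebra maps, so generators suffice. The later
commutation rules are proved in the same way. -/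
theorem parity_cobarD (h : IsCobar t d δ m) (u : TensorAlgebra F M) :
    cobarParity t (cobarD t δ u) = -cobarD t δ (cobarParity t u) := by
  have h1 : IsSkewDer ((cobarParity t).comp (cobarParity t)) (cobarParity t)
      ((cobarParity t).toLinearMap ∘ₗ cobarD t δ) := fun u v => by
    simp [cobarD_mul]
  have h2 : IsSkewDer ((cobarParity t).comp (cobarParity t)) (cobarParity t)
      (-(cobarD t δ ∘ₗ (cobarParity t).toLinearMap)) := fun u v => by
    simp [cobarD_mul, add_comm]
  have := h1.ext_ι h2 (fun x => by simp [h.parity])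
  exact LinearMap.congr_fun this u

/-- The square of an odd derivation is an ordinary derivation, because the mixed terms cancel by
`parity_cobarD`. So its values on generators decide. -/
theorem cobarD_cobarD_mem (h : IsCobar t d δ m) (u : TensorAlgebra F M) :
    cobarD t δ (cobarD t δ u) ∈ augIdeal F M ^ (m + 1) := by
  have h1 : IsSkewDer (AlgHom.id F _) (AlgHom.id F _) (cobarD t δ ∘ₗ cobarD t δ) := fun u v => by
    simp [cobarD_mul, h.parity_cobarD, cobarParity_cobarParity h.invol]
  exact h1.mem_pow_of_ι (by omega) (fun x => by simpa using h.square x) u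

/-- The linear part of a cobar differential anticommutes with the parity involution. -/
theorem parity_d (h : IsCobar t d δ m) (x : M) : t (d x) = -d (t x) := by
  have h1 := algHom_mem_augIdeal_pow (cobarParity_ι_mem t) (h.linear x)
  have h2 := h.linear (t x)
  rw [map_sub, h.parity, cobarParity_ι] at h1
  have h3 := sub_mem h1 h2
  rw [← sub_eq_zero]
  refine eq_zero_of_ι_mem_sq (F := F) ?_
  convert h3 using 1
  simp

/-- On I^(j+1)/I^(j+2) the differential is thus that of a tensor power of the complex (M, d). -/
theorem cobarD_linear_sub_mem (h : IsCobar t d δ m) (j : ℕ) {u : TensorAlgebra F M}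
    (hu : u ∈ augIdeal F M ^ (j + 1)) :
    cobarD t δ u - cobarD t (ι F ∘ₗ d) u ∈ augIdeal F M ^ (j + 2) :=
  ((isSkewDer_cobarD t δ).sub (isSkewDer_cobarD t (ι F ∘ₗ d))).mem_pow (cobarParity_ι_mem t)
    algHom_id_ι_mem (by omega) (fun x => by simpa using h.linear x) j hu

/-- The component of length one of D² = 0, which is visible modulo I^(m+1) as soon as m ≥ 1. -/
theorem d_d (h : IsCobar t d δ m) (hm : 1 ≤ m) (x : M) : d (d x) = 0 := by
  have h1 := h.cobarD_mem 1 (h.linear x)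
  rw [map_sub, cobarD_ι] at h1
  have h2 := augIdeal_pow_le (by omega) (show 2 ≤ m + 1 by omega) (h.square x)
  refine eq_zero_of_ι_mem_sq (F := F) ?_
  have h3 := sub_mem (sub_mem h2 h1) (h.linear (d x))
  convert h3 using 1
  abel

end IsCobar

/-- A map of cobar constructions modulo words of length greater than `m`, with given values `φ` on
generators, whose linear part is `f`. -/
structure IsCobarMap (t : M →ₗ[F] M) (δ : M →ₗ[F] TensorAlgebra F M) (t' : N →ₗ[F] N)
    (δ' : N →ₗ[F] TensorAlgebra F N) (f : M →ₗ[F] N) (φ : M →ₗ[F] TensorAlgebra F N)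
    (m : ℕ) : Prop where
  linear : ∀ x, φ x - ι F (f x) ∈ augIdeal F N ^ 2
  parity : ∀ x, cobarParity t' (φ x) = -φ (t x)
  comm : ∀ x, cobarD t' δ' (φ x) - lift F φ (δ x) ∈ augIdeal F N ^ (m + 1)

namespace IsCobarMap

variable {t d : M →ₗ[F] M} {δ : M →ₗ[F] TensorAlgebra F M} {m : ℕ}
  {t' d' : N →ₗ[F] N} {δ' : N →ₗ[F] TensorAlgebra F N} {f : M →ₗ[F] N}
  {φ : M →ₗ[F] TensorAlgebra F N}

theorem φ_mem (h : IsCobarMap t δ t' δ' f φ m) (x : M) : lift F φ (ι F x) ∈ augIdeal F N := by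
  have := augIdeal_pow_succ_le le_rfl (h.linear x)
  rw [pow_one] at this
  simpa [lift_ι_apply] using add_mem this (ι_mem_augIdeal (f x))

theorem lift_parity (h : IsCobarMap t δ t' δ' f φ m) (u : TensorAlgebra F M) :
    cobarParity t' (lift F φ u) = lift F φ (cobarParity t u) := by
  have : (cobarParity t').comp (lift F φ) = (lift F φ).comp (cobarParity t) := by
    ext x
    simp [lift_ι_apply, h.parity]
  exact DFunLike.congr_fun this u

theorem lift_comm (h : IsCobarMap t δ t' δ' f φ m) (u : TensorAlgebra F M) :
    cobarD t' δ' (lift F φ u) - lift F φ (cobarD t δ u) ∈ augIdeal F N ^ (m + 1) := by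
  have h1 : IsSkewDer ((cobarParity t').comp (lift F φ)) (lift F φ)
      (cobarD t' δ' ∘ₗ (lift F φ).toLinearMap - (lift F φ).toLinearMap ∘ₗ cobarD t δ) :=
    fun u v => by
      simp [cobarD_mul, h.lift_parity, sub_mul, mul_sub]
      abel
  exact h1.mem_pow_of_ι (by omega) (fun x => by simpa [lift_ι_apply] using h.comm x) u

theorem lift_linear_sub_mem (h : IsCobarMap t δ t' δ' f φ m) (j : ℕ) {u : TensorAlgebra F M}
    (hu : u ∈ augIdeal F M ^ (j + 1)) :
    lift F φ u - lift F (ι F ∘ₗ f) u ∈ augIdeal F N ^ (j + 2) :=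
  (isSkewDer_sub (lift F φ) (lift F (ι F ∘ₗ f))).mem_pow h.φ_mem
    (fun x => by simpa [lift_ι_apply] using ι_mem_augIdeal (f x)) (by omega)
    (fun x => by simpa [lift_ι_apply] using h.linear x) j hu

theorem parity_f (h : IsCobarMap t δ t' δ' f φ m) (x : M) : t' (f x) = f (t x) := by
  have h1 := algHom_mem_augIdeal_pow (cobarParity_ι_mem t') (h.linear x)
  have h2 := h.linear (t x)
  rw [map_sub, h.parity, cobarParity_ι] at h1
  have h3 := add_mem h1 h2
  rw [← sub_eq_zero]
  refine eq_zero_of_ι_mem_sq (F := F) ?_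
  convert h3 using 1
  simp
  abel

theorem d_f (h : IsCobarMap t δ t' δ' f φ m) (hM : IsCobar t d δ m) (hN : IsCobar t' d' δ' m)
    (hm : 1 ≤ m) (x : M) : d' (f x) = f (d x) := by
  have h1 := hN.cobarD_mem 1 (h.linear x)
  have h2 := algHom_mem_augIdeal_pow h.φ_mem (hM.linear x)
  have h3 := augIdeal_pow_le (by omega) (show 2 ≤ m + 1 by omega) (h.comm x)
  have h4 := hN.linear (f x)
  have h5 := h.linear (d x)
  rw [map_sub, cobarD_ι] at h1
  rw [map_sub, lift_ι_apply] at h2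
  rw [← sub_eq_zero]
  refine eq_zero_of_ι_mem_sq (F := F) ?_
  have h6 := add_mem (add_mem (sub_mem (sub_mem h3 h1) h4) h2) h5
  convert h6 using 1
  rw [map_sub]
  abel

end IsCobarMap

/-- The cycle `x` extends to a cycle of the cobar construction modulo words of length greater
than `m`. -/
def Extends (t : M →ₗ[F] M) (δ : M →ₗ[F] TensorAlgebra F M) (m : ℕ) (x : M) : Prop :=
  ∃ c ∈ augIdeal F M ^ 2, cobarD t δ (ι F x + c) ∈ augIdeal F M ^ (m + 1)

variable {t d : M →ₗ[F] M} {δ : M →ₗ[F] TensorAlgebra F M} {m : ℕ}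
  {t' d' : N →ₗ[F] N} {δ' : N →ₗ[F] TensorAlgebra F N} {f : M →ₗ[F] N}
  {φ : M →ₗ[F] TensorAlgebra F N}

/-- Tensor powers of a homotopy equivalence are homotopy equivalences. -/
theorem cobar_homotopy (t d h k : M →ₗ[F] M) (ht : ∀ x, t (t x) = x)
    (htd : ∀ x, t (d x) = -d (t x)) (hth : ∀ x, t (h x) = -h (t x))
    (hdk : ∀ x, d (k x) = k (d x)) (htk : ∀ x, t (k x) = k (t x))
    (hk : ∀ x, x - k x = d (h x) + h (d x)) :
    ∃ H : TensorAlgebra F M →ₗ[F] TensorAlgebra F M,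
      (∀ j, ∀ u ∈ augIdeal F M ^ (j + 1), H u ∈ augIdeal F M ^ (j + 1)) ∧
      ∀ u, u - lift F (ι F ∘ₗ k) u =
        cobarD t (ι F ∘ₗ d) (H u) + H (cobarD t (ι F ∘ₗ d) u) := by
  obtain ⟨K, hK⟩ : ∃ K, K = lift F (ι F ∘ₗ k) := ⟨_, rfl⟩
  -- On words this is, up to signs, the usual homotopy: the sum of the maps k ⊗ ⋯ ⊗ k ⊗ h ⊗ 1 ⊗ ⋯ ⊗
  -- 1.
  obtain ⟨H, hH⟩ : ∃ H, H = skewDer ((cobarParity t).comp K) (AlgHom.id F _) (ι F ∘ₗ h) :=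
    ⟨_, rfl⟩
  have hKι : ∀ x, K (ι F x) = ι F (k x) := fun x => by simp [hK, lift_ι_apply]
  have hHι : ∀ x, H (ι F x) = ι F (h x) := fun x => by simp [hH, skewDer_ι]
  have hHs : IsSkewDer ((cobarParity t).comp K) (AlgHom.id F _) H := by
    rw [hH]
    exact isSkewDer_skewDer _
  refine ⟨H, fun j u hu => hHs.mem_pow (fun x => ?_) algHom_id_ι_mem le_rfl (fun x => ?_) j hu, ?_⟩
  · rw [AlgHom.comp_apply, hKι]
    exact cobarParity_ι_mem t _
  · rw [hHι, pow_one]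
    exact ι_mem_augIdeal _
  rw [← hK]
  clear hK hH
  obtain ⟨τ, hτ⟩ : ∃ τ, τ = cobarParity t := ⟨_, rfl⟩
  obtain ⟨D, hD⟩ : ∃ D, D = cobarD t (ι F ∘ₗ d) := ⟨_, rfl⟩
  have hDι : ∀ x, D (ι F x) = ι F (d x) := fun x => by simp [hD]
  have hDm : ∀ u v, D (u * v) = D u * v + τ u * D v := by
    rw [hD, hτ]
    exact cobarD_mul t _
  have hτι : ∀ x, τ (ι F x) = -ι F (t x) := fun x => by rw [hτ, cobarParity_ι]
  have hττ : ∀ u, τ (τ u) = u := by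
    rw [hτ]
    exact cobarParity_cobarParity ht
  rw [← hD]
  rw [← hτ] at hHs
  clear hD hτ
  have hHm : ∀ u v, H (u * v) = H u * v + τ (K u) * H v := hHs
  have hτK : ∀ u, τ (K u) = K (τ u) := by
    have : τ.comp K = K.comp τ := by
      ext x
      simp [hτι, hKι, htk]
    exact DFunLike.congr_fun this
  have hτD : ∀ u, τ (D u) = -D (τ u) := by
    have h1 : IsSkewDer (τ.comp τ) τ (τ.toLinearMap ∘ₗ D) := fun u v => by simp [hDm]
    have h2 : IsSkewDer (τ.comp τ) τ (-(D ∘ₗ τ.toLinearMap)) := fun u v => by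
      simp [hDm, add_comm]
    exact LinearMap.congr_fun (h1.ext_ι h2 fun x => by simp [hτι, hDι, htd])
  have hτH : ∀ u, τ (H u) = -H (τ u) := by
    have h1 : IsSkewDer (τ.comp (τ.comp K)) τ (τ.toLinearMap ∘ₗ H) := fun u v => by simp [hHm]
    have h2 : IsSkewDer (τ.comp (τ.comp K)) τ (-(H ∘ₗ τ.toLinearMap)) := fun u v => by
      simp [hHm, add_comm, hτK]
    exact LinearMap.congr_fun (h1.ext_ι h2 fun x => by simp [hτι, hHι, hth])
  have hDK : ∀ u, D (K u) = K (D u) := by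
    have h1 : IsSkewDer (τ.comp K) K (D ∘ₗ K.toLinearMap) := fun u v => by simp [hDm]
    have h2 : IsSkewDer (τ.comp K) K (K.toLinearMap ∘ₗ D) := fun u v => by
      simp [hDm, hτK]
    exact LinearMap.congr_fun (h1.ext_ι h2 fun x => by simp [hDι, hKι, hdk])
  -- Both id − K and DH + HD are derivations along (K, id), so the formula reduces to the given one
  -- on generators.
  have h1 : IsSkewDer K (AlgHom.id F _) (LinearMap.id - K.toLinearMap) := fun u v => by
    simp [sub_mul, mul_sub]
  have h2 : IsSkewDer K (AlgHom.id F _) (D ∘ₗ H + H ∘ₗ D) := fun u v => by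
    simp only [LinearMap.add_apply, LinearMap.comp_apply, hDm, hHm, map_add, map_neg, hτD, hτH, hττ,
      hτK, hDK, AlgHom.id_apply, add_mul, mul_add, neg_mul]
    abel
  exact LinearMap.congr_fun (h1.ext_ι h2 fun x => by
    simp only [LinearMap.sub_apply, LinearMap.id_apply, AlgHom.toLinearMap_apply, hKι,
      LinearMap.add_apply, LinearMap.comp_apply, hHι, hDι, ← map_sub, ← map_add, hk])

/-- The graded pieces of the cone of a map of cobar constructions induced by a quasi-isomorphism
are acyclic. -/
theorem cone_level (h : IsCobarMap t δ t' δ' f φ m) (hM : IsCobar t d δ m)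
    (hN : IsCobar t' d' δ' m) (hm : 1 ≤ m)
    (hinj : ∀ x, d x = 0 → (∃ y, d' y = f x) → ∃ z, d z = x)
    (hsurj : ∀ y, d' y = 0 → ∃ x, d x = 0 ∧ ∃ z, d' z = y - f x)
    (j : ℕ) {a : TensorAlgebra F M} {b : TensorAlgebra F N}
    (ha : a ∈ augIdeal F M ^ (j + 1)) (hb : b ∈ augIdeal F N ^ (j + 1))
    (hda : cobarD t δ a ∈ augIdeal F M ^ (j + 2))
    (hdb : lift F φ a + cobarD t' δ' b ∈ augIdeal F N ^ (j + 2)) :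
    ∃ c ∈ augIdeal F M ^ (j + 1), ∃ e ∈ augIdeal F N ^ (j + 1),
      a + cobarD t δ c ∈ augIdeal F M ^ (j + 2) ∧
      b - lift F φ c - cobarD t' δ' e ∈ augIdeal F N ^ (j + 2) := by
  obtain ⟨g, k, k', hg, htg, htk, htk', hk, hk'⟩ := exists_homotopyInverse t d t' d' f hM.invol
    hM.two hN.invol hN.two hM.parity_d hN.parity_d h.parity_f (hM.d_d hm) (hN.d_d hm)
    (h.d_f hM hN hm) hinj hsurj
  have hdf := h.d_f hM hN hm
  obtain ⟨H, hHI, hH⟩ := cobar_homotopy t d k (g ∘ₗ f) hM.invol hM.parity_d htk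
    (fun x => by simp [hg, hdf]) (fun x => by simp [htg, h.parity_f]) hk
  obtain ⟨H', hHI', hH'⟩ := cobar_homotopy t' d' k' (f ∘ₗ g) hN.invol hN.parity_d htk'
    (fun x => by simp [hg, hdf]) (fun x => by simp [htg, h.parity_f]) hk'
  set D := cobarD t (ι F ∘ₗ d) with hD
  set D' := cobarD t' (ι F ∘ₗ d') with hD'
  set P := lift F (ι F ∘ₗ f) with hP
  set G := lift F (ι F ∘ₗ g) with hG
  have hGP : lift F (ι F ∘ₗ g ∘ₗ f) = G.comp P := by ext x; simp [hG, hP, lift_ι_apply]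
  have hPG : lift F (ι F ∘ₗ f ∘ₗ g) = P.comp G := by ext x; simp [hG, hP, lift_ι_apply]
  simp only [hGP, hPG, AlgHom.comp_apply] at hH hH'
  have hPI : ∀ {k u}, u ∈ augIdeal F M ^ k → P u ∈ augIdeal F N ^ k := fun hu =>
    algHom_mem_augIdeal_pow (fun x => by simpa [hP, lift_ι_apply] using ι_mem_augIdeal (f x)) hu
  have hGI : ∀ {k u}, u ∈ augIdeal F N ^ k → G u ∈ augIdeal F M ^ k := fun hu =>
    algHom_mem_augIdeal_pow (fun x => by simpa [hG, lift_ι_apply] using ι_mem_augIdeal (g x)) hu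
  have hDP : ∀ u, D' (P u) = P (D u) := by
    have h1 : IsSkewDer ((cobarParity t').comp P) P (D' ∘ₗ P.toLinearMap) := fun u v => by
      simp [hD', cobarD_mul]
    have h2 : IsSkewDer ((cobarParity t').comp P) P (P.toLinearMap ∘ₗ D) := fun u v => by
      have : P.comp (cobarParity t) = (cobarParity t').comp P := by
        ext x
        simp [hP, lift_ι_apply, h.parity_f]
      have := DFunLike.congr_fun this u
      simp only [AlgHom.comp_apply] at this
      simp [hD, cobarD_mul, this]
    exact LinearMap.congr_fun (h1.ext_ι h2 fun x => by
      simp [hD', hD, hP, lift_ι_apply, hdf])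
  have hDG : ∀ u, D (G u) = G (D' u) := by
    have h1 : IsSkewDer ((cobarParity t).comp G) G (D ∘ₗ G.toLinearMap) := fun u v => by
      simp [hD, cobarD_mul]
    have h2 : IsSkewDer ((cobarParity t).comp G) G (G.toLinearMap ∘ₗ D') := fun u v => by
      have : G.comp (cobarParity t') = (cobarParity t).comp G := by
        ext x
        simp [hG, lift_ι_apply, htg]
      have := DFunLike.congr_fun this u
      simp only [AlgHom.comp_apply] at this
      simp [hD', cobarD_mul, this]
    exact LinearMap.congr_fun (h1.ext_ι h2 fun x => by
      simp [hD', hD, hG, lift_ι_apply, hg])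
  -- Modulo I^(j+2) the full differentials and Φ may be replaced by the maps D, D', P induced by the
  -- linear parts.
  have hDa : D a ∈ augIdeal F M ^ (j + 2) := by
    simpa using sub_mem hda (hM.cobarD_linear_sub_mem j ha)
  have hDb : P a + D' b ∈ augIdeal F N ^ (j + 2) := by
    have := sub_mem (sub_mem hdb (h.lift_linear_sub_mem j ha)) (hN.cobarD_linear_sub_mem j hb)
    convert this using 1
    simp only [hP, hD']
    abel
  -- The choice c = Gb − Ha, e = H'b solves the first equation and leaves the defect q in the
  -- second, since the two homotopies need not be compatible with P. Modulo longer words q is a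
  -- cycle, so q = PGq + D'H'q, and adding Gq to c and H'q to e removes it.
  set q := P (H a) - H' (P a) with hq
  have hqI : q ∈ augIdeal F N ^ (j + 1) :=
    sub_mem (hPI (hHI j a ha)) (hHI' j _ (hPI ha))
  have hDq : D' q ∈ augIdeal F N ^ (j + 2) := by
    have h1 := congrArg P (hH a)
    have h2 := hH' (P a)
    rw [map_sub, map_add] at h1
    have : D' q = H' (P (D a)) - P (H (D a)) := by
      rw [hq, map_sub, hDP, ← hDP a, sub_eq_sub_iff_add_eq_add, ← h1, add_comm, ← h2]
    rw [this]
    exact sub_mem (hHI' _ _ (hPI hDa)) (hPI (hHI _ _ hDa))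
  set c := G b - H a + G q with hc
  set e := H' b + H' q with he
  have hcI : c ∈ augIdeal F M ^ (j + 1) := add_mem (sub_mem (hGI hb) (hHI j a ha)) (hGI hqI)
  have heI : e ∈ augIdeal F N ^ (j + 1) := add_mem (hHI' j b hb) (hHI' j q hqI)
  refine ⟨c, hcI, e, heI, ?_, ?_⟩
  · have h1 : a + D c = G (P a + D' b) + H (D a) + G (D' q) := by
      rw [hc, map_add, map_sub, hDG, hDG, map_add]
      linear_combination (norm := abel) hH a
    have h2 : a + D c ∈ augIdeal F M ^ (j + 2) := by
      rw [h1]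
      exact add_mem (add_mem (hGI hDb) (hHI (j + 1) _ hDa)) (hGI hDq)
    convert add_mem h2 (hM.cobarD_linear_sub_mem j hcI) using 1
    simp only [hD]
    abel
  · have h1 : b - P c - D' e = H' (P a + D' b) + H' (D' q) := by
      rw [hc, he]
      simp only [map_add, map_sub]
      linear_combination (norm := abel) hH' b + hH' q - hq
    have h2 : b - P c - D' e ∈ augIdeal F N ^ (j + 2) := by
      rw [h1]
      exact add_mem (hHI' (j + 1) _ hDb) (hHI' (j + 1) _ hDq)
    convert sub_mem (sub_mem h2 (h.lift_linear_sub_mem j hcI))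
      (hN.cobarD_linear_sub_mem j heI) using 1
    simp only [hP, hD']
    abel

/-- The cone of a map of truncated cobar constructions induced by a quasi-isomorphism is
acyclic. -/
theorem cone_acyclic (h : IsCobarMap t δ t' δ' f φ m) (hM : IsCobar t d δ m)
    (hN : IsCobar t' d' δ' m) (hm : 1 ≤ m)
    (hinj : ∀ x, d x = 0 → (∃ y, d' y = f x) → ∃ z, d z = x)
    (hsurj : ∀ y, d' y = 0 → ∃ x, d x = 0 ∧ ∃ z, d' z = y - f x)
    (j : ℕ) (hj : j ≤ m) {a : TensorAlgebra F M} {b : TensorAlgebra F N}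
    (ha : a ∈ augIdeal F M ^ (j + 1)) (hb : b ∈ augIdeal F N ^ (j + 1))
    (hda : cobarD t δ a ∈ augIdeal F M ^ (m + 1))
    (hdb : lift F φ a + cobarD t' δ' b ∈ augIdeal F N ^ (m + 1)) :
    ∃ c ∈ augIdeal F M ^ (j + 1), ∃ e ∈ augIdeal F N ^ (j + 1),
      a + cobarD t δ c ∈ augIdeal F M ^ (m + 1) ∧
      b - lift F φ c - cobarD t' δ' e ∈ augIdeal F N ^ (m + 1) := by
  -- Downward from j = m, where zero works. One correction by `cone_level` pushes the pair one power
  -- deeper, and it stays a cycle of the cone because D² and the commutator of D with Φ vanish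
  -- modulo I^(m+1).
  induction hj using Nat.decreasingInduction generalizing a b with
  | self => exact ⟨0, zero_mem _, 0, zero_mem _, by simpa using ha, by simpa using hb⟩
  | of_succ j hj ih =>
    obtain ⟨c, hc, e, he, h1, h2⟩ := cone_level h hM hN hm hinj hsurj j ha hb
      (augIdeal_pow_le (by omega) (by omega) hda) (augIdeal_pow_le (by omega) (by omega) hdb)
    obtain ⟨c', hc', e', he', h3, h4⟩ := ih h1 h2
      (by rw [map_add]; exact add_mem hda (hM.cobarD_cobarD_mem c))
      (by
        convert sub_mem (sub_mem hdb (h.lift_comm c)) (hN.cobarD_cobarD_mem e) using 1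
        simp only [map_add, map_sub]
        abel)
    refine ⟨c + c', add_mem hc (augIdeal_pow_succ_le (by omega) hc'), e + e',
      add_mem he (augIdeal_pow_succ_le (by omega) he'), ?_, ?_⟩
    · rw [map_add, ← add_assoc]; exact h3
    · convert h4 using 1
      simp only [map_add]
      abel

/-- Quasi-isomorphisms preserve and reflect the property of cycles to extend to cycles of truncated
cobar constructions. -/
theorem extends_iff (h : IsCobarMap t δ t' δ' f φ m) (hM : IsCobar t d δ m)
    (hN : IsCobar t' d' δ' m) (hm : 1 ≤ m)
    (hinj : ∀ x, d x = 0 → (∃ y, d' y = f x) → ∃ z, d z = x)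
    (hsurj : ∀ y, d' y = 0 → ∃ x, d x = 0 ∧ ∃ z, d' z = y - f x)
    {x : M} (hx : d x = 0) : Extends t δ m x ↔ Extends t' δ' m (f x) := by
  constructor
  · rintro ⟨c, hc, h1⟩
    -- The image Φ(x + c) has linear part f x; the longer words of φ x join the correction.
    refine ⟨lift F φ c + (φ x - ι F (f x)),
      add_mem (algHom_mem_augIdeal_pow h.φ_mem hc) (h.linear x), ?_⟩
    have h2 := add_mem (h.lift_comm (ι F x + c)) (algHom_mem_augIdeal_pow h.φ_mem h1)
    convert h2 using 1
    rw [sub_add_cancel]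
    congr 1
    rw [map_add, lift_ι_apply]
    abel
  · rintro ⟨c, hc, h1⟩
    have ha : δ x ∈ augIdeal F M ^ 2 := by simpa [hx] using hM.linear x
    -- As d x = 0, the element δ x = D x lies in I². Together with the correction given for f x,
    -- minus the nonlinear part of φ x, it is a cycle of the cone. Acyclicity at j = 1 gives c' ∈ I²
    -- with δ x + D c' ∈ I^(m+1), which is an extension of x.
    obtain ⟨c', hc', e, -, h2, -⟩ := cone_acyclic h hM hN hm hinj hsurj 1 hm (a := δ x)
      (b := c - (φ x - ι F (f x))) ha (sub_mem hc (h.linear x)) (hM.square x)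
      (by
        convert sub_mem h1 (h.comm x) using 1
        simp only [map_add, map_sub]
        abel)
    exact ⟨c', hc', by rw [map_add, cobarD_ι]; exact h2⟩

/-- The element δ x has linear part d x, and D(δ x) = D² x. Together with additivity this makes
extendability a property of homology classes. -/
theorem IsCobar.extends_d (hM : IsCobar t d δ m) (x : M) : Extends t δ m (d x) :=
  ⟨δ x - ι F (d x), hM.linear x, by simpa using hM.square x⟩

theorem Extends.add {x y : M} (hx : Extends t δ m x) (hy : Extends t δ m y) :
    Extends t δ m (x + y) := by
  obtain ⟨c, hc, h1⟩ := hx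
  obtain ⟨e, he, h2⟩ := hy
  refine ⟨c + e, add_mem hc he, ?_⟩
  rw [map_add (ι F), add_add_add_comm, map_add]
  exact add_mem h1 h2

theorem Extends.smul {x : M} (r : F) (hx : Extends t δ m x) : Extends t δ m (r • x) := by
  obtain ⟨c, hc, h1⟩ := hx
  refine ⟨r • c, Submodule.smul_mem _ _ hc, ?_⟩
  rw [map_smul, ← smul_add, map_smul]
  exact Submodule.smul_mem _ _ h1

end Cobar

/-! ### Desuspension signs -/

section Desuspension

variable {F : Type v} [Field F] {V W : GradedSpace.{v, w} F}

open TensorAlgebra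

variable (F) in
/-- The scalar `(-1)^e`. -/
def koszulSign (e : ℤ) : F := ((e.negOnePow : ℤ) : F)

theorem koszulSign_add (a b : ℤ) : koszulSign F (a + b) = koszulSign F a * koszulSign F b := by
  simp [koszulSign, Int.negOnePow_add]

theorem koszulSign_even {a : ℤ} (h : Even a) : koszulSign F a = 1 := by
  simp [koszulSign, Int.negOnePow_even a h]

theorem koszulSign_congr {a b : ℤ} (h : Even (a - b)) : koszulSign F a = koszulSign F b := by
  rw [← sub_add_cancel a b, koszulSign_add, koszulSign_even h, one_mul]

@[simp]
theorem koszulSign_zero : koszulSign F 0 = 1 := koszulSign_even Even.zero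

theorem koszulSign_one : koszulSign F 1 = -1 := by simp [koszulSign]

theorem koszulSign_natCast (n : ℕ) : koszulSign F n = (-1) ^ n := by
  simp [koszulSign]

theorem koszulSign_mul_self (a : ℤ) : koszulSign F a * koszulSign F a = 1 := by
  rw [← koszulSign_add]
  exact koszulSign_even (Even.add_self a)

theorem koszulSign_sum {ι : Type*} (s : Finset ι) (f : ι → ℤ) :
    koszulSign F (∑ b ∈ s, f b) = ∏ b ∈ s, koszulSign F (f b) := by
  classical
  induction s using Finset.induction_on with
  | empty => simp
  | insert a s ha ih => rw [Finset.sum_insert ha, Finset.prod_insert ha, koszulSign_add, ih]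

theorem negOnePow_smul {M : Type*} [AddCommGroup M] [Module F M] (e : ℤ) (x : M) :
    e.negOnePow • x = koszulSign F e • x := by
  rw [Units.smul_def, koszulSign, Int.cast_smul_eq_zsmul]

theorem signTwist_incl (e d : ℤ) (x : V d) :
    signTwist V e (incl V d x) = koszulSign F (e * d) • incl V d x := by
  rw [signTwist, toModule_lof, LinearMap.smul_apply, negOnePow_smul (F := F)]

theorem signTwist_invol (e : ℤ) (x : Total V) : signTwist V e (signTwist V e x) = x := by
  have : signTwist V e ∘ₗ signTwist V e = LinearMap.id := by
    refine DirectSum.linearMap_ext F fun d => LinearMap.ext fun x => ?_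
    change signTwist V e (signTwist V e (incl V d x)) = incl V d x
    rw [signTwist_incl, map_smul, signTwist_incl, smul_smul, koszulSign_mul_self, one_smul]
  exact LinearMap.congr_fun this x

theorem signTwist_of_two (h : (2 : F) = 0) (e : ℤ) (x : Total V) : signTwist V e x = x := by
  have h1 : ∀ d, koszulSign F d = 1 := fun d => by
    rcases Int.even_or_odd d with hd | hd
    · exact koszulSign_even hd
    · rw [← sub_add_cancel d 1, koszulSign_add, koszulSign_even (by
        obtain ⟨k, rfl⟩ := hd
        exact ⟨k, by ring⟩), koszulSign_one, one_mul]
      rw [eq_comm, ← sub_eq_zero, sub_neg_eq_add, one_add_one_eq_two, h]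
  have : signTwist V e = LinearMap.id := by
    refine DirectSum.linearMap_ext F fun d => LinearMap.ext fun x => ?_
    change signTwist V e (incl V d x) = incl V d x
    rw [signTwist_incl, h1, one_smul]
  exact LinearMap.congr_fun this x

/-- The automorphism of the tensor algebra that multiplies words of length `n` by `(-1)^{en}`. -/
def lengthTwist (M : Type*) [AddCommGroup M] [Module F M] (e : ℤ) :
    TensorAlgebra F M →ₐ[F] TensorAlgebra F M := lift F (koszulSign F e • ι F)

@[simp]
theorem lengthTwist_ι {M : Type*} [AddCommGroup M] [Module F M] (e : ℤ) (x : M) :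
    lengthTwist M e (ι F x) = koszulSign F e • ι F x := by
  simp [lengthTwist, lift_ι_apply]

/-- The action of the tensor algebra on itself in which a generator `x` of degree `p` sends a
word `u` of length `n` to `(-1)^{pn} x u`. -/
def desuspAction (V : GradedSpace.{v, w} F) :
    TensorAlgebra F (Total V) →ₐ[F] Module.End F (TensorAlgebra F (Total V)) :=
  lift F (DirectSum.toModule F ℤ _ fun p =>
    LinearMap.lcomp F _ (lengthTwist (Total V) p).toLinearMap ∘ₗ
      LinearMap.mul F (TensorAlgebra F (Total V)) ∘ₗ ι F ∘ₗ incl V p)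

theorem desuspAction_ι (p : ℤ) (x : V p) (u : TensorAlgebra F (Total V)) :
    desuspAction V (ι F (incl V p x)) u = ι F (incl V p x) * lengthTwist _ p u := by
  rw [desuspAction, lift_ι_apply, toModule_lof]
  rfl

/-- The operator on the tensor algebra that sends `x_1 ⋯ x_n` to
`(-1)^ε x_1 ⋯ x_n`, where `ε` is the sum of `|x_b|` over `b < c`. -/
def desusp (V : GradedSpace.{v, w} F) :
    TensorAlgebra F (Total V) →ₗ[F] TensorAlgebra F (Total V) :=
  LinearMap.applyₗ 1 ∘ₗ (desuspAction V).toLinearMap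

theorem desusp_apply (u : TensorAlgebra F (Total V)) : desusp V u = desuspAction V u 1 := rfl

/-- Although `desusp` is not multiplicative, this computes it letter by letter: the sign for moving
degrees of u past desuspensions of v is built into the action. -/
theorem desusp_mul (u v : TensorAlgebra F (Total V)) :
    desusp V (u * v) = desuspAction V u (desusp V v) := by
  simp [desusp_apply]

theorem desusp_one : desusp V 1 = 1 := by simp [desusp_apply]

theorem desusp_ι (x : Total V) : desusp V (ι F x) = ι F x := by
  have : desusp V ∘ₗ ι F = ι F := by
    refine DirectSum.linearMap_ext F fun d => LinearMap.ext fun x => ?_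
    change desusp V (ι F (incl V d x)) = ι F (incl V d x)
    rw [desusp_apply, desuspAction_ι, map_one, mul_one]
  exact LinearMap.congr_fun this x

/-- `u` is a combination of words of length `n`. -/
def HasLength {M : Type*} [AddCommGroup M] [Module F M] (n : ℕ) (u : TensorAlgebra F M) : Prop :=
  ∀ e, lengthTwist M e u = koszulSign F (e * n) • u

/-- `HasLength` only sees how length twists act, hence at most the parity of the length. The signs
need no more. -/
theorem HasLength.mul {M : Type*} [AddCommGroup M] [Module F M] {m n : ℕ}
    {u v : TensorAlgebra F M} (hu : HasLength m u) (hv : HasLength n v) :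
    HasLength (m + n) (u * v) := fun e => by
  rw [map_mul, hu e, hv e, smul_mul_smul_comm, ← koszulSign_add, ← mul_add, Nat.cast_add]

theorem HasLength.smul {M : Type*} [AddCommGroup M] [Module F M] {n : ℕ}
    {u : TensorAlgebra F M} (hu : HasLength n u) (r : F) : HasLength n (r • u) := fun e => by
  rw [map_smul, hu e, smul_comm]

theorem hasLength_one {M : Type*} [AddCommGroup M] [Module F M] :
    HasLength (F := F) 0 (1 : TensorAlgebra F M) := fun e => by simp

theorem hasLength_ι {M : Type*} [AddCommGroup M] [Module F M] (x : M) :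
    HasLength 1 (ι F x) := fun e => by simp

/-- Words of length `n` and degree `d`. -/
def wordDegree (V : GradedSpace.{v, w} F) (n : ℕ) (d : ℤ) :
    Submodule F (TensorAlgebra F (Total V)) :=
  (tensorDegree V n d).map (word V n)

theorem wordDegree_induction {n : ℕ} {d : ℤ} {C : TensorAlgebra F (Total V) → Prop}
    (h : ∀ (p : Fin n → ℤ) (x : ∀ b, V (p b)), ∑ b, p b = d →
      C (tprod F (Total V) n fun b => incl V (p b) (x b)))
    (hz : C 0) (ha : ∀ u v, C u → C v → C (u + v)) (hs : ∀ (r : F) u, C u → C (r • u))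
    {u : TensorAlgebra F (Total V)} (hu : u ∈ wordDegree V n d) : C u := by
  obtain ⟨t, ht, rfl⟩ := hu
  induction ht using Submodule.span_induction with
  | mem t ht =>
    obtain ⟨p, x, hp, rfl⟩ := ht
    rw [word, TensorPower.toTensorAlgebra_tprod]
    exact h p x hp
  | zero => rw [map_zero]; exact hz
  | add t t' _ _ h h' => rw [map_add]; exact ha _ _ h h'
  | smul r t _ h => rw [map_smul]; exact hs _ _ h

theorem tprod_succ {M : Type*} [AddCommGroup M] [Module F M] {n : ℕ} (x : Fin (n + 1) → M) :
    tprod F M (n + 1) x = ι F (x 0) * tprod F M n (fun b => x b.succ) := by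
  simp [tprod_apply, List.ofFn_succ]

theorem hasLength_prod {M : Type*} [AddCommGroup M] [Module F M] {l : ℕ} (k : Fin l → ℕ)
    (u : Fin l → TensorAlgebra F M) (hu : ∀ b, HasLength (k b) (u b)) :
    HasLength (∑ b, k b) (List.ofFn u).prod := by
  induction l with
  | zero => simpa using hasLength_one
  | succ l ih =>
    rw [List.ofFn_succ, List.prod_cons, Fin.sum_univ_succ]
    exact (hu 0).mul (ih _ _ fun b => hu b.succ)

theorem hasLength_tprod {M : Type*} [AddCommGroup M] [Module F M] {l : ℕ} (x : Fin l → M) :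
    HasLength l (tprod F M l x) := by
  have := hasLength_prod (fun _ : Fin l => 1) _ (fun b => hasLength_ι (F := F) (x b))
  rw [tprod_apply]
  simpa using this

theorem tprod_mem_augIdeal_pow {M : Type*} [AddCommGroup M] [Module F M] {l : ℕ}
    (x : Fin l → M) : tprod F M l x ∈ augIdeal F M ^ l := by
  induction l with
  | zero => simp [tprod_apply]
  | succ l ih =>
    rw [tprod_succ, pow_succ']
    exact Submodule.mul_mem_mul (ι_mem_augIdeal _) (ih _)

theorem desusp_tprod {l : ℕ} (p : Fin l → ℤ) (x : ∀ b, V (p b)) :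
    desusp V (tprod F (Total V) l fun b => incl V (p b) (x b)) =
      koszulSign F (∑ b, ∑ _c ∈ Finset.Ioi b, p b) •
        tprod F (Total V) l fun b => incl V (p b) (x b) := by
  induction l with
  | zero => simp [tprod_apply, desusp_one]
  | succ l ih =>
    rw [tprod_succ, desusp_mul, ih (fun b => p b.succ), desuspAction_ι, map_smul,
      hasLength_tprod, mul_smul_comm, mul_smul_comm, smul_smul, ← koszulSign_add,
      Fin.sum_univ_succ]
    congr 2
    have h0 : (Finset.Ioi (0 : Fin (l + 1))).card = l := by simp
    have hs : ∀ b : Fin l, (Finset.Ioi b.succ).card = (Finset.Ioi b).card := fun b => by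
      rw [Fin.card_Ioi, Fin.card_Ioi, Fin.val_succ]
      omega
    simp only [Finset.sum_const, nsmul_eq_mul, h0, hs]
    rw [add_comm, mul_comm]

theorem desusp_mem_augIdeal_pow {n : ℕ} {d : ℤ} {u : TensorAlgebra F (Total V)}
    (hu : u ∈ wordDegree V n d) : desusp V u ∈ augIdeal F (Total V) ^ n := by
  refine wordDegree_induction (C := fun u => desusp V u ∈ augIdeal F (Total V) ^ n)
    (fun p x _ => ?_) ?_ (fun u v hu hv => ?_) (fun r u hu => ?_) hu
  · rw [desusp_tprod]
    exact Submodule.smul_mem _ _ (tprod_mem_augIdeal_pow _)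
  · rw [map_zero]; exact zero_mem _
  · rw [map_add]; exact add_mem hu hv
  · rw [map_smul]; exact Submodule.smul_mem _ _ hu

theorem hasLength_desusp {n : ℕ} {d : ℤ} {u : TensorAlgebra F (Total V)}
    (hu : u ∈ wordDegree V n d) : HasLength n (desusp V u) := by
  intro e
  refine wordDegree_induction (C := fun u => lengthTwist _ e (desusp V u) = koszulSign F (e * n) • desusp V u)
    (fun p x _ => ?_) ?_ (fun u v hu hv => ?_) (fun r u hu => ?_) hu
  · rw [desusp_tprod]
    exact (hasLength_tprod _).smul _ e
  · simp
  · simp [hu, hv]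
  · rw [map_smul, map_smul, hu, smul_comm]

theorem cobarParity_tprod {l : ℕ} (p : Fin l → ℤ) (x : ∀ b, V (p b)) :
    cobarParity (signTwist V 1) (tprod F (Total V) l fun b => incl V (p b) (x b)) =
      koszulSign F (∑ b, (p b - 1)) • tprod F (Total V) l fun b => incl V (p b) (x b) := by
  induction l with
  | zero => simp [tprod_apply]
  | succ l ih =>
    rw [tprod_succ, map_mul, ih (fun b => p b.succ), cobarParity_ι, signTwist_incl, map_smul,
      Fin.sum_univ_succ, koszulSign_add, mul_smul_comm, neg_mul, smul_mul_assoc, ← smul_neg,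
      smul_smul, smul_neg, ← neg_smul, one_mul]
    congr 1
    rw [mul_comm, ← neg_mul, ← neg_one_mul (koszulSign F (p 0)), ← koszulSign_one,
      ← koszulSign_add]
    congr 1
    exact koszulSign_congr ⟨1, by ring⟩

/-- Desuspension lowers the degree of every letter by one, so the parity of a word is its degree
minus its length. -/
theorem cobarParity_desusp {n : ℕ} {d : ℤ} {u : TensorAlgebra F (Total V)}
    (hu : u ∈ wordDegree V n d) :
    cobarParity (signTwist V 1) (desusp V u) = koszulSign F (d - n) • desusp V u := by
  refine wordDegree_induction (C := fun u => cobarParity (signTwist V 1) (desusp V u) = koszulSign F (d - n) • desusp V u)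
    (fun p x hp => ?_) ?_ (fun u v hu hv => ?_) (fun r u hu => ?_) hu
  · rw [desusp_tprod, map_smul, cobarParity_tprod, smul_comm, Finset.sum_sub_distrib, hp]
    simp
  · simp
  · simp [hu, hv]
  · rw [map_smul, map_smul, hu, smul_comm]

/-- The letters of u, of total degree d, pass the n' desuspensions in v. What remains is the
internal sign of u. -/
theorem desuspAction_eq {n n' : ℕ} {d : ℤ} {u v : TensorAlgebra F (Total V)}
    (hu : u ∈ wordDegree V n d) (hv : HasLength n' v) :
    desuspAction V u v = koszulSign F (d * n') • (desusp V u * v) := by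
  refine wordDegree_induction (C := fun u => desuspAction V u v = koszulSign F (d * n') • (desusp V u * v))
    (fun p x hp => ?_) ?_ (fun u v hu hv => ?_) (fun r u hu => ?_) hu
  · subst hp
    clear hu
    induction n with
    | zero => simp [tprod_apply, desusp_one]
    | succ n ih =>
      rw [tprod_succ, map_mul, Module.End.mul_apply, ih (fun b => p b.succ), desusp_mul,
        desuspAction_ι, desuspAction_ι, map_smul, map_mul, hv, mul_smul_comm, mul_smul_comm,
        mul_smul_comm, smul_smul, ← koszulSign_add, Fin.sum_univ_succ, ← mul_assoc, add_mul,
        add_comm]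
  · simp
  · simp [hu, hv, add_mul]
  · rw [map_smul, map_smul, LinearMap.smul_apply, hu, smul_mul_assoc, smul_comm]

/-- For b < c the degree d_b of one factor passes the k_c desuspensions of a later one. -/
theorem desusp_prod {l : ℕ} (k : Fin l → ℕ) (d : Fin l → ℤ)
    (y : Fin l → TensorAlgebra F (Total V)) (hy : ∀ b, y b ∈ wordDegree V (k b) (d b)) :
    desusp V (List.ofFn y).prod = koszulSign F (∑ b, ∑ c ∈ Finset.Ioi b, k c * d b) •
      (List.ofFn fun b => desusp V (y b)).prod := by
  induction l with
  | zero => simp [desusp_one]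
  | succ l ih =>
    rw [List.ofFn_succ, List.prod_cons, desusp_mul, ih (fun b => k b.succ) (fun b => d b.succ) _
      fun b => hy b.succ, map_smul, desuspAction_eq (hy 0)
      (hasLength_prod _ _ fun b => hasLength_desusp (hy b.succ)), smul_smul, ← koszulSign_add,
      List.ofFn_succ, List.prod_cons, Fin.sum_univ_succ]
    congr 2
    simp only [Fin.sum_Ioi_succ, Fin.sum_Ioi_zero, Nat.cast_sum, Finset.mul_sum]
    rw [add_comm]
    congr 1
    exact Finset.sum_congr rfl fun b _ => mul_comm _ _

theorem koszulTensor_tprod {l : ℕ} (e : Fin l → ℤ)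
    (g : Fin l → (Total V →ₗ[F] TensorAlgebra F (Total W))) (p : Fin l → ℤ) (x : ∀ b, V (p b)) :
    koszulTensor e g (PiTensorProduct.tprod F fun b => incl V (p b) (x b)) =
      koszulSign F (∑ b, ∑ c ∈ Finset.Ioi b, e c * p b) •
        (List.ofFn fun b => g b (incl V (p b) (x b))).prod := by
  rw [koszulTensor, PiTensorProduct.lift.tprod, MultilinearMap.compLinearMap_apply]
  simp only [LinearMap.comp_apply, signTwist_incl, map_smul]
  rw [MultilinearMap.map_smul_univ, MultilinearMap.mkPiAlgebraFin_apply, koszulSign_sum]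
  simp only [Finset.sum_mul]

/-- The desuspension of a tensor product of homogeneous maps. -/
theorem desusp_koszulTensor {l : ℕ} (e : Fin l → ℤ) (k : Fin l → ℕ) (d : Fin l → ℤ)
    (g : Fin l → (Total V →ₗ[F] TensorAlgebra F (Total W))) (p : Fin l → ℤ) (x : ∀ b, V (p b))
    (hg : ∀ b, g b (incl V (p b) (x b)) ∈ wordDegree W (k b) (d b)) :
    desusp W (koszulTensor e g (PiTensorProduct.tprod F fun b => incl V (p b) (x b))) =
      koszulSign F (∑ b, ∑ c ∈ Finset.Ioi b, (e c * p b + k c * d b)) •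
        (List.ofFn fun b => desusp W (g b (incl V (p b) (x b)))).prod := by
  rw [koszulTensor_tprod, map_smul, desusp_prod k d _ hg, smul_smul, ← koszulSign_add]
  simp only [Finset.sum_add_distrib]

theorem tensorPower_hom_ext {E : Type*} [AddCommGroup E] [Module F E] {l : ℕ}
    {f g : ⨂[F]^l (Total V) →ₗ[F] E}
    (h : ∀ (p : Fin l → ℤ) (x : ∀ b, V (p b)),
      f (PiTensorProduct.tprod F fun b => incl V (p b) (x b)) =
        g (PiTensorProduct.tprod F fun b => incl V (p b) (x b))) : f = g := by
  refine PiTensorProduct.ext ?_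
  refine MultilinearMap.dfinsupp_ext (κ := fun _ => ℤ) (M := fun _ d => V d) fun p => ?_
  ext x
  exact h p x

theorem ι_incl_mem_wordDegree (p : ℤ) (x : V p) : ι F (incl V p x) ∈ wordDegree V 1 p := by
  refine ⟨PiTensorProduct.tprod F fun _ => incl V p x,
    Submodule.subset_span ⟨fun _ => p, fun _ => x, by simp, rfl⟩, ?_⟩
  rw [word, TensorPower.toTensorAlgebra_tprod]
  simp [tprod_apply]

end Desuspension

/-! ### The truncated cobar construction of an A∞-coalgebra -/

section Operations

variable {F : Type v} [Field F] {V W : GradedSpace.{v, w} F}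

open TensorAlgebra

/-- The desuspension of an operation `V → W^{⊗ n}`. -/
def desuspOp (f : Ops V W) (n : ℕ) : Total V →ₗ[F] TensorAlgebra F (Total W) :=
  desusp W ∘ₗ word W n ∘ₗ f n

/-- The sum of the desuspensions of the operations with at most `m + 1` outputs. -/
def cobarMap (f : Ops V W) (m : ℕ) : Total V →ₗ[F] TensorAlgebra F (Total W) :=
  ∑ n ∈ Finset.Ico 1 (m + 2), desuspOp f n

theorem cobarMap_apply (f : Ops V W) (m : ℕ) (x : Total V) :
    cobarMap f m x = ∑ n ∈ Finset.Ico 1 (m + 2), desuspOp f n x := by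
  simp [cobarMap]

/-- The maps of a family have the degrees `f_n ↦ n + r`. -/
def HasOpDegree (f : Ops V W) (r : ℤ) : Prop :=
  ∀ n, 1 ≤ n → ∀ (p : ℤ) (x : V p), f n (incl V p x) ∈ tensorDegree W n (p + n + r)

theorem HasOpDegree.word_mem {f : Ops V W} {r : ℤ} (h : HasOpDegree f r) {n : ℕ} (hn : 1 ≤ n)
    (p : ℤ) (x : V p) : word W n (f n (incl V p x)) ∈ wordDegree W n (p + n + r) :=
  ⟨_, h n hn p x, rfl⟩

theorem total_induction {C : Total V → Prop} (hi : ∀ p x, C (incl V p x))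
    (ha : ∀ x y, C x → C y → C (x + y)) (x : Total V) : C x := by
  induction x using DirectSum.induction_on with
  | zero => simpa using hi 0 0
  | of p x => exact hi p x
  | add x y hx hy => exact ha x y hx hy

theorem desuspOp_mem {f : Ops V W} {r : ℤ} (h : HasOpDegree f r) {n : ℕ} (hn : 1 ≤ n)
    (x : Total V) : desuspOp f n x ∈ augIdeal F (Total W) ^ n := by
  induction x using total_induction with
  | hi p x => exact desusp_mem_augIdeal_pow (h.word_mem hn p x)
  | ha x y hx hy => rw [map_add]; exact add_mem hx hy

theorem cobarParity_cobarMap {f : Ops V W} {r : ℤ} (h : HasOpDegree f r) (m : ℕ) (x : Total V) :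
    cobarParity (signTwist W 1) (cobarMap f m x) =
      koszulSign F r • cobarMap f m (signTwist V 1 x) := by
  induction x using total_induction with
  | hi p x =>
    rw [signTwist_incl, map_smul, cobarMap_apply, map_sum, smul_smul, Finset.smul_sum]
    refine Finset.sum_congr rfl fun n hn => ?_
    refine (cobarParity_desusp (h.word_mem (Finset.mem_Ico.mp hn).1 p x)).trans ?_
    rw [← koszulSign_add]
    congr 2
    ring
  | ha x y hx hy => simp only [map_add, hx, hy, smul_add]

/-- The map `1^{⊗ a} ⊗ Δ_i ⊗ 1^{⊗ (N - 1 - a)}`. -/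
def insertAt (Δ : Ops V V) (N a i : ℕ) : ⨂[F]^N (Total V) →ₗ[F] TensorAlgebra F (Total V) :=
  koszulTensor (fun b => if (b : ℕ) = a then (i : ℤ) - 2 else 0)
    (fun b => if (b : ℕ) = a then word V i ∘ₗ Δ i else TensorAlgebra.ι F)

/-- The derivation reaches position a after passing the earlier letters, of desuspended degrees p_b
− 1. -/
theorem cobarD_tprod (δ : Total V →ₗ[F] TensorAlgebra F (Total V)) {N : ℕ} (p : Fin N → ℤ)
    (x : ∀ b, V (p b)) :
    cobarD (signTwist V 1) δ (tprod F (Total V) N fun b => incl V (p b) (x b)) =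
      ∑ a : Fin N, koszulSign F (∑ b, if b < a then p b - 1 else 0) •
        (List.ofFn fun b => if b = a then δ (incl V (p b) (x b))
          else ι F (incl V (p b) (x b))).prod := by
  induction N with
  | zero =>
    rw [tprod_apply]
    simp [(isSkewDer_cobarD (signTwist V 1) δ).map_one]
  | succ N ih =>
    rw [tprod_succ, cobarD_mul, ih (fun b => p b.succ), cobarD_ι, cobarParity_ι, signTwist_incl,
      Fin.sum_univ_succ]
    congr 1
    · simp [List.ofFn_succ, tprod_apply]
    · rw [Finset.mul_sum]
      refine Finset.sum_congr rfl fun a _ => ?_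
      simp only [List.ofFn_succ, List.prod_cons, Fin.sum_univ_succ, Fin.succ_inj,
        (Fin.succ_ne_zero _).symm, if_false, Fin.succ_lt_succ_iff, Fin.succ_pos, if_true, map_smul]
      rw [koszulSign_add, mul_smul_comm, neg_mul, smul_mul_assoc, ← smul_neg, mul_comm, mul_smul,
        sub_eq_add_neg, koszulSign_add, mul_smul, mul_one]
      rw [koszulSign_congr (a := -1) (b := 1) ⟨-1, by ring⟩, koszulSign_one]
      simp only [neg_smul, one_smul, smul_neg]
      rw [smul_comm]

/-- Parity comparison of the exponents on the two sides of `cobarD_desusp_word`. It holds for each b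
separately, with the cases before, at and after position a. -/
theorem insertAt_sign_even {N : ℕ} (p : Fin N → ℤ) (a : Fin N) (i : ℕ) :
    Even (((∑ b, ∑ _c ∈ Finset.Ioi b, p b) + ∑ b, if b < a then p b - 1 else 0) -
      ((a + i * (N - 1 - a) : ℤ) + ∑ b : Fin N, ∑ c ∈ Finset.Ioi b,
        ((if (c : ℕ) = a then (i : ℤ) - 2 else 0) * p b +
          ((if c = a then i else 1 : ℕ) : ℤ) * (if b = a then p b + i + -2 else p b)))) := by
  have hcard : (N : ℤ) - 1 - a = (Finset.Ioi a).card := by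
    rw [Fin.card_Ioi]
    omega
  have ha : (a : ℤ) = ∑ b, if b < a then (1 : ℤ) else 0 := by
    have : Finset.univ.filter (fun b => b < a) = Finset.Iio a := by
      ext
      simp
    rw [Finset.sum_boole, this, Fin.card_Iio]
  have hi : (i : ℤ) * (N - 1 - a) = ∑ b, if b = a then (i : ℤ) * (Finset.Ioi b).card else 0 := by
    rw [Finset.sum_ite_eq', if_pos (Finset.mem_univ _), hcard]
  rw [hi, ha, ← Finset.sum_add_distrib, ← Finset.sum_add_distrib, ← Finset.sum_add_distrib,
    ← Finset.sum_sub_distrib]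
  refine Finset.even_sum _ fun b _ => ?_
  rcases lt_trichotomy b a with hb | rfl | hb
  · have h1 : ∀ c ∈ Finset.Ioi b, ((if (c : ℕ) = a then (i : ℤ) - 2 else 0) * p b +
        ((if c = a then i else 1 : ℕ) : ℤ) * p b) =
        p b + if c = a then (2 * i - 3) * p b else 0 := fun c _ => by
      by_cases hc : c = a
      · subst hc
        simp
        ring
      · have hc' : (c : ℕ) ≠ a := fun h => hc (Fin.ext h)
        simp [hc, hc']
    simp only [if_pos hb, if_neg hb.ne]
    rw [Finset.sum_congr rfl h1, Finset.sum_add_distrib, Finset.sum_ite_eq',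
      if_pos (Finset.mem_Ioi.mpr hb)]
    exact ⟨p b * (2 - i) - 1, by ring⟩
  · have h1 : ∀ c ∈ Finset.Ioi b, ((if (c : ℕ) = b then (i : ℤ) - 2 else 0) * p b +
        ((if c = b then i else 1 : ℕ) : ℤ) * (p b + i + -2)) = p b + (i - 2) := fun c hc => by
      have hc' := (Finset.mem_Ioi.mp hc).ne'
      have hc'' : (c : ℕ) ≠ b := fun h => hc' (Fin.ext h)
      simp [hc', hc'']
      ring
    simp only [lt_irrefl, if_true, if_false]
    rw [Finset.sum_congr rfl h1, Finset.sum_add_distrib]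
    simp only [Finset.sum_const, nsmul_eq_mul]
    exact ⟨(Finset.Ioi b).card * (1 - i), by ring⟩
  · have h1 : ∀ c ∈ Finset.Ioi b, ((if (c : ℕ) = a then (i : ℤ) - 2 else 0) * p b +
        ((if c = a then i else 1 : ℕ) : ℤ) * p b) = p b := fun c hc => by
      have hc' := (hb.trans (Finset.mem_Ioi.mp hc)).ne'
      have hc'' : (c : ℕ) ≠ a := fun h => hc' (Fin.ext h)
      simp [hc', hc'']
    simp only [if_neg hb.not_gt, if_neg hb.ne']
    rw [Finset.sum_congr rfl h1]
    simp

/-- After desuspension, inserting Δ_i at all positions with these signs is the derivation induced by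
Δ_i. Here a letters stand before the insertion and N − 1 − a after it. -/
theorem cobarD_desusp_word {Δ : Ops V V} (h : HasOpDegree Δ (-2)) {N i : ℕ} (hi : 1 ≤ i)
    (t : ⨂[F]^N (Total V)) :
    cobarD (signTwist V 1) (desuspOp Δ i) (desusp V (word V N t)) =
      ∑ a ∈ Finset.range N, koszulSign F (a + i * (N - 1 - a)) •
        desusp V (insertAt Δ N a i t) := by
  suffices H : cobarD (signTwist V 1) (desuspOp Δ i) ∘ₗ desusp V ∘ₗ word V N =
      ∑ a ∈ Finset.range N, koszulSign F (a + i * (N - 1 - a)) • (desusp V ∘ₗ insertAt Δ N a i) by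
    have := LinearMap.congr_fun H t
    simpa using this
  refine tensorPower_hom_ext fun p x => ?_
  rw [LinearMap.comp_apply, LinearMap.comp_apply, word, TensorPower.toTensorAlgebra_tprod,
    desusp_tprod, map_smul, cobarD_tprod, Finset.sum_range, LinearMap.sum_apply, Finset.smul_sum]
  refine Finset.sum_congr rfl fun a _ => ?_
  rw [LinearMap.smul_apply, LinearMap.comp_apply, insertAt,
    desusp_koszulTensor _ (fun b => if b = a then i else 1)
      (fun b => if b = a then p b + i + -2 else p b), smul_smul, smul_smul, ← koszulSign_add,
    ← koszulSign_add]
  · congr 1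
    · exact koszulSign_congr (insertAt_sign_even p a i)
    · congr 2
      funext b
      by_cases hb : b = a
      · subst hb
        simp [desuspOp]
      · have hb' : (b : ℕ) ≠ a := fun h => hb (Fin.ext h)
        simp [hb, hb', desusp_ι]
  · intro b
    by_cases hb : b = a
    · subst hb
      simpa using h.word_mem hi _ _
    · have hb' : (b : ℕ) ≠ a := fun h => hb (Fin.ext h)
      simpa [hb, hb'] using ι_incl_mem_wordDegree _ _

/-- The contribution of `Δ_i` inserted into the values of `f_N`, in the cobar construction. -/
def insertSum (Δ : Ops W W) (f : Ops V W) (x : Total V) (N i : ℕ) :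
    TensorAlgebra F (Total W) :=
  cobarD (signTwist W 1) (desuspOp Δ i) (desuspOp f N x)

theorem cobarD_cobarMap (Δ : Ops W W) (f : Ops V W) (m : ℕ) (x : Total V) :
    cobarD (signTwist W 1) (cobarMap Δ m) (cobarMap f m x) =
      ∑ N ∈ Finset.Ico 1 (m + 2), ∑ i ∈ Finset.Ico 1 (m + 2), insertSum Δ f x N i := by
  have : cobarD (signTwist W 1) (cobarMap Δ m) =
      ∑ i ∈ Finset.Ico 1 (m + 2), cobarD (signTwist W 1) (desuspOp Δ i) := by
    refine (isSkewDer_cobarD _ _).ext_ι (α := cobarParity (signTwist W 1))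
      (β := AlgHom.id F _) (fun u v => ?_) fun y => ?_
    · simp only [LinearMap.sum_apply, cobarD_mul, Finset.sum_add_distrib, Finset.sum_mul,
        Finset.mul_sum, AlgHom.id_apply]
    · simp only [LinearMap.sum_apply, cobarD_ι, cobarMap_apply]
  rw [this, cobarMap_apply, map_sum]
  simp only [LinearMap.sum_apply]
  rfl

theorem insertSum_mem {Δ : Ops W W} {f : Ops V W} {r : ℤ} (h : HasOpDegree Δ (-2))
    (hf : HasOpDegree f r) (x : Total V) {N i : ℕ} (hN : 1 ≤ N) (hi : 1 ≤ i) :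
    insertSum Δ f x N i ∈ augIdeal F (Total W) ^ (N + i - 1) := by
  obtain ⟨N, rfl⟩ := Nat.exists_eq_add_of_le' hN
  have := (isSkewDer_cobarD (signTwist W 1) (desuspOp Δ i)).mem_pow (cobarParity_ι_mem _)
    algHom_id_ι_mem hi (fun y => by rw [cobarD_ι]; exact desuspOp_mem h hi y) N
    (desuspOp_mem hf hN x)
  rwa [show N + 1 + i - 1 = N + i by omega]

/-- The sum that occurs in the Stasheff identities and in the identities for morphisms. -/
theorem sum_insertSum {Δ : Ops W W} (f : Ops V W) (h : HasOpDegree Δ (-2)) (x : Total V) (n : ℕ) :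
    ∑ i ∈ Finset.Icc 1 n, insertSum Δ f x (n - i + 1) i =
      desusp W (∑ i ∈ Finset.Icc 1 n, ∑ j ∈ Finset.range (n - i + 1),
        (-1 : F) ^ ((n - i - j) + i * j) •
          (insertOp Δ (n - i - j) i j (f (n - i - j + 1 + j) x))) := by
  rw [map_sum]
  refine Finset.sum_congr rfl fun i hi => ?_
  rw [Finset.mem_Icc] at hi
  change cobarD _ (desuspOp Δ i) (desusp W (word W _ (f _ x))) = _
  -- The identities count the position from the right: j letters after the insertion, hence a = n −
  -- i − j before it.
  rw [cobarD_desusp_word h hi.1, map_sum, ← Finset.sum_range_reflect]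
  refine Finset.sum_congr rfl fun j hj => ?_
  rw [Finset.mem_range] at hj
  have e1 : n - i + 1 - 1 - j = n - i - j := by omega
  have e2 : n - i + 1 = n - i - j + 1 + j := by omega
  rw [map_smul, ← koszulSign_natCast]
  -- The arity occurs in types, so it becomes a variable before its two expressions are identified.
  generalize hN : n - i + 1 = N at *
  rw [e1]
  subst e2
  congr 1
  congr 1
  push_cast
  ring

/-- The square of indices (N, i) contains the whole diagonal N + i − 1 = n for each n ≤ m, which
sums to S n. All other terms lie in J. -/
theorem sum_mem_of_antidiagonal {A : Type*} [AddCommGroup A] [Module F A] {J : Submodule F A}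
    {U : ℕ → ℕ → A} {S : ℕ → A} {m : ℕ}
    (h : ∀ n, 1 ≤ n → n ≤ m → ∑ i ∈ Finset.Icc 1 n, U (n - i + 1) i = S n)
    (hU : ∀ N i, 1 ≤ N → 1 ≤ i → m + 1 ≤ N + i - 1 → U N i ∈ J) :
    ∑ N ∈ Finset.Ico 1 (m + 2), ∑ i ∈ Finset.Ico 1 (m + 2), U N i - ∑ n ∈ Finset.Icc 1 m, S n
      ∈ J := by
  rw [← Finset.sum_product', ← Finset.sum_filter_add_sum_filter_not _
    (fun q : ℕ × ℕ => q.1 + q.2 ≤ m + 1)]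
  have h1 : ∑ q ∈ (Finset.Ico 1 (m + 2) ×ˢ Finset.Ico 1 (m + 2)).filter
      (fun q : ℕ × ℕ => q.1 + q.2 ≤ m + 1), U q.1 q.2 = ∑ n ∈ Finset.Icc 1 m, S n := by
    rw [← Finset.sum_congr rfl fun n hn => h n (Finset.mem_Icc.mp hn).1 (Finset.mem_Icc.mp hn).2,
      Finset.sum_sigma']
    refine Finset.sum_bij' (fun q _ => ⟨q.1 + q.2 - 1, q.2⟩)
      (fun q _ => (q.1 - q.2 + 1, q.2)) ?_ ?_ ?_ ?_ ?_
    · simp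
      omega
    · simp
      omega
    · simp
      omega
    · rintro ⟨n, i⟩
      simp
      omega
    · rintro ⟨N, i⟩
      simp
      intros
      congr 1
      omega
  rw [h1, add_sub_cancel_left]
  refine Submodule.sum_mem _ fun q hq => ?_
  simp only [Finset.mem_filter, Finset.mem_product, Finset.mem_Ico] at hq
  exact hU _ _ hq.1.1.1 hq.1.2.1 (by omega)

theorem cobarMap_linear {f : Ops V W} {r : ℤ} (hf : HasOpDegree f r) {m : ℕ} (x : Total V) :
    cobarMap f m x - ι F (linearPart f x) ∈ augIdeal F (Total W) ^ 2 := by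
  have h1 : desuspOp f 1 x = ι F (linearPart f x) := by
    have : ∀ t : ⨂[F]^1 (Total W), desusp W (word W 1 t) =
        ι F (PiTensorProduct.subsingletonEquiv (R := F) (s := fun _ : Fin 1 => Total W) 0 t) := by
      intro t
      induction t using PiTensorProduct.induction_on with
      | smul_tprod c y =>
        simp [word, tprod_apply, desusp_ι]
      | add t t' h h' => simp only [map_add, h, h']
    exact this _
  rw [cobarMap_apply, Finset.sum_eq_sum_Ico_succ_bot (by omega), h1, add_sub_cancel_left]
  refine Submodule.sum_mem _ fun n hn => ?_
  rw [Finset.mem_Ico] at hn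
  exact augIdeal_pow_le (by omega) hn.1 (desuspOp_mem hf (by omega) x)

theorem IsCoalgebra.hasOpDegree {Δ : Ops V V} (h : IsCoalgebra Δ) : HasOpDegree Δ (-2) :=
  fun n hn p x => by simpa [sub_eq_add_neg] using h.degree n hn p x

theorem IsMorphism.hasOpDegree {Δ : Ops V V} {Δ' : Ops W W} {f : Ops V W}
    (h : IsMorphism Δ Δ' f) : HasOpDegree f (-1) :=
  fun n hn p x => by simpa [sub_eq_add_neg] using h.degree n hn p x

/-- The Stasheff identities say that the cobar differential squares to zero. -/
theorem IsCoalgebra.isCobar {Δ : Ops V V} (h : IsCoalgebra Δ) (m : ℕ) :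
    IsCobar (signTwist V 1) (linearPart Δ) (cobarMap Δ m) m where
  invol := signTwist_invol 1
  two h2 := signTwist_of_two h2 1
  linear := cobarMap_linear h.hasOpDegree
  parity x := by
    rw [cobarParity_cobarMap h.hasOpDegree, koszulSign_even ⟨-1, by ring⟩, one_smul]
  square x := by
    have h1 := sum_mem_of_antidiagonal (F := F) (J := augIdeal F (Total V) ^ (m + 1))
      (U := insertSum Δ Δ x) (S := 0) (m := m) (fun n hn _ => ?_) (fun N i hN hi hm => ?_)
    · rw [cobarD_cobarMap]
      simpa using h1
    · rw [sum_insertSum Δ h.hasOpDegree]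
      have h2 := LinearMap.congr_fun (h.stasheff n hn) x
      simp only [LinearMap.sum_apply, LinearMap.smul_apply, LinearMap.comp_apply,
        LinearMap.zero_apply] at h2
      -- The exponents i + j + ij and (n − i − j) + ij differ in parity by n, a sign common to the
      -- whole identity.
      have h3 := congrArg (fun u => (-1 : F) ^ n • u) h2
      simp only [smul_zero, Finset.smul_sum, smul_smul, ← pow_add] at h3
      rw [Pi.zero_apply, ← map_zero (desusp V), ← h3]
      congr 1
      refine Finset.sum_congr rfl fun i hi => Finset.sum_congr rfl fun j hj => ?_
      rw [Finset.mem_Icc] at hi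
      rw [Finset.mem_range] at hj
      congr 1
      have : n + (i + j + i * j) = (n - i - j) + i * j + 2 * (i + j) := by omega
      rw [this, pow_add _ _ (2 * (i + j)), pow_mul]
      simp
    · exact augIdeal_pow_le (by omega) hm (insertSum_mem h.hasOpDegree h.hasOpDegree x hN hi)

end Operations

section Morphisms

variable {F : Type v} [Field F] {V W : GradedSpace.{v, w} F}

open TensorAlgebra

/-- The tensor product `f_{k_1} ⊗ ⋯ ⊗ f_{k_l}`. -/
def tensorOp (f : Ops V W) {l : ℕ} (k : Fin l → ℕ) :
    ⨂[F]^l (Total V) →ₗ[F] TensorAlgebra F (Total W) :=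
  koszulTensor (fun b => (k b : ℤ) - 1) (fun b => word W (k b) ∘ₗ f (k b))

/-- The exponent of the sign of `f_{k_1} ⊗ ⋯ ⊗ f_{k_l}` in the identities for morphisms. -/
def tensorOpSign {l : ℕ} (k : Fin l → ℕ) : ℤ :=
  ∑ b, ∑ c ∈ Finset.Ioi b, (k c : ℤ) * (k b - 1)

/-- With e_b = k_b − 1, the terms of a pair b < c combine to e_b + e_b e_c = (k_b − 1) k_c. The
factor l − b (with b counted from 1) is the number of such c. -/
theorem morphismSign_eq {n : ℕ} (c : Composition n) :
    (morphismSign c : ℤ) = tensorOpSign c.blocksFun := by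
  have h : ∀ b, 1 ≤ c.blocksFun b := fun b => c.one_le_blocksFun b
  have h1 : ∀ b : Fin c.length, ((c.length - 1 - b : ℕ) : ℤ) = (Finset.Ioi b).card := fun b => by
    rw [Fin.card_Ioi]
  have h2 : ∑ b : Fin c.length, ∑ a ∈ Finset.Iio b, (c.blocksFun a - 1) * (c.blocksFun b - 1) =
      ∑ b : Fin c.length, ∑ a ∈ Finset.Ioi b, (c.blocksFun b - 1) * (c.blocksFun a - 1) :=
    Finset.sum_comm' (by simp)
  rw [morphismSign, h2, tensorOpSign]
  push_cast [h1, h]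
  rw [← Finset.sum_add_distrib]
  refine Finset.sum_congr rfl fun b _ => ?_
  rw [← nsmul_eq_mul, ← Finset.sum_const, ← Finset.sum_add_distrib]
  refine Finset.sum_congr rfl fun a _ => ?_
  ring

/-- For each pair b < c the signs agree: (k_c − 1) p_b + k_c (p_b + k_b − 1) is congruent to p_b +
k_c (k_b − 1) modulo 2. -/
theorem desusp_tensorOp {f : Ops V W} (hf : HasOpDegree f (-1)) {l : ℕ} (k : Fin l → ℕ)
    (hk : ∀ b, 1 ≤ k b) (p : Fin l → ℤ) (x : ∀ b, V (p b)) :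
    koszulSign F (∑ b, ∑ _c ∈ Finset.Ioi b, p b) •
      (List.ofFn fun b => desuspOp f (k b) (incl V (p b) (x b))).prod =
    koszulSign F (tensorOpSign k) •
      desusp W (tensorOp f k (PiTensorProduct.tprod F fun b => incl V (p b) (x b))) := by
  rw [tensorOp, desusp_koszulTensor _ k _ _ _ _ fun b => hf.word_mem (hk b) _ _, smul_smul,
    ← koszulSign_add]
  congr 1
  apply koszulSign_congr
  rw [tensorOpSign, ← Finset.sum_add_distrib, ← Finset.sum_sub_distrib]
  refine Finset.even_sum _ fun b _ => ?_
  rw [← Finset.sum_add_distrib, ← Finset.sum_sub_distrib]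
  refine Finset.even_sum _ fun c _ => ?_
  exact ⟨p b - k c * (k b - 1) - k c * p b, by ring⟩

theorem list_prod_mem_augIdeal_pow {M : Type*} [AddCommGroup M] [Module F M] {l : ℕ}
    (k : Fin l → ℕ) (u : Fin l → TensorAlgebra F M) (hu : ∀ b, u b ∈ augIdeal F M ^ k b) :
    (List.ofFn u).prod ∈ augIdeal F M ^ (∑ b, k b) := by
  induction l with
  | zero => simp
  | succ l ih =>
    rw [List.ofFn_succ, List.prod_cons, Fin.sum_univ_succ]
    exact mul_mem_augIdeal_pow (hu 0) (ih _ _ fun b => hu b.succ)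

theorem tensorOp_mem {f : Ops V W} (hf : HasOpDegree f (-1)) {l : ℕ} (k : Fin l → ℕ)
    (hk : ∀ b, 1 ≤ k b) (t : ⨂[F]^l (Total V)) :
    desusp W (tensorOp f k t) ∈ augIdeal F (Total W) ^ (∑ b, k b) := by
  -- Vanishing in the quotient is an equality of linear maps, so it can be tested on homogeneous
  -- tensors.
  have h : (augIdeal F (Total W) ^ (∑ b, k b)).mkQ ∘ₗ desusp W ∘ₗ tensorOp f k = 0 := by
    refine tensorPower_hom_ext fun p x => ?_
    rw [LinearMap.comp_apply, LinearMap.zero_apply, Submodule.mkQ_apply,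
      Submodule.Quotient.mk_eq_zero, LinearMap.comp_apply]
    have h1 := congrArg (fun u => koszulSign F (tensorOpSign k) • u) (desusp_tensorOp hf k hk p x)
    simp only [smul_smul, koszulSign_mul_self, one_smul] at h1
    rw [← h1]
    exact Submodule.smul_mem _ _ (list_prod_mem_augIdeal_pow _ _ fun b => desuspOp_mem hf (hk b) _)
  have := LinearMap.congr_fun h t
  rwa [LinearMap.comp_apply, LinearMap.zero_apply, Submodule.mkQ_apply,
      Submodule.Quotient.mk_eq_zero] at this

theorem lift_desusp_word {f : Ops V W} (hf : HasOpDegree f (-1)) (m : ℕ) {l : ℕ}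
    (t : ⨂[F]^l (Total V)) :
    lift F (cobarMap f m) (desusp V (word V l t)) =
      ∑ k ∈ Fintype.piFinset fun _ : Fin l => Finset.Ico 1 (m + 2),
        koszulSign F (tensorOpSign k) • desusp W (tensorOp f k t) := by
  suffices H : (lift F (cobarMap f m)).toLinearMap ∘ₗ desusp V ∘ₗ word V l =
      ∑ k ∈ Fintype.piFinset fun _ : Fin l => Finset.Ico 1 (m + 2),
        koszulSign F (tensorOpSign k) • (desusp W ∘ₗ tensorOp f k) by
    have := LinearMap.congr_fun H t
    simpa using this
  refine tensorPower_hom_ext fun p x => ?_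
  rw [LinearMap.comp_apply, LinearMap.comp_apply, word, TensorPower.toTensorAlgebra_tprod,
    desusp_tprod, map_smul, LinearMap.sum_apply, tprod_apply, AlgHom.toLinearMap_apply,
    map_list_prod, List.map_ofFn]
  simp only [Function.comp_def, lift_ι_apply, cobarMap_apply]
  rw [← MultilinearMap.mkPiAlgebraFin_apply (R := F), MultilinearMap.map_sum_finset,
    Finset.smul_sum]
  refine Finset.sum_congr rfl fun k hk => ?_
  rw [Fintype.mem_piFinset] at hk
  rw [MultilinearMap.mkPiAlgebraFin_apply]
  exact desusp_tensorOp hf k (fun b => (Finset.mem_Ico.mp (hk b)).1) p x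

/-- The term of `(f_{k_1} ⊗ ⋯ ⊗ f_{k_l}) Δ_l`. -/
def tensorTerm (f : Ops V W) (Δ : Ops V V) (x : Total V) (e : Σ l : ℕ, Fin l → ℕ) :
    TensorAlgebra F (Total W) :=
  koszulSign F (tensorOpSign e.2) • desusp W (tensorOp f e.2 (Δ e.1 x))

/-- Families of l positive numbers are compositions of their sum. The reindexing is the one used for
composing formal power series, here with length and blocks between 1 and m + 1. -/
theorem lift_cobarMap {f : Ops V W} (hf : HasOpDegree f (-1)) (Δ : Ops V V) (m : ℕ)
    (x : Total V) :
    lift F (cobarMap f m) (cobarMap Δ m x) =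
      ∑ c ∈ FormalMultilinearSeries.compPartialSumTarget 1 (m + 2) (m + 2),
        tensorTerm f Δ x ⟨c.2.length, c.2.blocksFun⟩ := by
  rw [← FormalMultilinearSeries.compChangeOfVariables_sum 1 (m + 2) (m + 2) (tensorTerm f Δ x),
    FormalMultilinearSeries.compPartialSumSource, Finset.sum_sigma, cobarMap_apply, map_sum]
  · refine Finset.sum_congr rfl fun l _ => ?_
    exact lift_desusp_word hf m (Δ l x)
  · intro e he
    congr 1
    refine (Sigma.ext ?_ ?_).symm
    · exact FormalMultilinearSeries.compChangeOfVariables_length _ _ _ he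
    · refine (Fin.heq_fun_iff
        (FormalMultilinearSeries.compChangeOfVariables_length _ _ _ he)).mpr fun i => ?_
      exact FormalMultilinearSeries.compChangeOfVariables_blocksFun _ _ _ he ⟨i, _⟩

/-- All compositions of a number n with 1 ≤ n ≤ m occur in the sum, their length and blocks being at
most n. The remaining ones have total at least m + 1 and contribute to I^(m+1). -/
theorem sum_tensorTerm_sub_mem {f : Ops V W} (hf : HasOpDegree f (-1)) (Δ : Ops V V) (m : ℕ)
    (x : Total V) :
    lift F (cobarMap f m) (cobarMap Δ m x) -
      ∑ n ∈ Finset.Icc 1 m, ∑ c : Composition n, tensorTerm f Δ x ⟨c.length, c.blocksFun⟩ ∈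
        augIdeal F (Total W) ^ (m + 1) := by
  rw [lift_cobarMap hf, ← Finset.sum_filter_add_sum_filter_not _
    (fun c : Σ n, Composition n => c.1 ≤ m)]
  have h1 : (FormalMultilinearSeries.compPartialSumTarget 1 (m + 2) (m + 2)).filter
      (fun c : Σ n, Composition n => c.1 ≤ m) = (Finset.Icc 1 m).sigma fun _ => Finset.univ := by
    ext ⟨n, c⟩
    simp only [Finset.mem_filter, FormalMultilinearSeries.mem_compPartialSumTarget_iff,
      Finset.mem_sigma, Finset.mem_univ, and_true, Finset.mem_Icc]
    constructor
    · rintro ⟨⟨h1, -⟩, h2⟩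
      exact ⟨h1.trans c.length_le, h2⟩
    · rintro ⟨h1, h2⟩
      refine ⟨⟨Composition.length_pos_of_pos _ h1, by have := c.length_le; omega, fun j => ?_⟩, h2⟩
      have := c.blocksFun_le j
      omega
  rw [h1, Finset.sum_sigma, add_sub_cancel_left]
  refine Submodule.sum_mem _ fun c hc => Submodule.smul_mem _ _ ?_
  rw [Finset.mem_filter] at hc
  refine augIdeal_pow_le (by omega) ?_ (tensorOp_mem hf _ (fun b => c.2.one_le_blocksFun b) _)
  rw [c.2.sum_blocksFun]
  omega

/-- The identities for morphisms say that the induced map of cobar constructions commutes with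
the differentials. -/
theorem IsMorphism.isCobarMap {Δ : Ops V V} {Δ' : Ops W W} {f : Ops V W}
    (h : IsMorphism Δ Δ' f) (hW : IsCoalgebra Δ') (m : ℕ) :
    IsCobarMap (signTwist V 1) (cobarMap Δ m) (signTwist W 1) (cobarMap Δ' m) (linearPart f)
      (cobarMap f m) m where
  linear := cobarMap_linear h.hasOpDegree
  parity x := by
    rw [cobarParity_cobarMap h.hasOpDegree, koszulSign_congr (b := 1) ⟨-1, by ring⟩,
      koszulSign_one, neg_one_smul]
  comm x := by
    have h1 := sum_mem_of_antidiagonal (F := F) (J := augIdeal F (Total W) ^ (m + 1))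
      (U := insertSum Δ' f x) (S := fun n => ∑ c : Composition n,
        tensorTerm f Δ x ⟨c.length, c.blocksFun⟩) (m := m) (fun n hn _ => ?_)
      (fun N i hN hi hm => ?_)
    · rw [cobarD_cobarMap]
      have h2 := sub_mem h1 (sum_tensorTerm_sub_mem h.hasOpDegree Δ m x)
      convert h2 using 1
      abel
    · rw [sum_insertSum f hW.hasOpDegree]
      have h2 := LinearMap.congr_fun (h.identity n hn) x
      simp only [LinearMap.sum_apply, LinearMap.smul_apply, LinearMap.comp_apply] at h2
      rw [h2, map_sum]
      refine Finset.sum_congr rfl fun c _ => ?_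
      rw [map_smul, ← koszulSign_natCast, morphismSign_eq]
      rfl
    · exact augIdeal_pow_le (by omega) hm (insertSum_mem hW.hasOpDegree h.hasOpDegree x hN hi)

end Morphisms

/-! ### Minimal coalgebras -/

section Minimal

variable {F : Type v} [Field F] {V : GradedSpace.{v, w} F}

open TensorAlgebra

open Polynomial in
/-- The algebra map that records the lengths of words. -/
def lengthGrading (F M : Type*) [Field F] [AddCommGroup M] [Module F M] :
    TensorAlgebra F M →ₐ[F] (TensorAlgebra F M)[X] :=
  lift F ((LinearMap.mulRight F (X : (TensorAlgebra F M)[X])) ∘ₗ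
    (Polynomial.CAlgHom (R := F)).toLinearMap ∘ₗ ι F)

theorem lengthGrading_ι {M : Type*} [AddCommGroup M] [Module F M] (x : M) :
    lengthGrading F M (ι F x) = Polynomial.C (ι F x) * Polynomial.X := by
  simp [lengthGrading, lift_ι_apply]

theorem lengthGrading_tprod {M : Type*} [AddCommGroup M] [Module F M] {l : ℕ} (x : Fin l → M) :
    lengthGrading F M (tprod F M l x) = Polynomial.C (tprod F M l x) * Polynomial.X ^ l := by
  induction l with
  | zero => simp [tprod_apply]
  | succ l ih =>
    rw [tprod_succ, map_mul, ih, lengthGrading_ι, Polynomial.C_mul, pow_succ', mul_assoc,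
      mul_assoc, ← mul_assoc Polynomial.X, Polynomial.X_mul_C, mul_assoc]

/-- The constant coefficient is the augmentation, so each factor from I contributes at least one
power of X. -/
theorem lengthGrading_augIdeal {M : Type*} [AddCommGroup M] [Module F M] {n : ℕ}
    {u : TensorAlgebra F M} (hu : u ∈ augIdeal F M ^ n) :
    ∀ i < n, (lengthGrading F M u).coeff i = 0 := by
  have h1 : ∀ u : TensorAlgebra F M,
      (lengthGrading F M u).coeff 0 = algebraMap F _ (algebraMapInv u) := by
    intro u
    induction u using TensorAlgebra.induction with
    | algebraMap r =>
      rw [AlgHom.commutes, AlgHom.commutes, Polynomial.algebraMap_apply]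
      simp
    | ι x => simp [lengthGrading_ι, algebraMapInv]
    | mul a b ha hb => rw [map_mul, Polynomial.mul_coeff_zero, ha, hb, map_mul, map_mul]
    | add a b ha hb => rw [map_add, Polynomial.coeff_add, ha, hb, map_add, map_add]
  induction n generalizing u with
  | zero => simp
  | succ n ih =>
    rw [pow_succ'] at hu
    induction hu using Submodule.mul_induction_on' with
    | mem_mul_mem a ha b hb =>
      intro i hi
      rw [map_mul, Polynomial.coeff_mul]
      refine Finset.sum_eq_zero fun q hq => ?_
      replace hq := Finset.HasAntidiagonal.mem_antidiagonal.mp hq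
      rcases Nat.eq_zero_or_pos q.1 with h | h
      · rw [h, h1, mem_augIdeal.mp ha, map_zero, zero_mul]
      · rw [ih hb q.2 (by omega), mul_zero]
    | add a _ b _ ha hb =>
      intro i hi
      rw [map_add, Polynomial.coeff_add, ha i hi, hb i hi, add_zero]

theorem lengthGrading_word {n : ℕ} (t : ⨂[F]^n (Total V)) :
    lengthGrading F (Total V) (word V n t) = Polynomial.C (word V n t) * Polynomial.X ^ n := by
  induction t using PiTensorProduct.induction_on with
  | smul_tprod c y =>
    rw [map_smul, word, TensorPower.toTensorAlgebra_tprod, map_smul, lengthGrading_tprod,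
      ← Polynomial.smul_C, smul_mul_assoc]
  | add t t' h h' => simp only [map_add, h, h', add_mul]

theorem word_injective (n : ℕ) : Function.Injective (word V n) := by
  have h : ∀ t : ⨂[F]^n (Total V), ofDirectSum (DirectSum.of (fun n => ⨂[F]^n (Total V)) n t) =
      word V n t := fun t => DirectSum.toAddMonoid_of _ _ _
  intro s t hst
  rw [← h, ← h] at hst
  exact DirectSum.of_injective n (equivDirectSum.symm.injective hst)

theorem eq_zero_of_word_mem {n : ℕ} {t : ⨂[F]^n (Total V)}
    (ht : word V n t ∈ augIdeal F (Total V) ^ (n + 1)) : t = 0 := by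
  have h := lengthGrading_augIdeal ht n (Nat.lt_succ_self n)
  rw [lengthGrading_word, Polynomial.coeff_C_mul, Polynomial.coeff_X_pow_self, mul_one] at h
  exact word_injective n (h.trans (map_zero _).symm)

/-- The desuspension signs can be undone. -/
theorem desusp_desusp {n : ℕ} {d : ℤ} {u : TensorAlgebra F (Total V)}
    (hu : u ∈ wordDegree V n d) : desusp V (desusp V u) = u := by
  refine wordDegree_induction (C := fun u => desusp V (desusp V u) = u) (fun p x _ => ?_) ?_
    (fun u v hu hv => ?_) (fun r u hu => ?_) hu
  · rw [desusp_tprod, map_smul, desusp_tprod, smul_smul, koszulSign_mul_self, one_smul]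
  · simp
  · rw [map_add, map_add, hu, hv]
  · rw [map_smul, map_smul, hu]

theorem desusp_mem_wordDegree {n : ℕ} {d : ℤ} {u : TensorAlgebra F (Total V)}
    (hu : u ∈ wordDegree V n d) : desusp V u ∈ wordDegree V n d := by
  refine wordDegree_induction (C := fun u => desusp V u ∈ wordDegree V n d) (fun p x hp => ?_) ?_
    (fun u v hu hv => ?_) (fun r u hu => ?_) hu
  · rw [desusp_tprod]
    refine Submodule.smul_mem _ _ ⟨_, Submodule.subset_span ⟨p, x, hp, rfl⟩, ?_⟩
    rw [word, TensorPower.toTensorAlgebra_tprod]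
  · rw [map_zero]; exact zero_mem _
  · rw [map_add]; exact add_mem hu hv
  · rw [map_smul]; exact Submodule.smul_mem _ _ hu

theorem eq_zero_of_desuspOp_mem {Δ : Ops V V} {r : ℤ} (h : HasOpDegree Δ r) {n : ℕ} (hn : 1 ≤ n)
    (p : ℤ) (x : V p)
    (hx : desuspOp Δ n (incl V p x) ∈ augIdeal F (Total V) ^ (n + 1)) :
    Δ n (incl V p x) = 0 := by
  have h1 := h.word_mem hn p x
  obtain ⟨t, -, ht⟩ := desusp_mem_wordDegree h1
  have h2 : word V n t ∈ augIdeal F (Total V) ^ (n + 1) := by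
    rw [ht]
    exact hx
  have h3 := desusp_desusp h1
  rw [← ht, eq_zero_of_word_mem h2, map_zero, map_zero] at h3
  exact word_injective n (h3.symm.trans (map_zero _).symm)

/-- If `Δ_n = 0` for `n < m`, then the obstruction to extending `x` is `Δ_m x`. -/
theorem extends_iff_of_vanishing {Δ : Ops V V} (h : HasOpDegree Δ (-2)) {m : ℕ} (hm : 1 ≤ m)
    (h0 : ∀ n, 1 ≤ n → n < m → Δ n = 0) (p : ℤ) (x : V p) :
    Extends (signTwist V 1) (cobarMap Δ m) m (incl V p x) ↔ Δ m (incl V p x) = 0 := by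
  -- `cobarMap` stops at arity m + 1, so besides Δ_m only that last term survives, and it lies in
  -- I^(m+1).
  have h1 : ∀ y, cobarMap Δ m y - desuspOp Δ m y ∈ augIdeal F (Total V) ^ (m + 1) := by
    intro y
    rw [cobarMap_apply, Finset.sum_Ico_succ_top (by omega), Finset.sum_Ico_succ_top hm,
      Finset.sum_eq_zero fun n hn => ?_, zero_add, add_sub_cancel_left]
    · exact desuspOp_mem h (by omega) y
    · rw [Finset.mem_Ico] at hn
      rw [desuspOp, h0 n hn.1 hn.2]
      simp
  have h2 : ∀ y, cobarMap Δ m y ∈ augIdeal F (Total V) ^ m := fun y => by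
    have := add_mem (augIdeal_pow_succ_le hm (h1 y)) (desuspOp_mem h hm y)
    rwa [sub_add_cancel] at this
  constructor
  · rintro ⟨c, hc, hD⟩
    -- D lengthens words by at least m − 1, hence sends I² into I^(m+1): no correction c affects the
    -- part of D x of length m.
    have h3 := (isSkewDer_cobarD (signTwist V 1) (cobarMap Δ m)).mem_pow (cobarParity_ι_mem _)
      algHom_id_ι_mem hm (fun y => by rw [cobarD_ι]; exact h2 y) 1 hc
    rw [map_add, cobarD_ι] at hD
    rw [add_comm 1 m] at h3
    refine eq_zero_of_desuspOp_mem h hm p x ?_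
    have h4 := sub_mem (sub_mem hD h3) (h1 (incl V p x))
    convert h4 using 1
    abel
  · intro hx
    refine ⟨0, zero_mem _, ?_⟩
    have := h1 (incl V p x)
    rw [desuspOp, LinearMap.comp_apply, LinearMap.comp_apply, hx, map_zero, map_zero,
      sub_zero] at this
    rwa [add_zero, cobarD_ι]

end Minimal

/-! ### Invariants of quasi-isomorphic coalgebras -/

section Invariants

variable {F : Type v} [Field F] {V W : GradedSpace.{v, w} F}

/-- The cycles of degree `p` that extend to cycles of the truncated cobar construction. -/
def extendsAt (Δ : Ops V V) (m : ℕ) (p : ℤ) : Submodule F (V p) where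
  carrier := {x | linearPart Δ (incl V p x) = 0 ∧
    Extends (signTwist V 1) (cobarMap Δ m) m (incl V p x)}
  zero_mem' := ⟨by simp, 0, zero_mem _, by simp⟩
  add_mem' {x y} hx hy := by
    refine ⟨?_, ?_⟩
    · rw [map_add, map_add, hx.1, hy.1, add_zero]
    · rw [map_add]
      exact hx.2.add hy.2
  smul_mem' r x hx := by
    refine ⟨?_, ?_⟩
    · rw [map_smul, map_smul, hx.1, smul_zero]
    · rw [map_smul]
      exact hx.2.smul r

theorem mem_extendsAt {Δ : Ops V V} {m : ℕ} {p : ℤ} {x : V p} : x ∈ extendsAt Δ m p ↔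
    linearPart Δ (incl V p x) = 0 ∧ Extends (signTwist V 1) (cobarMap Δ m) m (incl V p x) :=
  Iff.rfl

/-- The boundaries of degree `p`. -/
def boundariesAt (Δ : Ops V V) (p : ℤ) : Submodule F (V p) :=
  (LinearMap.range (linearPart Δ)).comap (incl V p)

/-- The dimension of the space of homology classes of degree `p` that extend to cycles of the
truncated cobar construction. -/
def extendsRank (Δ : Ops V V) (m : ℕ) (p : ℤ) : Cardinal :=
  Module.rank F ((extendsAt Δ m p).map (boundariesAt Δ p).mkQ)

/-- All homology classes extend to cycles of the truncated cobar construction. -/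
def AllExtend (Δ : Ops V V) (m : ℕ) : Prop :=
  ∀ x, linearPart Δ x = 0 → Extends (signTwist V 1) (cobarMap Δ m) m x

/-- The map `f` has degree `r`. -/
def HasDegree (f : Total V →ₗ[F] Total W) (r : ℤ) : Prop :=
  ∀ (p : ℤ) (x : V p), ∃ y, f (incl V p x) = incl W (p + r) y

theorem HasDegree.component {f : Total V →ₗ[F] Total W} {r : ℤ} (h : HasDegree f r) (p : ℤ)
    (x : Total V) :
    f (incl V p (DirectSum.component F ℤ _ p x)) =
      incl W (p + r) (DirectSum.component F ℤ _ (p + r) (f x)) := by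
  induction x using total_induction with
  | hi q x =>
    obtain ⟨y, hy⟩ := h q x
    rw [hy]
    by_cases hq : q = p
    · subst hq
      simp only [incl, DirectSum.component.lof_self] at hy ⊢
      exact hy
    · have h1 : DirectSum.component F ℤ (fun d => V d) p (incl V q x) = 0 := by
        rw [DirectSum.component.of, dif_neg hq]
      have h2 : DirectSum.component F ℤ (fun d => W d) (p + r) (incl W (q + r) y) = 0 := by
        rw [DirectSum.component.of, dif_neg (by omega)]
      rw [h1, h2, map_zero, map_zero, map_zero]
  | ha x y hx hy => simp only [map_add, hx, hy]

theorem component_incl (p : ℤ) (x : V p) :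
    DirectSum.component F ℤ (fun d => V d) p (incl V p x) = x :=
  DirectSum.component.lof_self F (M := fun d => V d) p x

/-- A quasi-isomorphism of truncated cobar constructions, with linear part `f`. -/
structure IsCobarEquiv (Δ : Ops V V) (Δ' : Ops W W) (f : Total V →ₗ[F] Total W) (m : ℕ) :
    Prop where
  cobar : IsCobar (signTwist V 1) (linearPart Δ) (cobarMap Δ m) m
  cobar' : IsCobar (signTwist W 1) (linearPart Δ') (cobarMap Δ' m) m
  degree : HasDegree (linearPart Δ) (-1)
  degree' : HasDegree (linearPart Δ') (-1)
  degree_map : HasDegree f 0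
  map : ∃ φ, IsCobarMap (signTwist V 1) (cobarMap Δ m) (signTwist W 1) (cobarMap Δ' m) f φ m
  injective : ∀ x, linearPart Δ x = 0 → (∃ y, linearPart Δ' y = f x) →
    ∃ z, linearPart Δ z = x
  surjective : ∀ y, linearPart Δ' y = 0 →
    ∃ x, linearPart Δ x = 0 ∧ ∃ z, linearPart Δ' z = y - f x

namespace IsCobarEquiv

variable {Δ : Ops V V} {Δ' : Ops W W} {f : Total V →ₗ[F] Total W} {m : ℕ}

theorem extends_iff (h : IsCobarEquiv Δ Δ' f m) (hm : 1 ≤ m) {x : Total V}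
    (hx : linearPart Δ x = 0) :
    Extends (signTwist V 1) (cobarMap Δ m) m x ↔
      Extends (signTwist W 1) (cobarMap Δ' m) m (f x) := by
  obtain ⟨φ, hφ⟩ := h.map
  exact AInfty.extends_iff hφ h.cobar h.cobar' hm h.injective h.surjective hx

theorem d_f (h : IsCobarEquiv Δ Δ' f m) (hm : 1 ≤ m) (x : Total V) :
    linearPart Δ' (f x) = f (linearPart Δ x) := by
  obtain ⟨φ, hφ⟩ := h.map
  exact hφ.d_f h.cobar h.cobar' hm x

theorem allExtend_iff (h : IsCobarEquiv Δ Δ' f m) (hm : 1 ≤ m) :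
    AllExtend Δ m ↔ AllExtend Δ' m := by
  constructor
  · intro hA y hy
    obtain ⟨x, hx, z, hz⟩ := h.surjective y hy
    have h1 := ((h.extends_iff hm hx).mp (hA x hx)).add (h.cobar'.extends_d z)
    rwa [hz, add_sub_cancel] at h1
  · intro hA x hx
    exact (h.extends_iff hm hx).mpr (hA _ (by rw [h.d_f hm, hx, map_zero]))

/-- The maps being homogeneous, one passes to the components of degree p of the preimage and of
degree p + 1 of the bounding element. -/
theorem surjective_degree (h : IsCobarEquiv Δ Δ' f m) (p : ℤ) (y : W p)
    (hy : linearPart Δ' (incl W p y) = 0) :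
    ∃ x : V p, linearPart Δ (incl V p x) = 0 ∧
      ∃ z, linearPart Δ' z = incl W p y - f (incl V p x) := by
  obtain ⟨x, hx, z, hz⟩ := h.surjective _ hy
  refine ⟨DirectSum.component F ℤ (fun d => V d) p x, ?_,
    incl W (p + 1) (DirectSum.component F ℤ (fun d => W d) (p + 1) z), ?_⟩
  · rw [h.degree.component, hx, map_zero, map_zero]
  · have h1 := h.degree'.component (p + 1) z
    have h2 := h.degree_map.component p x
    rw [h1, h2, hz]
    have : ∀ q, q = p → incl W q (DirectSum.component F ℤ (fun d => W d) q
        (incl W p y - f x)) = incl W p y - incl W p (DirectSum.component F ℤ (fun d => W d) p (f x)) := by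
      rintro q rfl
      rw [map_sub, map_sub, component_incl]
    rw [this _ (by ring)]
    have : ∀ q, q = p → incl W p (DirectSum.component F ℤ (fun d => W d) p (f x)) =
        incl W q (DirectSum.component F ℤ (fun d => W d) q (f x)) := by
      rintro q rfl
      rfl
    rw [this (p + 0) (by ring)]

theorem mem_boundariesAt {Δ : Ops V V} {p : ℤ} {x : V p} :
    x ∈ boundariesAt Δ p ↔ ∃ y, linearPart Δ y = incl V p x := Iff.rfl

/-- Extendable cycles of V map to chains modulo boundaries of V by A, and of W by B. The kernels
agree because f is a chain map injective on homology, and the ranges are the two spaces of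
extendable classes. That B reaches all of the second uses surjectivity on homology and the fact that
boundaries extend. -/
theorem extendsRank_eq (h : IsCobarEquiv Δ Δ' f m) (hm : 1 ≤ m) (p : ℤ) :
    extendsRank Δ m p = extendsRank Δ' m p := by
  set fp : V p →ₗ[F] W p := DirectSum.component F ℤ (fun d => W d) p ∘ₗ f ∘ₗ incl V p with hfp
  have hf : ∀ x, incl W p (fp x) = f (incl V p x) := by
    intro x
    obtain ⟨y, hy⟩ := h.degree_map p x
    have : ∀ q, q = p → ∀ y : W q, incl W p (DirectSum.component F ℤ (fun d => W d) p
        (incl W q y)) = incl W q y := by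
      rintro q rfl y
      rw [component_incl]
    rw [hfp, LinearMap.comp_apply, LinearMap.comp_apply, hy, this _ (by ring)]
  obtain ⟨A, hA⟩ : ∃ A : extendsAt Δ m p →ₗ[F] V p ⧸ boundariesAt Δ p,
    A = (boundariesAt Δ p).mkQ ∘ₗ (extendsAt Δ m p).subtype := ⟨_, rfl⟩
  obtain ⟨B, hB⟩ : ∃ B : extendsAt Δ m p →ₗ[F] W p ⧸ boundariesAt Δ' p,
    B = (boundariesAt Δ' p).mkQ ∘ₗ fp ∘ₗ (extendsAt Δ m p).subtype := ⟨_, rfl⟩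
  have hAx : ∀ x, A x = (boundariesAt Δ p).mkQ x.1 := fun x => by rw [hA]; rfl
  have hBx : ∀ x, B x = (boundariesAt Δ' p).mkQ (fp x.1) := fun x => by rw [hB]; rfl
  have hker : LinearMap.ker A = LinearMap.ker B := by
    ext ⟨x, hx⟩
    rw [LinearMap.mem_ker, LinearMap.mem_ker, hAx, hBx, Submodule.mkQ_apply, Submodule.mkQ_apply,
      Submodule.Quotient.mk_eq_zero, Submodule.Quotient.mk_eq_zero, mem_boundariesAt,
      mem_boundariesAt, hf]
    constructor
    · rintro ⟨y, hy⟩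
      exact ⟨f y, by rw [h.d_f hm, hy]⟩
    · exact h.injective _ hx.1
  have hrA : LinearMap.range A = (extendsAt Δ m p).map (boundariesAt Δ p).mkQ := by
    rw [hA, LinearMap.range_comp, Submodule.range_subtype]
  have hrB : LinearMap.range B = (extendsAt Δ' m p).map (boundariesAt Δ' p).mkQ := by
    ext q
    constructor
    · rintro ⟨⟨x, hx⟩, rfl⟩
      rw [hBx]
      refine ⟨fp x, ⟨?_, ?_⟩, rfl⟩
      · rw [hf, h.d_f hm, hx.1, map_zero]
      · rw [hf]
        exact (h.extends_iff hm hx.1).mp hx.2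
    · rintro ⟨y, hy, rfl⟩
      obtain ⟨x, hx, z, hz⟩ := h.surjective_degree p y hy.1
      refine ⟨⟨x, hx, (h.extends_iff hm hx).mpr ?_⟩, ?_⟩
      · have h1 := hy.2.add (Extends.smul (-1) (h.cobar'.extends_d z))
        rw [hz] at h1
        convert h1 using 1
        rw [neg_one_smul]
        abel
      · rw [hBx, eq_comm, Submodule.mkQ_apply, Submodule.mkQ_apply, Submodule.Quotient.eq,
          mem_boundariesAt]
        exact ⟨z, hz.trans (by rw [map_sub, hf])⟩
  rw [extendsRank, extendsRank, ← hrA, ← hrB]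
  exact ((Submodule.quotEquivOfEq _ _ hker).symm.trans A.quotKerEquivRange).symm.trans
    B.quotKerEquivRange |>.rank_eq

end IsCobarEquiv

theorem tensorDegree_one {d : ℤ} {t : ⨂[F]^1 (Total W)} (ht : t ∈ tensorDegree W 1 d) :
    ∃ y, PiTensorProduct.subsingletonEquiv (R := F) (s := fun _ : Fin 1 => Total W) 0 t =
      incl W d y := by
  induction ht using Submodule.span_induction with
  | mem t ht =>
    obtain ⟨p, x, hp, rfl⟩ := ht
    rw [Fin.sum_univ_one] at hp
    subst hp
    exact ⟨x 0, by simp⟩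
  | zero => exact ⟨0, by simp⟩
  | add t t' _ _ h h' =>
    obtain ⟨y, hy⟩ := h
    obtain ⟨y', hy'⟩ := h'
    exact ⟨y + y', by rw [map_add, map_add, hy, hy']⟩
  | smul r t _ h =>
    obtain ⟨y, hy⟩ := h
    exact ⟨r • y, by rw [map_smul, map_smul, hy]⟩

theorem HasOpDegree.linearPart {f : Ops V W} {r : ℤ} (h : HasOpDegree f r) :
    HasDegree (linearPart f) (1 + r) := fun p x => by
  obtain ⟨y, hy⟩ := tensorDegree_one (h 1 le_rfl p x)
  have : ∀ q, q = p + (1 + r) → ∀ y : W q, ∃ z, incl W q y = incl W (p + (1 + r)) z := by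
    rintro q rfl y
    exact ⟨y, rfl⟩
  obtain ⟨z, hz⟩ := this _ (by push_cast; ring) y
  exact ⟨z, hy.trans hz⟩

theorem IsQuasiIso.isCobarEquiv {Δ : Ops V V} {Δ' : Ops W W} {f : Ops V W}
    (h : IsQuasiIso Δ Δ' f) (hV : IsCoalgebra Δ) (hW : IsCoalgebra Δ') (m : ℕ) :
    IsCobarEquiv Δ Δ' (linearPart f) m where
  cobar := hV.isCobar m
  cobar' := hW.isCobar m
  degree := hV.hasOpDegree.linearPart
  degree' := hW.hasOpDegree.linearPart
  degree_map := h.morphism.hasOpDegree.linearPart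
  map := ⟨_, h.morphism.isCobarMap hW m⟩
  injective := h.injective
  surjective := h.surjective

/-- The invariants of `Δ` and `Δ'` agree. -/
def SameInvariants (Δ : Ops V V) (Δ' : Ops W W) : Prop :=
  ∀ m, 1 ≤ m → (AllExtend Δ m ↔ AllExtend Δ' m) ∧
    ∀ p, extendsRank Δ m p = extendsRank Δ' m p

theorem SameInvariants.symm {Δ : Ops V V} {Δ' : Ops W W} (h : SameInvariants Δ Δ') :
    SameInvariants Δ' Δ :=
  fun m hm => ⟨(h m hm).1.symm, fun p => ((h m hm).2 p).symm⟩

theorem SameInvariants.trans {U : GradedSpace.{v, w} F} {Δ : Ops V V} {Δ' : Ops W W}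
    {Δ'' : Ops U U} (h : SameInvariants Δ Δ') (h' : SameInvariants Δ' Δ'') :
    SameInvariants Δ Δ'' :=
  fun m hm => ⟨(h m hm).1.trans (h' m hm).1, fun p => ((h m hm).2 p).trans ((h' m hm).2 p)⟩

theorem SameInvariants.of_isCobarEquiv {Δ : Ops V V} {Δ' : Ops W W} {f : Total V →ₗ[F] Total W}
    (h : ∀ m, 1 ≤ m → IsCobarEquiv Δ Δ' f m) : SameInvariants Δ Δ' :=
  fun m hm => ⟨(h m hm).allExtend_iff hm, (h m hm).extendsRank_eq hm⟩

/-- Agreement of invariants is an equivalence relation, so an arrow of the zigzag may point either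
way. -/
theorem QuasiIsomorphic.sameInvariants {Δ : Ops V V} {Δ' : Ops W W}
    (h : QuasiIsomorphic Δ Δ') : SameInvariants Δ Δ' := by
  have : ∀ A B : (Σ U : GradedSpace.{v, w} F, Ops U U), Relation.EqvGen
      (fun A B => IsCoalgebra A.2 ∧ IsCoalgebra B.2 ∧ ∃ f : Ops A.1 B.1, IsQuasiIso A.2 B.2 f)
      A B → SameInvariants A.2 B.2 := by
    intro A B hAB
    induction hAB with
    | rel A B h =>
      obtain ⟨hA, hB, f, hf⟩ := h
      exact SameInvariants.of_isCobarEquiv fun m _ => hf.isCobarEquiv hA hB m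
    | refl A => exact fun m _ => ⟨Iff.rfl, fun _ => rfl⟩
    | symm A B _ ih => exact ih.symm
    | trans A B C _ _ ih ih' => exact ih.trans ih'
  exact this _ _ h

/-! ### Minimal coalgebras -/

theorem lt_firstNonzero_iff {Δ : Ops V V} {m : ℕ} :
    (m : ℕ∞) < firstNonzero Δ ↔ ∀ n, 1 ≤ n → n ≤ m → Δ n = 0 := by
  constructor
  · intro h n hn hnm
    by_contra hne
    have : firstNonzero Δ ≤ n := sInf_le ⟨n, hn, hne, rfl⟩
    exact absurd (h.trans_le this) (by simpa using hnm)
  · intro h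
    have h1 : ((m + 1 : ℕ) : ℕ∞) ≤ firstNonzero Δ := by
      refine le_sInf ?_
      rintro _ ⟨n, hn, hne, rfl⟩
      by_contra hlt
      rw [not_le, Nat.cast_lt] at hlt
      exact hne (h n hn (by omega))
    exact lt_of_lt_of_le (by exact_mod_cast Nat.lt_succ_self m) h1

theorem vanishing_of_le_firstNonzero {Δ : Ops V V} {m : ℕ} (h : (m : ℕ∞) ≤ firstNonzero Δ) :
    ∀ n, 1 ≤ n → n < m → Δ n = 0 := fun n hn hnm =>
  lt_firstNonzero_iff.mp (lt_of_lt_of_le (by exact_mod_cast hnm) h) n hn le_rfl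

theorem IsMinimal.linearPart {Δ : Ops V V} (h : IsMinimal Δ) (x : Total V) :
    linearPart Δ x = 0 := by
  rw [AInfty.linearPart, show Δ 1 = 0 from h]
  simp

/-- In a minimal coalgebra everything is a cycle and only zero is a boundary, so extendable classes
are the zeros of the obstruction Δ_m. -/
theorem extendsRank_of_isMinimal {Δ : Ops V V} (h : IsCoalgebra Δ) (hmin : IsMinimal Δ) {m : ℕ}
    (hm : 1 ≤ m) (h0 : (m : ℕ∞) ≤ firstNonzero Δ) (p : ℤ) :
    extendsRank Δ m p = Module.rank F (kerAt Δ m p) := by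
  have h1 : extendsAt Δ m p = kerAt Δ m p := by
    ext x
    rw [mem_extendsAt, extends_iff_of_vanishing h.hasOpDegree hm (vanishing_of_le_firstNonzero h0),
      kerAt, LinearMap.mem_ker, LinearMap.comp_apply]
    simp [hmin.linearPart]
  have h2 : boundariesAt Δ p = ⊥ := by
    rw [eq_bot_iff]
    rintro x ⟨y, hy⟩
    rw [hmin.linearPart] at hy
    have := congrArg (DirectSum.component F ℤ (fun d => V d) p) hy
    rw [component_incl, map_zero] at this
    exact this.symm
  rw [extendsRank, h1]
  refine ((Submodule.equivMapOfInjective _ ?_ _).rank_eq).symm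
  rw [← LinearMap.ker_eq_bot, Submodule.ker_mkQ, h2]

/-- Once Δ_n = 0 for all n < j, extendability of everything at stage j says Δ_j = 0, and induction
continues. -/
theorem lt_firstNonzero_iff_allExtend {Δ : Ops V V} (h : IsCoalgebra Δ) (hmin : IsMinimal Δ)
    (m : ℕ) : (m : ℕ∞) < firstNonzero Δ ↔ ∀ j, 1 ≤ j → j ≤ m → AllExtend Δ j := by
  rw [lt_firstNonzero_iff]
  constructor
  · intro h0 j hj hjm x _
    induction x using total_induction with
    | hi p x =>
      rw [extends_iff_of_vanishing h.hasOpDegree hj fun n hn hnj => h0 n hn (by omega), h0 j hj hjm]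
      rfl
    | ha x y hx hy => exact (hx (hmin.linearPart x)).add (hy (hmin.linearPart y))
  · intro hA n
    induction n using Nat.strong_induction_on with
    | _ n ih =>
      intro hn hnm
      refine DirectSum.linearMap_ext F fun p => LinearMap.ext fun x => ?_
      exact (extends_iff_of_vanishing h.hasOpDegree hn
        (fun j hj hjn => ih j hjn hj (by omega)) p x).mp (hA n hn hnm _ (hmin.linearPart _))

/-- The number `k` and the dimensions of the kernels of `Δ_1, …, Δ_k` agree for minimal coalgebras
with the same invariants. -/
theorem SameInvariants.conclusion {Δ : Ops V V} {Δ' : Ops W W} (hs : SameInvariants Δ Δ')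
    (h : IsCoalgebra Δ) (hmin : IsMinimal Δ) (h' : IsCoalgebra Δ') (hmin' : IsMinimal Δ') :
    firstNonzero Δ = firstNonzero Δ' ∧
      ∀ m : ℕ, 1 ≤ m → (m : ℕ∞) ≤ firstNonzero Δ → ∀ p : ℕ,
        Module.rank F (kerAt Δ m p) = Module.rank F (kerAt Δ' m p) := by
  have hk : firstNonzero Δ = firstNonzero Δ' := by
    -- An element of ℕ∞, including +∞, is determined by the natural numbers strictly below it.
    have hlt : ∀ m : ℕ, (m : ℕ∞) < firstNonzero Δ ↔ (m : ℕ∞) < firstNonzero Δ' := fun m => by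
      rw [lt_firstNonzero_iff_allExtend h hmin, lt_firstNonzero_iff_allExtend h' hmin']
      exact forall₃_congr fun j hj _ => (hs j hj).1
    rcases lt_trichotomy (firstNonzero Δ) (firstNonzero Δ') with hl | hl | hl
    · lift firstNonzero Δ to ℕ using ne_top_of_lt hl with k
      exact absurd ((hlt k).mpr hl) (lt_irrefl _)
    · exact hl
    · lift firstNonzero Δ' to ℕ using ne_top_of_lt hl with k
      exact absurd ((hlt k).mp hl) (lt_irrefl _)
  refine ⟨hk, fun m hm hmk p => ?_⟩
  rw [← extendsRank_of_isMinimal h hmin hm hmk, ← extendsRank_of_isMinimal h' hmin' hm (hk ▸ hmk)]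
  exact (hs m hm).2 p

end Invariants

/-! ### Homotopy invariance of singular chains -/

section Homotopy

variable (F : Type v) [Field F]

/-- The free vector space functor. -/
def freeSpace : Type u ⥤ ModuleCat.{max u v} F where
  obj S := ModuleCat.of F (S →₀ F)
  map f := ModuleCat.ofHom (Finsupp.lmapDomain F F f)
  map_id S := by
    ext x
    simp
  map_comp f g := by
    ext x
    simp

/-- The simplicial vector space spanned by a simplicial set. -/
abbrev freeSimplicial (K : SSet.{u}) : SimplicialObject (ModuleCat.{max u v} F) :=
  ((SimplicialObject.whiskering _ _).obj (freeSpace F)).obj K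

variable {K L : SSet.{u}}

/-- The inclusion of the chains of degree `n`. -/
def chainIncl (n : ℕ) : (Simplex K n →₀ F) →ₗ[F] SChain F K :=
  Finsupp.lmapDomain F F (fun σ => ⟨n, σ⟩)

theorem chainIncl_single {n : ℕ} (σ : Simplex K n) :
    chainIncl F n (Finsupp.single σ 1) = simplex F σ := by
  simp [chainIncl]

/-- The boundary operator in degree `n + 1`. -/
def simplicialBoundary (n : ℕ) : (Simplex K (n + 1) →₀ F) →ₗ[F] (Simplex K n →₀ F) :=
  (((AlgebraicTopology.alternatingFaceMapComplex _).obj (freeSimplicial F K)).d (n + 1) n).hom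

theorem simplicialBoundary_single {n : ℕ} (σ : Simplex K (n + 1)) :
    simplicialBoundary F n (Finsupp.single σ 1) =
      ∑ i : Fin (n + 2), (-1 : ℤ) ^ (i : ℕ) • Finsupp.single (K.δ i σ) (1 : F) := by
  have h : ∀ (s : Finset (Fin (n + 2))) (g : Fin (n + 2) → ((freeSimplicial F K).obj
      (Opposite.op (SimplexCategory.mk (n + 1))) ⟶ (freeSimplicial F K).obj
        (Opposite.op (SimplexCategory.mk n)))), (∑ i ∈ s, g i).hom = ∑ i ∈ s, (g i).hom :=
    fun s g => map_sum (ModuleCat.homAddEquiv) g s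
  rw [simplicialBoundary, AlgebraicTopology.alternatingFaceMapComplex_obj_d,
    AlgebraicTopology.AlternatingFaceMapComplex.objD]
  refine (LinearMap.congr_fun (h Finset.univ _) (Finsupp.single σ (1 : F))).trans ?_
  refine (LinearMap.sum_apply _ _ _).trans (Finset.sum_congr rfl fun i _ => ?_)
  refine (LinearMap.congr_fun (ModuleCat.hom_zsmul _ ((freeSimplicial F K).δ i))
    (Finsupp.single σ (1 : F))).trans ?_
  exact congrArg (fun c : Simplex K n →₀ F => (-1 : ℤ) ^ (i : ℕ) • c) Finsupp.mapDomain_single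

theorem boundary_chainIncl (n : ℕ) (c : Simplex K (n + 1) →₀ F) :
    boundary F K (chainIncl F (n + 1) c) = chainIncl F n (simplicialBoundary F n c) := by
  have : boundary F K ∘ₗ chainIncl F (n + 1) = chainIncl F n ∘ₗ simplicialBoundary F n := by
    refine Finsupp.lhom_ext' fun σ => LinearMap.ext_ring ?_
    change boundary F K (chainIncl F (n + 1) (Finsupp.single σ 1)) =
      chainIncl F n (simplicialBoundary F n (Finsupp.single σ 1))
    rw [chainIncl_single, boundary, Finsupp.linearCombination_single, one_smul, boundarySimplex,
      simplicialBoundary_single, map_sum]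
    refine Finset.sum_congr rfl fun i _ => ?_
    rw [map_zsmul, chainIncl_single, ← Int.cast_smul_eq_zsmul F]
    simp
  exact LinearMap.congr_fun this c

theorem boundary_chainIncl_zero (c : Simplex K 0 →₀ F) : boundary F K (chainIncl F 0 c) = 0 := by
  have : boundary F K ∘ₗ chainIncl F 0 = 0 := by
    refine Finsupp.lhom_ext' fun σ => LinearMap.ext_ring ?_
    change boundary F K (chainIncl F 0 (Finsupp.single σ 1)) = 0
    rw [chainIncl_single, boundary, Finsupp.linearCombination_single, one_smul, boundarySimplex]
  exact LinearMap.congr_fun this c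

theorem boundary_boundary (c : SChain F K) : boundary F K (boundary F K c) = 0 := by
  have : boundary F K ∘ₗ boundary F K = 0 := by
    refine Finsupp.lhom_ext' fun ⟨n, σ⟩ => LinearMap.ext_ring ?_
    change boundary F K (boundary F K (simplex F σ)) = 0
    rw [← chainIncl_single]
    rcases n with _ | _ | n
    · rw [boundary_chainIncl_zero, map_zero]
    · rw [boundary_chainIncl, boundary_chainIncl_zero]
    · rw [boundary_chainIncl, boundary_chainIncl]
      have h : simplicialBoundary F n (simplicialBoundary F (n + 1) (Finsupp.single σ 1)) = 0 :=
        LinearMap.congr_fun (congrArg ModuleCat.Hom.hom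
          (((AlgebraicTopology.alternatingFaceMapComplex _).obj
            (freeSimplicial F K)).d_comp_d (n + 1 + 1) (n + 1) n)) (Finsupp.single σ (1 : F))
      rw [h, map_zero]
  exact LinearMap.congr_fun this c

theorem chainMap_chainIncl (φ : K ⟶ L) (n : ℕ) (c : Simplex K n →₀ F) :
    chainMap F φ (chainIncl F n c) = chainIncl F n (Finsupp.lmapDomain F F (φ.app _) c) := by
  have : chainMap F φ ∘ₗ chainIncl F n =
      chainIncl F n ∘ₗ Finsupp.lmapDomain F F (φ.app (Opposite.op (SimplexCategory.mk n))) := by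
    refine Finsupp.lhom_ext' fun σ => LinearMap.ext_ring ?_
    change chainMap F φ (chainIncl F n (Finsupp.single σ 1)) =
      chainIncl F n (Finsupp.mapDomain _ (Finsupp.single σ 1))
    rw [Finsupp.mapDomain_single, chainIncl_single, chainMap, Finsupp.lmapDomain_apply,
      Finsupp.mapDomain_single]
    exact (chainIncl_single F _).symm
  exact LinearMap.congr_fun this c

/-- Simplicially homotopic maps induce chain homotopic maps. -/
theorem exists_chainHomotopy {φ ψ : K ⟶ L} (H : SimplicialObject.Homotopy φ ψ) :
    ∃ P : SChain F K →ₗ[F] SChain F L, ∀ c,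
      chainMap F φ c - chainMap F ψ c = boundary F L (P c) + P (boundary F K c) := by
  -- The free functor carries the homotopy to simplicial vector spaces, where it yields a chain
  -- homotopy; its components are then assembled into one map of total spaces.
  let h := (H.whiskerRight (freeSpace F)).toChainHomotopy
  let hN : ∀ n, (Simplex K n →₀ F) →ₗ[F] (Simplex L (n + 1) →₀ F) :=
    fun n => (h.hom n (n + 1)).hom
  let P : SChain F K →ₗ[F] SChain F L := Finsupp.linearCombination F fun s =>
    chainIncl F (s.1 + 1) (hN s.1 (Finsupp.single s.2 1))
  have hP : ∀ n (c : Simplex K n →₀ F), P (chainIncl F n c) = chainIncl F (n + 1) (hN n c) := by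
    intro n c
    have : P ∘ₗ chainIncl F n = chainIncl F (n + 1) ∘ₗ hN n := by
      refine Finsupp.lhom_ext' fun σ => LinearMap.ext_ring ?_
      change P (chainIncl F n (Finsupp.single σ 1)) = _
      rw [chainIncl_single, Finsupp.linearCombination_single, one_smul]
      rfl
    exact LinearMap.congr_fun this c
  have hzero : ∀ c : Simplex K 0 →₀ F, Finsupp.lmapDomain F F (φ.app _) c =
      simplicialBoundary F 0 (hN 0 c) + Finsupp.lmapDomain F F (ψ.app _) c := by
    intro c
    have := h.comm 0
    rw [prevD_eq (j' := 1) (w := by simp), dNext_eq_zero _ _ (by simp), zero_add] at this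
    exact LinearMap.congr_fun (congrArg ModuleCat.Hom.hom this) c
  have hsucc : ∀ n, ∀ c : Simplex K (n + 1) →₀ F, Finsupp.lmapDomain F F (φ.app _) c =
      hN n (simplicialBoundary F n c) + simplicialBoundary F (n + 1) (hN (n + 1) c) +
        Finsupp.lmapDomain F F (ψ.app _) c := by
    intro n c
    have := h.comm (n + 1)
    rw [dNext_eq (i' := n) (w := by simp), prevD_eq (j' := n + 2) (w := by simp)] at this
    exact LinearMap.congr_fun (congrArg ModuleCat.Hom.hom this) c
  refine ⟨P, fun c => ?_⟩
  have : chainMap F φ - chainMap F ψ = boundary F L ∘ₗ P + P ∘ₗ boundary F K := by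
    refine Finsupp.lhom_ext' fun ⟨n, σ⟩ => LinearMap.ext_ring ?_
    change chainMap F φ (simplex F σ) - chainMap F ψ (simplex F σ) =
      boundary F L (P (simplex F σ)) + P (boundary F K (simplex F σ))
    rw [← chainIncl_single, chainMap_chainIncl, chainMap_chainIncl, hP, boundary_chainIncl,
      ← map_sub]
    rcases n with _ | n
    · rw [boundary_chainIncl_zero, map_zero, add_zero, hzero, add_sub_cancel_right]
    · rw [boundary_chainIncl, hP, hsucc, add_sub_cancel_right, map_add, add_comm]
  exact LinearMap.congr_fun this c

theorem exists_chainHomotopy_of_homotopy {X Y : TopCat.{u}} {f g : X ⟶ Y}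
    (H : ContinuousMap.Homotopy f.hom g.hom) :
    ∃ P : Sing F X →ₗ[F] Sing F Y, ∀ c,
      chainMap F (TopCat.toSSet.map f) c - chainMap F (TopCat.toSSet.map g) c =
        boundary F _ (P c) + P (boundary F _ c) :=
  exists_chainHomotopy F (TopCat.Homotopy.toSSet H).toSimplicialObjectHomotopy

end Homotopy

/-! ### Differential graded coalgebras -/

section Coalgebra

variable {F : Type*} [Field F] {M N : Type*} [AddCommGroup M] [Module F M]
  [AddCommGroup N] [Module F N]

open TensorAlgebra

/-- A coassociative differential graded coalgebra with differential `d` and coproduct `Δ`, where `t`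
is the parity involution. -/
structure IsDGCoalgebra (t d : M →ₗ[F] M) (Δ : M →ₗ[F] M ⊗[F] M) : Prop where
  parity_d : ∀ x, t (d x) = -d (t x)
  d_d : ∀ x, d (d x) = 0
  parity : ∀ x, TensorProduct.map t t (Δ x) = Δ (t x)
  chain : ∀ x, Δ (d x) =
    TensorProduct.map d LinearMap.id (Δ x) + TensorProduct.map t d (Δ x)
  coassoc : ∀ x, TensorProduct.assoc F _ _ _ (TensorProduct.map Δ LinearMap.id (Δ x)) =
    TensorProduct.map LinearMap.id Δ (Δ x)

/-- Applied to the projection of singular chains onto reduced chains, this exhibits the latter as a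
quotient coalgebra. -/
theorem IsDGCoalgebra.of_surjective {t d : M →ₗ[F] M} {Δ : M →ₗ[F] M ⊗[F] M}
    (h : IsDGCoalgebra t d Δ) {t' d' : N →ₗ[F] N} {Δ' : N →ₗ[F] N ⊗[F] N} {p : M →ₗ[F] N}
    (hp : Function.Surjective p) (ht : ∀ x, t' (p x) = p (t x)) (hd : ∀ x, d' (p x) = p (d x))
    (hΔ : ∀ x, Δ' (p x) = TensorProduct.map p p (Δ x)) : IsDGCoalgebra t' d' Δ' := by
  have ht' : t' ∘ₗ p = p ∘ₗ t := LinearMap.ext ht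
  have hd' : d' ∘ₗ p = p ∘ₗ d := LinearMap.ext hd
  have hΔ' : Δ' ∘ₗ p = TensorProduct.map p p ∘ₗ Δ := LinearMap.ext hΔ
  have hcomp : ∀ {A B : Type _} [AddCommGroup A] [Module F A] [AddCommGroup B] [Module F B]
      (a : N →ₗ[F] A) (b : N →ₗ[F] B) (u : M ⊗[F] M), TensorProduct.map a b
        (TensorProduct.map p p u) = TensorProduct.map (a ∘ₗ p) (b ∘ₗ p) u := by
    intro A B _ _ _ _ a b u
    rw [TensorProduct.map_comp]
    rfl
  have hcomp' : ∀ (a b : M →ₗ[F] M) (u : M ⊗[F] M), TensorProduct.map (p ∘ₗ a) (p ∘ₗ b) u =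
      TensorProduct.map p p (TensorProduct.map a b u) := by
    intro a b u
    rw [TensorProduct.map_comp]
    rfl
  refine ⟨?_, ?_, ?_, ?_, ?_⟩ <;> intro y <;> obtain ⟨x, rfl⟩ := hp y
  · rw [hd, ht, ht, hd, h.parity_d, map_neg]
  · rw [hd, hd, h.d_d, map_zero]
  · rw [hΔ, hcomp, ht', hcomp', h.parity, ht, hΔ]
  · rw [hd, hΔ, hΔ, h.chain, map_add, hcomp, hcomp, ht', hd', hcomp', ← hcomp']
    rfl
  · rw [hΔ, hcomp, hcomp, hΔ', LinearMap.id_comp]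
    have h1 : ∀ u : M ⊗[F] M, TensorProduct.map p (TensorProduct.map p p ∘ₗ Δ) u =
        TensorProduct.map p (TensorProduct.map p p) (TensorProduct.map LinearMap.id Δ u) := by
      intro u
      rw [← LinearMap.comp_apply, ← TensorProduct.map_comp, LinearMap.comp_id]
    have h2 : ∀ u : M ⊗[F] M, TensorProduct.map (TensorProduct.map p p ∘ₗ Δ) p u =
        TensorProduct.map (TensorProduct.map p p) p (TensorProduct.map Δ LinearMap.id u) := by
      intro u
      rw [← LinearMap.comp_apply, ← TensorProduct.map_comp, LinearMap.comp_id]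
    rw [h1, h2, ← h.coassoc]
    exact LinearMap.congr_fun (TensorProduct.map_map_comp_assoc_eq p p p).symm _

/-- The desuspended product `a ⊗ b ↦ ± a b` in the tensor algebra. -/
def desuspSquare (t : M →ₗ[F] M) : M ⊗[F] M →ₗ[F] TensorAlgebra F M :=
  LinearMap.mul' F _ ∘ₗ TensorProduct.map (ι F ∘ₗ t) (ι F)

@[simp]
theorem desuspSquare_tmul (t : M →ₗ[F] M) (a b : M) :
    desuspSquare t (a ⊗ₜ[F] b) = ι F (t a) * ι F b := rfl

theorem desuspSquare_mem (t : M →ₗ[F] M) (u : M ⊗[F] M) :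
    desuspSquare t u ∈ augIdeal F M ^ 2 := by
  induction u with
  | zero => rw [map_zero]; exact zero_mem _
  | tmul a b =>
    rw [desuspSquare_tmul, pow_two]
    exact Submodule.mul_mem_mul (ι_mem_augIdeal _) (ι_mem_augIdeal _)
  | add u v hu hv => rw [map_add]; exact add_mem hu hv

/-- In D² x the words of length one cancel by d² = 0, those of length two because Δ is a chain map,
and those of length three by coassociativity. -/
theorem IsDGCoalgebra.isCobar {t d : M →ₗ[F] M} {Δ : M →ₗ[F] M ⊗[F] M} (h : IsDGCoalgebra t d Δ)
    (ht : ∀ x, t (t x) = x) (h2 : (2 : F) = 0 → ∀ x, t x = x) {δ : M →ₗ[F] TensorAlgebra F M}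
    (hδ : ∀ x, δ x = ι F (d x) + desuspSquare t (Δ x)) (m : ℕ) : IsCobar t d δ m where
  invol := ht
  two := h2
  linear x := by
    rw [hδ, add_sub_cancel_left]
    exact desuspSquare_mem t _
  parity x := by
    have h1 : ∀ u, cobarParity t (desuspSquare t u) = desuspSquare t (TensorProduct.map t t u) := by
      intro u
      induction u with
      | zero => simp
      | tmul a b => simp [ht]
      | add u v hu hv => simp only [map_add, hu, hv]
    rw [hδ, hδ, map_add, cobarParity_ι, h1, h.parity, h.parity_d, map_neg, neg_neg]
  square x := by
    -- The signed triple product a ⊗ (b ⊗ c) ↦ a · t(b) · c, through which both iterated coproducts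
    -- are expressed.
    let τ : M ⊗[F] (M ⊗[F] M) →ₗ[F] TensorAlgebra F M :=
      LinearMap.mul' F _ ∘ₗ TensorProduct.map (ι F) (desuspSquare t)
    have h1 : ∀ a b, desuspSquare t (Δ (t a)) * ι F b =
        τ (TensorProduct.assoc F _ _ _ (Δ a ⊗ₜ[F] b)) := by
      intro a b
      rw [← h.parity]
      generalize Δ a = u
      induction u with
      | zero => simp
      | tmul c e => simp [τ, ht, mul_assoc]
      | add u v hu hv => simp only [map_add, add_mul, TensorProduct.add_tmul, hu, hv]
    have h3 : ∀ u, cobarD t δ (desuspSquare t u) =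
        -desuspSquare t (TensorProduct.map d LinearMap.id u + TensorProduct.map t d u) +
          (τ (TensorProduct.assoc F _ _ _ (TensorProduct.map Δ LinearMap.id u)) -
            τ (TensorProduct.map LinearMap.id Δ u)) := by
      intro u
      induction u with
      | zero => simp
      | tmul a b =>
        have h4 : τ (a ⊗ₜ[F] Δ b) = ι F a * desuspSquare t (Δ b) := rfl
        simp only [desuspSquare_tmul, cobarD_mul, cobarD_ι, cobarParity_ι, ht, hδ, add_mul, h1,
          mul_add, neg_mul, map_add, TensorProduct.map_tmul, LinearMap.id_apply, h.parity_d,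
          map_neg, h4]
        abel
      | add u v hu hv =>
        simp only [map_add, hu, hv]
        abel
    rw [hδ, map_add, cobarD_ι, hδ, h.d_d, map_zero, zero_add, h3, h.coassoc, sub_self, add_zero,
      h.chain, add_neg_cancel]
    exact zero_mem _

theorem isCobarMap_of_strict {t d : M →ₗ[F] M} {Δ : M →ₗ[F] M ⊗[F] M}
    {δ : M →ₗ[F] TensorAlgebra F M} (hδ : ∀ x, δ x = ι F (d x) + desuspSquare t (Δ x))
    {t' d' : N →ₗ[F] N} {Δ' : N →ₗ[F] N ⊗[F] N} {δ' : N →ₗ[F] TensorAlgebra F N}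
    (hδ' : ∀ x, δ' x = ι F (d' x) + desuspSquare t' (Δ' x)) {f : M →ₗ[F] N}
    (ht : ∀ x, t' (f x) = f (t x)) (hd : ∀ x, d' (f x) = f (d x))
    (hΔ : ∀ x, Δ' (f x) = TensorProduct.map f f (Δ x)) (m : ℕ) :
    IsCobarMap t δ t' δ' f (ι F ∘ₗ f) m where
  linear x := by
    rw [LinearMap.comp_apply, sub_self]
    exact zero_mem _
  parity x := by simp [ht]
  comm x := by
    have h1 : ∀ u, lift F (ι F ∘ₗ f) (desuspSquare t u) =
        desuspSquare t' (TensorProduct.map f f u) := by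
      intro u
      induction u with
      | zero => simp
      | tmul a b => simp [lift_ι_apply, ht]
      | add u v hu hv => simp only [map_add, hu, hv]
    rw [LinearMap.comp_apply, cobarD_ι, hδ, hδ', map_add, lift_ι_apply, h1, LinearMap.comp_apply,
      hd, hΔ, sub_self]
    exact zero_mem _

end Coalgebra

/-! ### The cobar construction of reduced singular chains -/

section SingularChains

variable {F : Type v} [Field F] {K L : SSet.{u}}

theorem chain_hom_ext_simplex {M : Type*} [AddCommMonoid M] [Module F M]
    {g h : SChain F K →ₗ[F] M}
    (H : ∀ (n : ℕ) (σ : Simplex K n), g (simplex F σ) = h (simplex F σ)) : g = h :=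
  Finsupp.lhom_ext' fun ⟨n, σ⟩ => LinearMap.ext_ring (H n σ)

theorem chainSign_simplex {n : ℕ} (σ : Simplex K n) :
    chainSign F K (simplex F σ) = (-1 : F) ^ n • simplex F σ := by
  simp [chainSign]

theorem chainSign_chainIncl (n : ℕ) (c : Simplex K n →₀ F) :
    chainSign F K (chainIncl F n c) = (-1 : F) ^ n • chainIncl F n c := by
  have : chainSign F K ∘ₗ chainIncl F n = (-1 : F) ^ n • chainIncl F n := by
    refine Finsupp.lhom_ext' fun σ => LinearMap.ext_ring ?_
    change chainSign F K (chainIncl F n (Finsupp.single σ 1)) =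
      (-1 : F) ^ n • chainIncl F n (Finsupp.single σ 1)
    rw [chainIncl_single, chainSign_simplex]
  exact LinearMap.congr_fun this c

theorem chainSign_boundary (c : SChain F K) :
    chainSign F K (boundary F K c) = -boundary F K (chainSign F K c) := by
  have : chainSign F K ∘ₗ boundary F K = -(boundary F K ∘ₗ chainSign F K) := by
    refine chain_hom_ext_simplex fun n σ => ?_
    simp only [LinearMap.comp_apply, LinearMap.neg_apply, chainSign_simplex, map_smul]
    rw [← chainIncl_single]
    rcases n with _ | n
    · rw [boundary_chainIncl_zero]
      simp
    · rw [boundary_chainIncl, chainSign_chainIncl, pow_succ]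
      simp
  exact LinearMap.congr_fun this c

theorem chainMap_simplex (φ : K ⟶ L) {n : ℕ} (σ : Simplex K n) :
    chainMap F φ (simplex F σ) = simplex F (φ.app _ σ) := by
  simp [chainMap]

theorem augmentation_simplex {n : ℕ} (σ : Simplex K n) :
    augmentation F K (simplex F σ) = if n = 0 then 1 else 0 := by
  simp [augmentation]

theorem augmentation_chainMap (φ : K ⟶ L) (c : SChain F K) :
    augmentation F L (chainMap F φ c) = augmentation F K c := by
  have : augmentation F L ∘ₗ chainMap F φ = augmentation F K := by
    refine chain_hom_ext_simplex fun n σ => ?_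
    rw [LinearMap.comp_apply, chainMap_simplex, augmentation_simplex, augmentation_simplex]
  exact LinearMap.congr_fun this c

theorem chainSign_chainMap (φ : K ⟶ L) (c : SChain F K) :
    chainSign F L (chainMap F φ c) = chainMap F φ (chainSign F K c) := by
  have : chainSign F L ∘ₗ chainMap F φ = chainMap F φ ∘ₗ chainSign F K := by
    refine chain_hom_ext_simplex fun n σ => ?_
    rw [LinearMap.comp_apply, LinearMap.comp_apply, chainMap_simplex, chainSign_simplex,
      chainSign_simplex, map_smul, chainMap_simplex]
  exact LinearMap.congr_fun this c

theorem boundary_chainMap (φ : K ⟶ L) (c : SChain F K) :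
    boundary F L (chainMap F φ c) = chainMap F φ (boundary F K c) := by
  have : boundary F L ∘ₗ chainMap F φ = chainMap F φ ∘ₗ boundary F K := by
    refine chain_hom_ext_simplex fun n σ => ?_
    rw [LinearMap.comp_apply, LinearMap.comp_apply, chainMap_simplex]
    simp only [boundary, Finsupp.linearCombination_single, one_smul]
    rcases n with _ | n
    · simp [boundarySimplex]
    · simp only [boundarySimplex, map_sum, map_smul, chainMap_simplex]
      refine Finset.sum_congr rfl fun i _ => ?_
      congr 2
      exact (ConcreteCategory.congr_hom (SimplicialObject.δ_naturality φ i) σ).symm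
  exact LinearMap.congr_fun this c

theorem chainMap_comp {J : SSet.{u}} (φ : K ⟶ L) (ψ : L ⟶ J) (c : SChain F K) :
    chainMap F (φ ≫ ψ) c = chainMap F ψ (chainMap F φ c) := by
  have : chainMap F (φ ≫ ψ) = chainMap F ψ ∘ₗ chainMap F φ := by
    refine chain_hom_ext_simplex fun n σ => ?_
    rw [LinearMap.comp_apply, chainMap_simplex, chainMap_simplex, chainMap_simplex]
    rfl
  exact LinearMap.congr_fun this c

theorem chainMap_id (c : SChain F K) : chainMap F (𝟙 K) c = c := by
  have : chainMap F (𝟙 K) = LinearMap.id := by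
    refine chain_hom_ext_simplex fun n σ => ?_
    rw [chainMap_simplex]
    rfl
  exact LinearMap.congr_fun this c

theorem boundary_vertex (σ : Simplex K 0) : boundary F K (simplex F σ) = 0 := by
  rw [← chainIncl_single, boundary_chainIncl_zero]

variable {X Y : TopCat.{u}}

theorem DiagonalApproximation.parity (D : DiagonalApproximation.{u, v} F) (c : Sing F X) :
    TensorProduct.map (chainSign F _) (chainSign F _) (D.map X c) =
      D.map X (chainSign F _ c) := by
  have : TensorProduct.map (chainSign F _) (chainSign F _) ∘ₗ D.map X =
      D.map X ∘ₗ chainSign F _ := by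
    refine chain_hom_ext_simplex fun n σ => ?_
    rw [LinearMap.comp_apply, LinearMap.comp_apply, chainSign_simplex, map_smul]
    have h := D.degree X n σ
    generalize D.map X (simplex F σ) = u at h ⊢
    induction h using Submodule.span_induction with
    | mem t ht =>
      obtain ⟨i, j, α, β, rfl, rfl⟩ := ht
      rw [TensorProduct.map_tmul, chainSign_simplex, chainSign_simplex,
        TensorProduct.smul_tmul_smul, pow_add]
    | zero => simp
    | add x y _ _ hx hy => rw [map_add, smul_add, hx, hy]
    | smul r x _ hx => rw [map_smul, hx, smul_comm]
  exact LinearMap.congr_fun this c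

theorem DiagonalApproximation.isDGCoalgebra (D : DiagonalApproximation.{u, v} F)
    (X : TopCat.{u}) : IsDGCoalgebra (chainSign F _) (boundary F _) (D.map X) where
  parity_d := chainSign_boundary
  d_d := boundary_boundary F
  parity := D.parity
  chain := LinearMap.congr_fun (D.chain X)
  coassoc := LinearMap.congr_fun (D.coassoc X)

theorem reducedIncl_incl (d : ℤ) (x : reducedChains F X d) :
    reducedIncl F X (incl (reducedChains F X) d x) = x.1 := by
  let φ : ∀ d, reducedChains F X d →ₗ[F] Sing F X := fun d => (reducedSub F X d).subtype
  exact DirectSum.toModule_lof (φ := φ) F d x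

theorem augmentation_reducedIncl (x : Total (reducedChains F X)) :
    augmentation F _ (reducedIncl F X x) = 0 := by
  induction x using total_induction with
  | hi p x => rw [reducedIncl_incl]; exact x.2.2
  | ha x y hx hy => rw [map_add, map_add, hx, hy, add_zero]

theorem reducedProj_simplex (x₀ : X) {n : ℕ} (σ : Simplex (TopCat.toSSet.obj X) n) :
    ∃ y : reducedChains F X n, reducedProj F x₀ (simplex F σ) = incl (reducedChains F X) n y ∧
      y.1 = simplex F σ - augmentation F _ (simplex F σ) • simplex F (basepoint x₀) :=
  ⟨_, (Finsupp.linearCombination_single F _ _).trans (one_smul F _), rfl⟩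

theorem reducedIncl_reducedProj (x₀ : X) (c : Sing F X) :
    reducedIncl F X (reducedProj F x₀ c) =
      c - augmentation F _ c • simplex F (basepoint x₀) := by
  have : reducedIncl F X ∘ₗ reducedProj F x₀ = LinearMap.id -
      (augmentation F _).smulRight (simplex F (basepoint x₀)) := by
    refine chain_hom_ext_simplex fun n σ => ?_
    obtain ⟨y, hy, hy'⟩ := reducedProj_simplex (F := F) x₀ σ
    rw [LinearMap.comp_apply, hy, reducedIncl_incl, hy']
    rfl
  exact LinearMap.congr_fun this c

theorem reducedProj_of_supported (x₀ : X) {d : ℤ} {c : Sing F X}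
    (hc : c ∈ Finsupp.supported F F {s : Σ n, Simplex (TopCat.toSSet.obj X) n | (s.1 : ℤ) = d}) :
    ∃ y : reducedChains F X d, reducedProj F x₀ c = incl (reducedChains F X) d y := by
  rw [Finsupp.supported_eq_span_single] at hc
  induction hc using Submodule.span_induction with
  | mem t ht =>
    obtain ⟨⟨n, σ⟩, hs, rfl⟩ := ht
    obtain rfl : (n : ℤ) = d := hs
    exact (reducedProj_simplex x₀ σ).imp fun _ h => h.1
  | zero => exact ⟨0, by simp⟩
  | add t t' _ _ h h' =>
    obtain ⟨y, hy⟩ := h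
    obtain ⟨y', hy'⟩ := h'
    exact ⟨y + y', by rw [map_add, map_add, hy, hy']⟩
  | smul r t _ h =>
    obtain ⟨y, hy⟩ := h
    exact ⟨r • y, by rw [map_smul, map_smul, hy]⟩

theorem reducedProj_reducedIncl (x₀ : X) (x : Total (reducedChains F X)) :
    reducedProj F x₀ (reducedIncl F X x) = x := by
  induction x using total_induction with
  | hi p x =>
    have h0 := augmentation_reducedIncl (incl (reducedChains F X) p x)
    rw [reducedIncl_incl] at h0 ⊢
    obtain ⟨y, hy⟩ := reducedProj_of_supported x₀ x.2.1
    have h1 := congrArg (reducedIncl F X) hy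
    rw [reducedIncl_reducedProj, h0, zero_smul, sub_zero, reducedIncl_incl] at h1
    rw [hy, Subtype.ext h1]
  | ha x y hx hy => rw [map_add, map_add, hx, hy]

theorem reducedProj_basepoint (x₀ : X) :
    reducedProj F x₀ (simplex F (basepoint x₀)) = 0 := by
  rw [← reducedProj_reducedIncl x₀ (reducedProj F x₀ _), reducedIncl_reducedProj,
    augmentation_simplex, if_pos rfl, one_smul, sub_self, map_zero]

theorem reducedProj_chainSign (x₀ : X) (c : Sing F X) :
    signTwist (reducedChains F X) 1 (reducedProj F x₀ c) = reducedProj F x₀ (chainSign F _ c) := by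
  have : signTwist (reducedChains F X) 1 ∘ₗ reducedProj F x₀ =
      reducedProj F x₀ ∘ₗ chainSign F _ := by
    refine chain_hom_ext_simplex fun n σ => ?_
    obtain ⟨y, hy, -⟩ := reducedProj_simplex (F := F) x₀ σ
    rw [LinearMap.comp_apply, LinearMap.comp_apply, chainSign_simplex, map_smul, hy,
      signTwist_incl, one_mul, koszulSign_natCast]
  exact LinearMap.congr_fun this c

/-- The reduced diagonal. -/
def reducedDiagonal (D : DiagonalApproximation.{u, v} F) (x₀ : X) :
    Total (reducedChains F X) →ₗ[F] Total (reducedChains F X) ⊗[F] Total (reducedChains F X) :=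
  TensorProduct.map (reducedProj F x₀) (reducedProj F x₀) ∘ₗ D.map X ∘ₗ reducedIncl F X

theorem linearPart_reducedOps (D : DiagonalApproximation.{u, v} F) (x₀ : X)
    (x : Total (reducedChains F X)) : linearPart (reducedOps F D x₀) x =
      reducedProj F x₀ (boundary F _ (reducedIncl F X x)) := by
  simp [linearPart, reducedOps]

theorem linearPart_reducedProj (D : DiagonalApproximation.{u, v} F) (x₀ : X) (c : Sing F X) :
    linearPart (reducedOps F D x₀) (reducedProj F x₀ c) = reducedProj F x₀ (boundary F _ c) := by
  rw [linearPart_reducedOps, reducedIncl_reducedProj, map_sub, map_smul, boundary_vertex,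
    smul_zero, sub_zero]

/-- The diagonal sends x₀ to x₀ ⊗ x₀, which the projection kills. So the base point spans a coideal.
-/
theorem reducedDiagonal_reducedProj (D : DiagonalApproximation.{u, v} F) (x₀ : X) (c : Sing F X) :
    reducedDiagonal D x₀ (reducedProj F x₀ c) =
      TensorProduct.map (reducedProj F x₀) (reducedProj F x₀) (D.map X c) := by
  rw [reducedDiagonal, LinearMap.comp_apply, LinearMap.comp_apply, reducedIncl_reducedProj,
    map_sub, map_sub, map_smul, map_smul, D.vertex, TensorProduct.map_tmul, reducedProj_basepoint,
    TensorProduct.zero_tmul, smul_zero, sub_zero]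

theorem augmentation_boundary (c : SChain F K) : augmentation F K (boundary F K c) = 0 := by
  have : augmentation F K ∘ₗ boundary F K = 0 := by
    refine chain_hom_ext_simplex fun n σ => ?_
    rw [LinearMap.comp_apply, boundary, Finsupp.linearCombination_single, one_smul]
    rcases n with _ | _ | n
    · simp [boundarySimplex]
    · simp only [boundarySimplex, map_sum, map_smul, augmentation_simplex]
      simp [Fin.sum_univ_two]
    · simp only [boundarySimplex, map_sum, map_smul, augmentation_simplex]
      simp
  exact LinearMap.congr_fun this c

theorem reducedIncl_linearPart (D : DiagonalApproximation.{u, v} F) (x₀ : X)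
    (x : Total (reducedChains F X)) :
    reducedIncl F X (linearPart (reducedOps F D x₀) x) = boundary F _ (reducedIncl F X x) := by
  rw [linearPart_reducedOps, reducedIncl_reducedProj, augmentation_boundary, zero_smul, sub_zero]

theorem reducedProj_surjective (x₀ : X) : Function.Surjective (reducedProj F x₀) :=
  fun x => ⟨_, reducedProj_reducedIncl x₀ x⟩

theorem isDGCoalgebra_reduced (D : DiagonalApproximation.{u, v} F) (x₀ : X) :
    IsDGCoalgebra (signTwist (reducedChains F X) 1) (linearPart (reducedOps F D x₀))
      (reducedDiagonal D x₀) :=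
  (D.isDGCoalgebra X).of_surjective (reducedProj_surjective x₀) (reducedProj_chainSign x₀)
    (linearPart_reducedProj D x₀) (reducedDiagonal_reducedProj D x₀)

theorem word_one {V : GradedSpace.{v, w} F} (x : Total V) :
    word V 1 ((PiTensorProduct.subsingletonEquiv (R := F) (s := fun _ : Fin 1 => Total V) 0).symm x)
      = TensorAlgebra.ι F x := by
  rw [PiTensorProduct.subsingletonEquiv_symm_apply, TensorPower.toTensorAlgebra_tprod]
  simp [TensorAlgebra.tprod_apply]

theorem word_tensorSquare {V : GradedSpace.{v, w} F} (x y : Total V) :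
    word V 2 (tensorSquare F (Total V) (x ⊗ₜ[F] y)) =
      TensorAlgebra.ι F x * TensorAlgebra.ι F y := by
  rw [← word_one x, ← word_one y]
  exact TensorPower.toTensorAlgebra_gMul _ _

theorem desusp_word_tensorSquare {V : GradedSpace.{v, w} F} (u : Total V ⊗[F] Total V) :
    desusp V (word V 2 (tensorSquare F (Total V) u)) = desuspSquare (signTwist V 1) u := by
  induction u with
  | zero => simp
  | add u v hu hv => simp only [map_add, hu, hv]
  | tmul x y =>
    rw [word_tensorSquare, desusp_mul, desusp_ι, desuspSquare_tmul]
    induction x using total_induction with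
    | hi p x =>
      rw [desuspAction_ι, lengthTwist_ι, signTwist_incl, one_mul, map_smul, smul_mul_assoc,
        mul_smul_comm]
    | ha x x' h h' => simp only [map_add, LinearMap.add_apply, add_mul, h, h']

theorem cobarMap_reducedOps (D : DiagonalApproximation.{u, v} F) (x₀ : X) {m : ℕ} (hm : 1 ≤ m)
    (x : Total (reducedChains F X)) : cobarMap (reducedOps F D x₀) m x =
      TensorAlgebra.ι F (linearPart (reducedOps F D x₀) x) +
        desuspSquare (signTwist (reducedChains F X) 1) (reducedDiagonal D x₀ x) := by
  obtain ⟨m, rfl⟩ := Nat.exists_eq_add_of_le' hm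
  have h0 : ∀ n ∈ Finset.Ico 3 (m + 1 + 2), desuspOp (reducedOps F D x₀) n x = 0 := by
    intro n hn
    obtain ⟨n, rfl⟩ := Nat.exists_eq_add_of_le' (Finset.mem_Ico.mp hn).1
    change desusp _ (word _ (n + 3) 0) = 0
    rw [map_zero, map_zero]
  rw [cobarMap_apply, Finset.sum_eq_sum_Ico_succ_bot (by omega),
    Finset.sum_eq_sum_Ico_succ_bot (by omega), Finset.sum_eq_zero h0, add_zero]
  congr 1
  · have h1 : reducedOps F D x₀ 1 x = (PiTensorProduct.subsingletonEquiv (R := F)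
        (s := fun _ : Fin 1 => Total (reducedChains F X)) 0).symm
          (reducedProj F x₀ (boundary F _ (reducedIncl F X x))) := rfl
    rw [linearPart_reducedOps, desuspOp, LinearMap.comp_apply, LinearMap.comp_apply, h1, word_one,
      desusp_ι]
  · exact desusp_word_tensorSquare _

/-- Obtained directly from the differential graded coalgebra, without passing through the Stasheff
identities. -/
theorem isCobar_reducedOps (D : DiagonalApproximation.{u, v} F) (x₀ : X) {m : ℕ} (hm : 1 ≤ m) :
    IsCobar (signTwist (reducedChains F X) 1) (linearPart (reducedOps F D x₀))
      (cobarMap (reducedOps F D x₀) m) m :=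
  (isDGCoalgebra_reduced D x₀).isCobar (signTwist_invol 1) (fun h2 => signTwist_of_two h2 1)
    (cobarMap_reducedOps D x₀ hm) m

theorem HasDegree.of_supported (y₀ : Y) {g : Sing F X →ₗ[F] Sing F Y} {r : ℤ}
    (hg : ∀ n (σ : Simplex (TopCat.toSSet.obj X) n),
      g (simplex F σ) ∈ Finsupp.supported F F {s | (s.1 : ℤ) = n + r}) :
    HasDegree (reducedProj F y₀ ∘ₗ g ∘ₗ reducedIncl F X) r := by
  intro p x
  rw [LinearMap.comp_apply, LinearMap.comp_apply, reducedIncl_incl]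
  refine reducedProj_of_supported y₀ ?_
  have hx := x.2.1
  generalize x.1 = c at hx
  rw [Finsupp.supported_eq_span_single] at hx
  induction hx using Submodule.span_induction with
  | mem t ht =>
    obtain ⟨⟨n, σ⟩, hs, rfl⟩ := ht
    obtain rfl : (n : ℤ) = p := hs
    exact hg n σ
  | zero => rw [map_zero]; exact zero_mem _
  | add t t' _ _ h h' => rw [map_add]; exact add_mem h h'
  | smul a t _ h => rw [map_smul]; exact Submodule.smul_mem _ _ h

theorem hasDegree_linearPart_reducedOps (D : DiagonalApproximation.{u, v} F) (x₀ : X) :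
    HasDegree (linearPart (reducedOps F D x₀)) (-1) := by
  have : linearPart (reducedOps F D x₀) = reducedProj F x₀ ∘ₗ boundary F _ ∘ₗ reducedIncl F X :=
    LinearMap.ext (linearPart_reducedOps D x₀)
  rw [this]
  refine HasDegree.of_supported x₀ fun n σ => ?_
  rw [boundary, Finsupp.linearCombination_single, one_smul]
  rcases n with _ | n
  · exact zero_mem _
  · exact Submodule.sum_mem _ fun i _ => Submodule.smul_mem _ _
      (Finsupp.single_mem_supported F _ (by simp))

/-- The map of reduced chains induced by a map of spaces. -/
def reducedMap (f : X ⟶ Y) (y₀ : Y) : Total (reducedChains F X) →ₗ[F] Total (reducedChains F Y) :=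
  reducedProj F y₀ ∘ₗ chainMap F (TopCat.toSSet.map f) ∘ₗ reducedIncl F X

theorem hasDegree_reducedMap (f : X ⟶ Y) (y₀ : Y) : HasDegree (reducedMap (F := F) f y₀) 0 := by
  refine HasDegree.of_supported y₀ fun n σ => ?_
  rw [chainMap_simplex]
  exact Finsupp.single_mem_supported F _ (by simp)

theorem reducedMap_reducedProj (f : X ⟶ Y) (x₀ : X) (c : Sing F X) :
    reducedMap f (f x₀) (reducedProj F x₀ c) =
      reducedProj F (f x₀) (chainMap F (TopCat.toSSet.map f) c) := by
  have h : chainMap F (TopCat.toSSet.map f) (simplex F (basepoint x₀)) =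
      simplex F (basepoint (f x₀)) := chainMap_simplex _ _
  rw [reducedMap, LinearMap.comp_apply, LinearMap.comp_apply, reducedIncl_reducedProj, map_sub,
    map_sub, map_smul, map_smul, h, reducedProj_basepoint, smul_zero, sub_zero]

theorem reducedIncl_reducedMap (f : X ⟶ Y) (y₀ : Y) (x : Total (reducedChains F X)) :
    reducedIncl F Y (reducedMap f y₀ x) =
      chainMap F (TopCat.toSSet.map f) (reducedIncl F X x) := by
  rw [reducedMap, LinearMap.comp_apply, LinearMap.comp_apply, reducedIncl_reducedProj,
    augmentation_chainMap, augmentation_reducedIncl, zero_smul, sub_zero]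

/-- With f x₀ as base point of Y the map commutes strictly with the projections, hence with the
reduced diagonals. No higher components are needed. -/
theorem isCobarMap_reducedMap (D : DiagonalApproximation.{u, v} F) (f : X ⟶ Y) (x₀ : X) {m : ℕ}
    (hm : 1 ≤ m) : IsCobarMap (signTwist (reducedChains F X) 1) (cobarMap (reducedOps F D x₀) m)
      (signTwist (reducedChains F Y) 1) (cobarMap (reducedOps F D (f x₀)) m)
      (reducedMap f (f x₀)) (TensorAlgebra.ι F ∘ₗ reducedMap f (f x₀)) m := by
  refine isCobarMap_of_strict (cobarMap_reducedOps D x₀ hm) (cobarMap_reducedOps D (f x₀) hm)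
    ?_ ?_ ?_ m <;> intro x <;> obtain ⟨c, rfl⟩ := reducedProj_surjective x₀ x
  · rw [reducedMap_reducedProj, reducedProj_chainSign, reducedProj_chainSign,
      reducedMap_reducedProj, chainSign_chainMap]
  · rw [reducedMap_reducedProj, linearPart_reducedProj, linearPart_reducedProj,
      reducedMap_reducedProj, boundary_chainMap]
  · have h : reducedMap f (f x₀) ∘ₗ reducedProj F x₀ =
        reducedProj F (f x₀) ∘ₗ chainMap F (TopCat.toSSet.map f) :=
      LinearMap.ext (reducedMap_reducedProj f x₀)
    rw [reducedMap_reducedProj, reducedDiagonal_reducedProj, reducedDiagonal_reducedProj,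
      ← LinearMap.comp_apply (TensorProduct.map _ _) (TensorProduct.map _ _),
      ← TensorProduct.map_comp, h, TensorProduct.map_comp, LinearMap.comp_apply]
    exact congrArg _ (LinearMap.congr_fun (D.natural f) c).symm

/-- A homotopy equivalence induces an equivalence of cobar constructions of reduced chains. -/
theorem isCobarEquiv_reducedMap (D : DiagonalApproximation.{u, v} F) (f : X ⟶ Y) (g : Y ⟶ X)
    (hgf : ContinuousMap.Homotopic (f ≫ g).hom (𝟙 X : X ⟶ X).hom)
    (hfg : ContinuousMap.Homotopic (g ≫ f).hom (𝟙 Y : Y ⟶ Y).hom) (x₀ : X) {m : ℕ}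
    (hm : 1 ≤ m) :
    IsCobarEquiv (reducedOps F D x₀) (reducedOps F D (f x₀)) (reducedMap f (f x₀)) m where
  cobar := isCobar_reducedOps D x₀ hm
  cobar' := isCobar_reducedOps D (f x₀) hm
  degree := hasDegree_linearPart_reducedOps D x₀
  degree' := hasDegree_linearPart_reducedOps D (f x₀)
  degree_map := hasDegree_reducedMap f (f x₀)
  map := ⟨_, isCobarMap_reducedMap D f x₀ hm⟩
  -- The homotopies need not fix base points: they are used on unreduced chains, and the result is
  -- projected.
  injective x hx := by
    rintro ⟨y, hy⟩
    obtain ⟨P, hP⟩ := exists_chainHomotopy_of_homotopy F hgf.some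
    have h1 := hP (reducedIncl F X x)
    have h2 := congrArg (reducedIncl F Y) hy
    rw [reducedIncl_linearPart, reducedIncl_reducedMap] at h2
    rw [TopCat.toSSet.map_comp, chainMap_comp, ← h2, ← boundary_chainMap, TopCat.toSSet.map_id,
      chainMap_id, ← reducedIncl_linearPart D x₀ x, hx, map_zero, map_zero, add_zero] at h1
    -- From f x = ∂y and g f x − x = ∂P x follows x = ∂(g y − P x).
    refine ⟨reducedProj F x₀ (chainMap F (TopCat.toSSet.map g) (reducedIncl F Y y) -
      P (reducedIncl F X x)), ?_⟩
    rw [linearPart_reducedProj, map_sub, ← h1, sub_sub_cancel, reducedProj_reducedIncl]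
  surjective y hy := by
    obtain ⟨P, hP⟩ := exists_chainHomotopy_of_homotopy F hfg.some
    have h1 := hP (reducedIncl F Y y)
    have h2 := reducedIncl_linearPart D (f x₀) y
    rw [hy, map_zero] at h2
    rw [TopCat.toSSet.map_comp, chainMap_comp, TopCat.toSSet.map_id, chainMap_id, ← h2, map_zero,
      add_zero] at h1
    refine ⟨reducedProj F x₀ (chainMap F (TopCat.toSSet.map g) (reducedIncl F Y y)), ?_,
      -reducedProj F (f x₀) (P (reducedIncl F Y y)), ?_⟩
    · rw [linearPart_reducedProj, boundary_chainMap, ← h2, map_zero, map_zero]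
    · rw [map_neg, linearPart_reducedProj, ← h1, map_sub, reducedProj_reducedIncl,
        reducedMap_reducedProj, neg_sub]

theorem sameInvariants_reducedOps (D : DiagonalApproximation.{u, v} F) (f : X ⟶ Y) (g : Y ⟶ X)
    (hgf : ContinuousMap.Homotopic (f ≫ g).hom (𝟙 X : X ⟶ X).hom)
    (hfg : ContinuousMap.Homotopic (g ≫ f).hom (𝟙 Y : Y ⟶ Y).hom) (x₀ : X) :
    SameInvariants (reducedOps F D x₀) (reducedOps F D (f x₀)) :=
  SameInvariants.of_isCobarEquiv fun _ hm => isCobarEquiv_reducedMap D f g hgf hfg x₀ hm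

end SingularChains

/-! ### Change of base point -/

section BasePoint

variable {F : Type v} [Field F] {Y : TopCat.{u}}

/-- The space of paths in `Y`. -/
abbrev pathSpace (Y : TopCat.{u}) : TopCat.{u} := TopCat.of C(unitInterval, Y)

/-- The evaluation of paths at a point. -/
def pathEval (Y : TopCat.{u}) (s : unitInterval) : pathSpace Y ⟶ Y :=
  TopCat.ofHom ⟨fun γ => γ s, by fun_prop⟩

/-- The inclusion of the constant paths. -/
def constPath (Y : TopCat.{u}) : Y ⟶ pathSpace Y :=
  TopCat.ofHom ContinuousMap.const'

/-- A contraction of the interval to `s` induces a deformation of the path space to the constant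
paths. -/
theorem pathEval_constPath_homotopic (s : unitInterval)
    (c : C(unitInterval × unitInterval, unitInterval)) (h0 : ∀ r, c (0, r) = s)
    (h1 : ∀ r, c (1, r) = r) :
    ContinuousMap.Homotopic (pathEval Y s ≫ constPath Y).hom (𝟙 _ : pathSpace Y ⟶ pathSpace Y).hom := by
  refine ⟨⟨⟨fun p => p.2.comp (c.curry p.1),
    continuous_snd.compCM (c.curry.continuous.comp continuous_fst)⟩, fun γ => ?_, fun γ => ?_⟩⟩
  · ext r
    exact congrArg γ (h0 r)
  · ext r
    exact congrArg γ (h1 r)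

theorem sameInvariants_pathEval (D : DiagonalApproximation.{u, v} F) (s : unitInterval)
    (c : C(unitInterval × unitInterval, unitInterval)) (h0 : ∀ r, c (0, r) = s)
    (h1 : ∀ r, c (1, r) = r) (γ : C(unitInterval, Y)) :
    SameInvariants (reducedOps F D (X := pathSpace Y) γ) (reducedOps F D (γ s)) :=
  sameInvariants_reducedOps D (pathEval Y s) (constPath Y)
    (pathEval_constPath_homotopic s c h0 h1) (ContinuousMap.Homotopic.refl _) γ

/-- The identity of Y does not carry y to y'. Instead a path γ from y to y' serves as base point of
the path space: evaluation at either end is a homotopy equivalence, and it takes γ exactly to y or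
to y'. -/
theorem sameInvariants_of_joined (D : DiagonalApproximation.{u, v} F) {y y' : Y}
    (h : Joined y y') : SameInvariants (reducedOps F D y) (reducedOps F D y') := by
  obtain ⟨γ⟩ := h
  -- The contractions of the interval are (s, r) ↦ s r to 0 and, below, (s, r) ↦ 1 − s(1 − r) to 1.
  have h0 := sameInvariants_pathEval D (Y := Y) 0 ⟨fun p => p.1 * p.2, by fun_prop⟩
    (fun r => zero_mul r) (fun r => one_mul r) γ.toContinuousMap
  have h1 := sameInvariants_pathEval D (Y := Y) 1
    ⟨fun p => unitInterval.symm (p.1 * unitInterval.symm p.2), by fun_prop⟩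
    (fun r => by simp) (fun r => by simp) γ.toContinuousMap
  have e0 : γ.toContinuousMap 0 = y := γ.source
  have e1 : γ.toContinuousMap 1 = y' := γ.target
  rw [e0] at h0
  rw [e1] at h1
  exact h0.symm.trans h1

end BasePoint

theorem sameInvariants_of_homotopyEquiv {F : Type v} [Field F]
    (D : DiagonalApproximation.{u, v} F) {X Y : TopCat.{u}} (h : ContinuousMap.HomotopyEquiv X Y)
    (x₀ : X) : SameInvariants (reducedOps F D x₀) (reducedOps F D (h x₀)) :=
  sameInvariants_reducedOps D (TopCat.ofHom h.toFun) (TopCat.ofHom h.invFun) h.left_inv h.right_inv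
    x₀

end AInfty

end

/-! ### Invariance of k and of the kernel dimensions -/

theorem mainTheorem2 {F : Type v} [Field F] (D : AInfty.DiagonalApproximation.{u, v} F) :
    (∀ (X : TopCat.{u}) (x₀ : X)
      (Δ Δ' : AInfty.Ops (AInfty.reducedHomology F X) (AInfty.reducedHomology F X)),
      AInfty.IsTransferred D x₀ Δ → AInfty.IsTransferred D x₀ Δ' →
        AInfty.firstNonzero Δ = AInfty.firstNonzero Δ' ∧
        ∀ m : ℕ, 1 ≤ m → (m : ℕ∞) ≤ AInfty.firstNonzero Δ → ∀ p : ℕ,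
          Module.rank F (AInfty.kerAt Δ m p) = Module.rank F (AInfty.kerAt Δ' m p)) ∧
    (∀ (X Y : TopCat.{u}) (x₀ : X) (y₀ : Y) (h : ContinuousMap.HomotopyEquiv X Y),
      Joined (h x₀) y₀ →
      ∀ (Δ : AInfty.Ops (AInfty.reducedHomology F X) (AInfty.reducedHomology F X))
        (Δ' : AInfty.Ops (AInfty.reducedHomology F Y) (AInfty.reducedHomology F Y)),
      AInfty.IsTransferred D x₀ Δ → AInfty.IsTransferred D y₀ Δ' →
        AInfty.firstNonzero Δ = AInfty.firstNonzero Δ' ∧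
        ∀ m : ℕ, 1 ≤ m → (m : ℕ∞) ≤ AInfty.firstNonzero Δ → ∀ p : ℕ,
          Module.rank F (AInfty.kerAt Δ m p) = Module.rank F (AInfty.kerAt Δ' m p)) := by
  refine ⟨fun X x₀ Δ Δ' hΔ hΔ' => ?_, fun X Y x₀ y₀ h hj Δ Δ' hΔ hΔ' => ?_⟩
  · exact (hΔ.quasiIso.sameInvariants.trans hΔ'.quasiIso.sameInvariants.symm).conclusion
      hΔ.coalgebra hΔ.minimal hΔ'.coalgebra hΔ'.minimal
  -- The invariants pass from Δ to chains of (X, x₀), then of (Y, h x₀), then of (Y, y₀), and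
  -- finally to Δ'.
  · exact ((hΔ.quasiIso.sameInvariants.trans (AInfty.sameInvariants_of_homotopyEquiv D h x₀)).trans
      ((AInfty.sameInvariants_of_joined D hj).trans hΔ'.quasiIso.sameInvariants.symm)).conclusion
      hΔ.coalgebra hΔ.minimal hΔ'.coalgebra hΔ'.minimal
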